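/- **Setting.** Let $R=R_V\cup R_E$ be the finite set of vertices and edges of a quantum field theory. For $r\in R$ let $N_e(r)$ be the number of lines of type $e\in R_E$ attached to $r$ (an edge of type $e$ has two lines of type $e$ and no others) and $N(r)=\sum_e N_e(r)$. A vertex $v$ is determined by the numbers $N_e(v)$, and $N(v)\ge 3$. A Feynman graph is a finite graph built from these vertices and edges, with external lines but no external vertices (multiple lines and self-loops are allowed); it is 1PI if it is connected, is not a tree, and is not disconnected by cutting one internal line. Its residue $\mathrm{res}(\Gamma)$ is the element of $R$ (if any) having the same external lines, $L(\Gamma)$ is its loop number, and $\mathrm{Sym}(\Gamma)$ is the number of its automorphisms that fix the external lines. Let $H$ be the free commutative $\mathbb Q$-algebra on the isomorphism classes (ignoring labels of the external lines) of 1PI graphs with residue in $R$, graded by the loop number, with counit $\epsilon(\Gamma)=0$ and coproduct $\Delta(\Gamma)=\Gamma\otimes 1+1\otimes\Gamma+\sum_{\emptyset\ne\gamma\subsetneq\Gamma}\gamma\otimes\Gamma/\gamma$, where $\gamma$ runs over the disjoint unions of 1PI subgraphs with residue in $R$ and, in $\Gamma/\gamma$, each component of $\gamma$ is replaced by its residue.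 For characters put $\phi*\psi=(\phi\otimes\psi)\circ\Delta$. The Green's functions are $$G^r=1\pm\sum_{\mathrm{res}(\Gamma)=r}\frac{\Gamma}{\mathrm{Sym}(\Gamma)}=\sum_{L\ge 0}G^r_L ,$$ with $+$ if $r$ is a vertex and $-$ if it is an edge. The sum is over isomorphism classes of 1PI graphs whose external lines are labelled by the lines of $r$, and $G^r_L$ is the part of loop order $L$. Rational powers of series starting with $1$ are defined by the binomial series, order by order. Put $$X_v=\Big(\frac{G^v}{\prod_e(G^e)^{N_e(v)/2}}\Big)^{1/(N(v)-2)}\qquad(v\in R_V),$$ and let $I=\langle X_v-X_{v'}\rangle_{v,v'\in R_V}$ be the ideal of $H$ generated by the loop-order components of the $X_v-X_{v'}$. Let $K=\mathbb C((z))$, let $U:H\to K$ be an algebra map, and let $U=C^{-1}*R$ be its Birkhoff decomposition. That is, $C,R:H\to K$ are algebra maps with $R=C*U$, with $C(x)\in z^{-1}\mathbb C[z^{-1}]$ whenever $\epsilon(x)=0$, and with $R(x)\in\mathbb C[[z]]$ for all $x$. For $\phi\in\{U,C,R\}$, introduce the coupling constant $g$ as a formal variable. The Feynman rules give each vertex $v$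 of a graph a factor $g^{N(v)-2}$, so $$\phi(G^r)(g)=g^{N(r)-2}\pm\sum_{\mathrm{res}(\Gamma)=r}g^{\sum_{v\in\Gamma}(N(v)-2)}\,\frac{\phi(\Gamma)}{\mathrm{Sym}(\Gamma)}\in K[[g]];$$ the exponent equals $2L(\Gamma)+N(r)-2$. Put $Z^e=C(G^e)(g)$ and let $g_0=C(X_v)\,g$ be the bare coupling constant, where $C(X_v)=\sum_L C\big((X_v)_L\big)g^{2L}$ and $(X_v)_L$ is the component of $X_v$ of loop order $L$. **Corollary (Dyson's formula).** Suppose that $U$ vanishes on $I$, as the Slavnov–Taylor identities give. Then $C$ and $R$ vanish on $I$, so that $U=C^{-1}*R$ is the Birkhoff decomposition on $H/I$. Moreover, for every $r\in R$ and every $v\in R_V$, $$R(G^r)(g)=\prod_e\big(Z^e\big)^{N_e(r)/2}\;U(G^r)(g_0)\qquad\text{in }K[[g]].$$ -/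

import Mathlib

open scoped TensorProduct

noncomputable section

namespace FeynmanHopf

/-! ## Involutions -/

open Classical in
/-- `other r x` is the element distinct from `x` that is `r`-related to `x` if there is one,
and `x` otherwise. It is only used for equivalence relations with classes of at most two elements. -/
def other {α : Type} (r : α → α → Prop) (x : α) : α :=
  if h : ∃ y, y ≠ x ∧ r x y then h.choose else x

/-- A relation is a pairing if it is an equivalence relation with classes of at most two elements. -/
structure IsPairing {α : Type} (r : α → α → Prop) : Prop where
  equiv : Equivalence r
  two : ∀ x y z, r x y → r x z → y ≠ x → z ≠ x → y = z

theorem other_rel {α : Type} {r : α → α → Prop} (hr : ∀ x, r x x) (x : α) : r x (other r x) := by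
  unfold other
  split_ifs with h
  · exact h.choose_spec.2
  · exact hr x

theorem other_other {α : Type} {r : α → α → Prop} (hr : IsPairing r) (x : α) :
    other r (other r x) = x := by
  by_cases h : ∃ y, y ≠ x ∧ r x y
  · have e : other r x = h.choose := by simp only [other, dif_pos h]
    have h1 := h.choose_spec.1
    have h2 := h.choose_spec.2
    rw [e]
    have h' : ∃ y, y ≠ h.choose ∧ r h.choose y := ⟨x, h1.symm, hr.equiv.symm h2⟩
    have e' : other r h.choose = h'.choose := by simp only [other, dif_pos h']
    rw [e']
    exact hr.two h.choose _ _ h'.choose_spec.2 (hr.equiv.symm h2) h'.choose_spec.1 h1.symm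
  · have e : other r x = x := by simp only [other, dif_neg h]
    rw [e, e]

/-- The involution that swaps the two elements of each two-element class of a pairing. -/
def otherPerm {α : Type} (r : α → α → Prop) (hr : IsPairing r) : Equiv.Perm α :=
  ⟨other r, other r, other_other hr, other_other hr⟩

/-- For involutions `σ`, `τ`, a cycle of `τ * σ` contains at most two fixed points of `τ`. -/
theorem sameCycle_two {α : Type} (σ τ : Equiv.Perm α) (hσ : ∀ x, σ (σ x) = x)
    (hτ : ∀ x, τ (τ x) = x) (x y z : α) (hx : τ x = x) (hy : τ y = y) (hz : τ z = z)
    (hxy : (τ * σ).SameCycle x y) (hxz : (τ * σ).SameCycle x z) (hyx : y ≠ x) (hzx : z ≠ x) :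
    y = z := by
  have hs : σ * σ = 1 := by ext a; simp [hσ]
  have ht : τ * τ = 1 := by ext a; simp [hτ]
  have hti : τ⁻¹ = τ := inv_eq_of_mul_eq_one_left ht
  have hsi : σ⁻¹ = σ := inv_eq_of_mul_eq_one_left hs
  have hconj : τ * (τ * σ) * τ⁻¹ = (τ * σ)⁻¹ := by
    rw [mul_inv_rev, hti, hsi, ← mul_assoc, ht, one_mul]
  have key2 : ∀ i : ℤ, τ (((τ * σ) ^ i) x) = ((τ * σ) ^ (-i)) x := by
    intro i
    have h1 : τ * (τ * σ) ^ i * τ⁻¹ = (τ * σ) ^ (-i) := by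
      rw [← conj_zpow, hconj, inv_zpow, zpow_neg]
    have h2 := congrArg (fun p : Equiv.Perm α => p x) h1
    simp only [Equiv.Perm.mul_apply, hti, hx] at h2
    exact h2
  obtain ⟨i, rfl⟩ := hxy
  obtain ⟨j, rfl⟩ := hxz
  set π := τ * σ with hπ
  have hi : (π ^ (2 * i)) x = x := by
    have h := key2 i
    rw [hy] at h
    rw [two_mul, zpow_add, Equiv.Perm.mul_apply, h, ← Equiv.Perm.mul_apply, ← zpow_add]
    simp
  have hj : (π ^ (2 * j)) x = x := by
    have h := key2 j
    rw [hz] at h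
    rw [two_mul, zpow_add, Equiv.Perm.mul_apply, h, ← Equiv.Perm.mul_apply, ← zpow_add]
    simp
  -- the stabilizer of `x` in `ℤ`
  let S : AddSubgroup ℤ :=
    { carrier := {n | (π ^ n) x = x}
      zero_mem' := by simp
      add_mem' := by
        intro a b ha hb
        simp only [Set.mem_ofPred_eq] at ha hb ⊢
        rw [zpow_add, Equiv.Perm.mul_apply, hb, ha]
      neg_mem' := by
        intro a ha
        simp only [Set.mem_ofPred_eq] at ha ⊢
        rw [zpow_neg, Equiv.Perm.inv_eq_iff_eq, ha] }
  obtain ⟨p, hp⟩ := Int.subgroup_cyclic S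
  have mem : ∀ n, n ∈ S ↔ p ∣ n := by
    intro n
    rw [hp, ← AddSubgroup.zmultiples_eq_closure, Int.mem_zmultiples_iff]
  have hi' : p ∣ 2 * i := (mem _).1 hi
  have hj' : p ∣ 2 * j := (mem _).1 hj
  have hin : ¬ p ∣ i := fun h => hyx ((mem i).2 h)
  have hjn : ¬ p ∣ j := fun h => hzx ((mem j).2 h)
  have hd : p ∣ i - j := by
    obtain ⟨a, ha⟩ := hi'
    obtain ⟨b, hb⟩ := hj'
    rcases Int.even_or_odd' a with ⟨a', rfl | rfl⟩
    · exact absurd ⟨a', by linarith⟩ hin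
    · rcases Int.even_or_odd' b with ⟨b', rfl | rfl⟩
      · exact absurd ⟨b', by linarith⟩ hjn
      · exact ⟨a' - b', by linarith⟩
  have hS : (π ^ (i - j)) x = x := (mem _).2 hd
  have : (π ^ i) x = (π ^ j) ((π ^ (i - j)) x) := by
    rw [← Equiv.Perm.mul_apply, ← zpow_add]; congr 2; ring
  rw [this, hS]

/-! ## Quantum field theories and Feynman graphs -/

/-- The combinatorial datum of a quantum field theory: the set `R = R_V ∪ R_E` of vertices and edges.
A vertex is determined by the number `N v e` of lines of each type `e` attached to it, and has
valence at least three. -/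
structure FieldTheory where
  Vert : Type
  Edge : Type
  [finVert : Finite Vert]
  [fintypeEdge : Fintype Edge]
  N : Vert → Edge → ℕ
  N_injective : Function.Injective N
  three_le : ∀ v, 3 ≤ ∑ e, N v e

attribute [instance] FieldTheory.finVert FieldTheory.fintypeEdge

namespace FieldTheory

variable (T : FieldTheory)

/-- The set `R = R_V ∪ R_E`. -/
abbrev R : Type := T.Vert ⊕ T.Edge

open Classical in
/-- `N_e(r)`, the number of lines of type `e` attached to `r ∈ R`; an edge of type `e` has two
lines of type `e`. -/
def lines : T.R → T.Edge → ℕ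
  | Sum.inl v, e => T.N v e
  | Sum.inr e', e => if e = e' then 2 else 0

/-- `N(r)`, the total number of lines attached to `r ∈ R`. -/
def valence (r : T.R) : ℕ := ∑ e, T.lines r e

/-- The external lines of the vertex or edge `r`, labelled. -/
abbrev Slot (r : T.R) : Type := Σ e : T.Edge, Fin (T.lines r e)

end FieldTheory

/-- A Feynman graph, given by its vertices, its half-lines, and the involution `σ` of the half-lines.
An internal line is a pair `{h, σ h}` with `σ h ≠ h`; an external line is a fixed point of `σ`.
Multiple lines and self-loops are allowed. -/
structure Graph (T : FieldTheory) where
  Vx : Type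
  Hf : Type
  [finVx : Finite Vx]
  [finHf : Finite Hf]
  typ : Vx → T.Vert
  src : Hf → Vx
  lbl : Hf → T.Edge
  σ : Equiv.Perm Hf
  σ_σ : ∀ h, σ (σ h) = h
  lbl_σ : ∀ h, lbl (σ h) = lbl h
  valence : ∀ w e, Nat.card {h : Hf // src h = w ∧ lbl h = e} = T.N (typ w) e

attribute [instance] Graph.finVx Graph.finHf

namespace Graph

variable {T : FieldTheory} (Γ : Graph T)

/-- External lines. -/
abbrev Ext : Type := {h : Γ.Hf // Γ.σ h = h}

/-- `Γ` is connected after cutting the internal lines in `D`. -/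
def ConnectedWithout (D : Set Γ.Hf) : Prop :=
  Nonempty Γ.Vx ∧ ∀ a b, Relation.ReflTransGen
    (fun a b => ∃ h, Γ.σ h ≠ h ∧ h ∉ D ∧ Γ.src h = a ∧ Γ.src (Γ.σ h) = b) a b

/-- The number of internal lines. -/
def numLines : ℕ := Nat.card {h : Γ.Hf // Γ.σ h ≠ h} / 2

/-- The loop number of a connected graph. -/
def loops : ℕ := Γ.numLines + 1 - Nat.card Γ.Vx

/-- One-particle irreducible: connected, not a tree, and not disconnected by cutting a single
internal line. -/
structure OnePI : Prop where
  connected : Γ.ConnectedWithout ∅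
  not_tree : Γ.loops ≠ 0
  cut : ∀ h, Γ.σ h ≠ h → Γ.ConnectedWithout {h, Γ.σ h}

/-- `res(Γ) = r`: collapsing `Γ` to a point leaves the external lines of `r`. -/
def HasResidue (r : T.R) : Prop :=
  ∀ e, Nat.card {h : Γ.Ext // Γ.lbl h.1 = e} = T.lines r e

/-- A 1PI graph with residue in `R`. -/
def IsGenerator : Prop := Γ.OnePI ∧ ∃ r, Γ.HasResidue r

/-- The number of coupling constants that the Feynman rules assign to `Γ`: each vertex `v`
carries `g ^ (N(v) - 2)`. -/
def couplingOrder : ℕ := ∑ᶠ w : Γ.Vx, (T.valence (Sum.inl (Γ.typ w)) - 2)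

/-- Isomorphisms of Feynman graphs; external lines may be permuted. -/
structure Iso (Γ Γ' : Graph T) where
  vx : Γ.Vx ≃ Γ'.Vx
  hf : Γ.Hf ≃ Γ'.Hf
  typ_vx : ∀ w, Γ'.typ (vx w) = Γ.typ w
  src_hf : ∀ h, Γ'.src (hf h) = vx (Γ.src h)
  lbl_hf : ∀ h, Γ'.lbl (hf h) = Γ.lbl h
  σ_hf : ∀ h, Γ'.σ (hf h) = hf (Γ.σ h)

namespace Iso

variable {Γ}

def refl (Γ : Graph T) : Iso Γ Γ :=
  ⟨Equiv.refl _, Equiv.refl _, fun _ => rfl, fun _ => rfl, fun _ => rfl, fun _ => rfl⟩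

def symm {Γ' : Graph T} (φ : Iso Γ Γ') : Iso Γ' Γ where
  vx := φ.vx.symm
  hf := φ.hf.symm
  typ_vx w := by rw [← φ.typ_vx, Equiv.apply_symm_apply]
  src_hf h := by
    apply φ.vx.injective
    rw [← φ.src_hf, Equiv.apply_symm_apply, Equiv.apply_symm_apply]
  lbl_hf h := by rw [← φ.lbl_hf, Equiv.apply_symm_apply]
  σ_hf h := by
    apply φ.hf.injective
    rw [← φ.σ_hf, Equiv.apply_symm_apply, Equiv.apply_symm_apply]

def trans {Γ' Γ'' : Graph T} (φ : Iso Γ Γ') (ψ : Iso Γ' Γ'') : Iso Γ Γ'' where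
  vx := φ.vx.trans ψ.vx
  hf := φ.hf.trans ψ.hf
  typ_vx w := by simp [ψ.typ_vx, φ.typ_vx]
  src_hf h := by simp [ψ.src_hf, φ.src_hf]
  lbl_hf h := by simp [ψ.lbl_hf, φ.lbl_hf]
  σ_hf h := by simp [ψ.σ_hf, φ.σ_hf]

end Iso

/-- `Sym(Γ)`: the number of automorphisms of `Γ` that leave the external lines fixed. -/
def symFactor : ℕ := Nat.card {φ : Iso Γ Γ // ∀ h, Γ.σ h = h → φ.hf h = h}

/-! ### Subgraphs and contraction -/

/-- A subgraph: a set of vertices together with a set of internal lines between them. -/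
structure Piece where
  verts : Set Γ.Vx
  halves : Set Γ.Hf
  internal : ∀ h ∈ halves, Γ.σ h ≠ h
  σ_mem : ∀ h ∈ halves, Γ.σ h ∈ halves
  src_mem : ∀ h ∈ halves, Γ.src h ∈ verts

namespace Piece

variable {Γ} (p : Γ.Piece)

/-- The half-lines by which `p` is attached to the rest of `Γ`. -/
def IsLeg (h : Γ.Hf) : Prop := Γ.src h ∈ p.verts ∧ h ∉ p.halves

open Classical in
/-- The involution of the half-lines of a subgraph. -/
def invol (h : {h : Γ.Hf // Γ.src h ∈ p.verts}) : {h : Γ.Hf // Γ.src h ∈ p.verts} :=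
  if hh : h.1 ∈ p.halves then ⟨Γ.σ h.1, p.src_mem _ (p.σ_mem _ hh)⟩ else h

theorem invol_pos {h : {h : Γ.Hf // Γ.src h ∈ p.verts}} (hh : h.1 ∈ p.halves) :
    p.invol h = ⟨Γ.σ h.1, p.src_mem _ (p.σ_mem _ hh)⟩ := dif_pos hh

theorem invol_neg {h : {h : Γ.Hf // Γ.src h ∈ p.verts}} (hh : h.1 ∉ p.halves) :
    p.invol h = h := dif_neg hh

theorem invol_invol (h : {h : Γ.Hf // Γ.src h ∈ p.verts}) : p.invol (p.invol h) = h := by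
  by_cases hh : h.1 ∈ p.halves
  · have h2 : (p.invol h).1 ∈ p.halves := by rw [p.invol_pos hh]; exact p.σ_mem _ hh
    rw [p.invol_pos h2]
    apply Subtype.ext
    simp only [p.invol_pos hh, Γ.σ_σ]
  · rw [p.invol_neg hh, p.invol_neg hh]

/-- A subgraph as a Feynman graph: the half-lines of its vertices that do not belong to one of its
lines become its external lines. -/
def toGraph : Graph T where
  Vx := p.verts
  Hf := {h : Γ.Hf // Γ.src h ∈ p.verts}
  typ w := Γ.typ w.1
  src h := ⟨Γ.src h.1, h.2⟩
  lbl h := Γ.lbl h.1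
  σ := ⟨p.invol, p.invol, p.invol_invol, p.invol_invol⟩
  σ_σ h := p.invol_invol h
  lbl_σ h := by
    change Γ.lbl (p.invol h).1 = _
    by_cases hh : h.1 ∈ p.halves
    · rw [p.invol_pos hh]; exact Γ.lbl_σ h.1
    · rw [p.invol_neg hh]
  valence w e := by
    rw [← Γ.valence w.1 e]
    refine Nat.card_congr ⟨fun h => ⟨h.1.1, congrArg Subtype.val h.2.1, h.2.2⟩,
      fun h => ⟨⟨h.1, by rw [h.2.1]; exact w.2⟩, Subtype.ext h.2.1, h.2.2⟩,
      fun h => rfl, fun h => rfl⟩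

theorem isExt_iff (h : {h : Γ.Hf // Γ.src h ∈ p.verts}) :
    p.toGraph.σ h = h ↔ h.1 ∉ p.halves := by
  change p.invol h = h ↔ _
  constructor
  · intro hh hm
    rw [p.invol_pos hm] at hh
    exact p.internal _ hm (congrArg Subtype.val hh)
  · intro hh
    exact p.invol_neg hh

/-- External lines of the subgraph are the same as its legs. -/
theorem card_leg (e : T.Edge) :
    Nat.card {h : p.toGraph.Ext // p.toGraph.lbl h.1 = e} =
      Nat.card {h : Γ.Hf // p.IsLeg h ∧ Γ.lbl h = e} :=
  Nat.card_congr
    ⟨fun h => ⟨h.1.1.1, ⟨h.1.1.2, (p.isExt_iff h.1.1).1 h.1.2⟩, h.2⟩,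
     fun h => ⟨⟨⟨h.1, h.2.1.1⟩, (p.isExt_iff ⟨h.1, h.2.1.1⟩).2 h.2.1.2⟩, h.2.2⟩,
     fun _ => rfl, fun _ => rfl⟩

theorem lbl_of_residue {e : T.Edge} (hp : p.toGraph.HasResidue (Sum.inr e)) {h : Γ.Hf}
    (hh : p.IsLeg h) : Γ.lbl h = e := by
  by_contra hne
  have h1 := hp (Γ.lbl h)
  rw [p.card_leg] at h1
  simp only [FieldTheory.lines, if_neg hne] at h1
  rw [Nat.card_eq_zero] at h1
  rcases h1 with h1 | h1
  · exact h1.false ⟨h, hh, rfl⟩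
  · exact (not_finite_iff_infinite.2 h1) inferInstance

theorem leg_two {e : T.Edge} (hp : p.toGraph.HasResidue (Sum.inr e)) {x y z : Γ.Hf}
    (hx : p.IsLeg x) (hy : p.IsLeg y) (hz : p.IsLeg z) (hyx : y ≠ x) (hzx : z ≠ x) : y = z := by
  have h1 := hp e
  rw [p.card_leg] at h1
  simp only [FieldTheory.lines, if_true] at h1
  rw [Nat.card_eq_two_iff' ⟨x, hx, p.lbl_of_residue hp hx⟩] at h1
  have h2 := h1.unique (y₁ := ⟨y, hy, p.lbl_of_residue hp hy⟩)
    (y₂ := ⟨z, hz, p.lbl_of_residue hp hz⟩) (by simpa using hyx) (by simpa using hzx)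
  exact congrArg Subtype.val h2

end Piece

/-- The graph itself as a subgraph. -/
def whole : Γ.Piece where
  verts := Set.univ
  halves := {h | Γ.σ h ≠ h}
  internal _ hh := hh
  σ_mem h hh := by
    simp only [Set.mem_ofPred_eq, Γ.σ_σ] at hh ⊢
    exact hh.symm
  src_mem _ _ := Set.mem_univ _

/-- A disjoint union of 1PI subgraphs with residue in `R`. -/
structure Sub where
  pieces : Set Γ.Piece
  gen : ∀ p ∈ pieces, p.toGraph.IsGenerator
  disj : ∀ p ∈ pieces, ∀ q ∈ pieces, p ≠ q → Disjoint p.verts q.verts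

namespace Sub

variable {Γ} (A : Γ.Sub)

/-- Nonempty and different from `Γ`. -/
def IsProper : Prop := A.pieces ≠ ∅ ∧ A.pieces ≠ {Γ.whole}

theorem eq_of_mem {p q : Γ.Piece} (hp : p ∈ A.pieces) (hq : q ∈ A.pieces) {w : Γ.Vx}
    (h1 : w ∈ p.verts) (h2 : w ∈ q.verts) : p = q := by
  by_contra h
  exact Set.disjoint_left.1 (A.disj p hp q hq h) h1 h2

/-- The component `p` is an edge graph, i.e. its residue is an edge. -/
def IsEdgePiece (p : Γ.Piece) : Prop := p ∈ A.pieces ∧ ∃ e, p.toGraph.HasResidue (Sum.inr e)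

/-- The component `p` is a vertex graph, i.e. its residue is a vertex. -/
def IsVertexPiece (p : Γ.Piece) : Prop := p ∈ A.pieces ∧ ∃ v, p.toGraph.HasResidue (Sum.inl v)

/-- Two half-lines are the legs of the same edge graph in `A` (or equal). -/
def Through (h h' : Γ.Hf) : Prop := h = h' ∨ ∃ p, A.IsEdgePiece p ∧ p.IsLeg h ∧ p.IsLeg h'

theorem through_pairing : IsPairing A.Through where
  equiv :=
    { refl := fun _ => Or.inl rfl
      symm := by
        rintro x y (rfl | ⟨p, hp, hx, hy⟩)
        · exact Or.inl rfl
        · exact Or.inr ⟨p, hp, hy, hx⟩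
      trans := by
        rintro x y z (rfl | ⟨p, hp, hx, hy⟩) (rfl | ⟨q, hq, hy', hz⟩)
        · exact Or.inl rfl
        · exact Or.inr ⟨q, hq, hy', hz⟩
        · exact Or.inr ⟨p, hp, hx, hy⟩
        · have := A.eq_of_mem hp.1 hq.1 hy.1 hy'.1
          subst this
          exact Or.inr ⟨p, hp, hx, hz⟩ }
  two := by
    rintro x y z (rfl | ⟨p, hp, hx, hy⟩) (rfl | ⟨q, hq, hx', hz⟩) hyx hzx
    · rfl
    · exact absurd rfl hyx
    · exact absurd rfl hzx
    · have := A.eq_of_mem hp.1 hq.1 hx.1 hx'.1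
      subst this
      obtain ⟨e, he⟩ := hp.2
      exact p.leg_two he hx hy hz hyx hzx

/-- The involution that interchanges the two legs of each edge graph in `A` and fixes all other
half-lines. -/
def τ : Equiv.Perm Γ.Hf := otherPerm A.Through A.through_pairing

theorem τ_τ (h : Γ.Hf) : A.τ (A.τ h) = h := other_other A.through_pairing h

theorem lbl_τ (h : Γ.Hf) : Γ.lbl (A.τ h) = Γ.lbl h := by
  rcases other_rel A.through_pairing.equiv.refl h with h1 | ⟨p, hp, h1, h2⟩
  · exact congrArg Γ.lbl h1.symm
  · obtain ⟨e, he⟩ := hp.2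
    exact (p.lbl_of_residue he h2).trans (p.lbl_of_residue he h1).symm

/-- Half-lines of `Γ / A`: those that lie neither on a line of `A` nor at an edge graph of `A`. -/
def Survives (h : Γ.Hf) : Prop :=
  (∀ p ∈ A.pieces, h ∉ p.halves) ∧ ∀ p, A.IsEdgePiece p → Γ.src h ∉ p.verts

theorem τ_of_survives {h : Γ.Hf} (hh : A.Survives h) : A.τ h = h := by
  rcases other_rel A.through_pairing.equiv.refl h with h1 | ⟨p, hp, h1, _⟩
  · exact h1.symm
  · exact absurd h1.1 (hh.2 p hp)

/-- Two half-lines of `Γ / A` belong to the same line if one gets from one to the other by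
alternately following lines of `Γ` and passing through edge graphs of `A`. -/
def Joined (h h' : {h : Γ.Hf // A.Survives h}) : Prop := (A.τ * Γ.σ).SameCycle h.1 h'.1

theorem joined_pairing : IsPairing A.Joined where
  equiv :=
    { refl := fun _ => Equiv.Perm.SameCycle.refl _ _
      symm := fun h => Equiv.Perm.SameCycle.symm h
      trans := fun h h' => Equiv.Perm.SameCycle.trans h h' }
  two x y z hxy hxz hyx hzx := Subtype.ext <|
    sameCycle_two Γ.σ A.τ Γ.σ_σ A.τ_τ x.1 y.1 z.1 (A.τ_of_survives x.2) (A.τ_of_survives y.2)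
      (A.τ_of_survives z.2) hxy hxz (fun h => hyx (Subtype.ext h)) (fun h => hzx (Subtype.ext h))

theorem lbl_joined {h h' : {h : Γ.Hf // A.Survives h}} (hh : A.Joined h h') :
    Γ.lbl h'.1 = Γ.lbl h.1 := by
  obtain ⟨i, hi⟩ := hh
  have step : ∀ x, Γ.lbl ((A.τ * Γ.σ) x) = Γ.lbl x := fun x => by
    rw [Equiv.Perm.mul_apply, A.lbl_τ, Γ.lbl_σ]
  have step' : ∀ x, Γ.lbl ((A.τ * Γ.σ)⁻¹ x) = Γ.lbl x := fun x => by
    rw [← step ((A.τ * Γ.σ)⁻¹ x), ← Equiv.Perm.mul_apply (A.τ * Γ.σ), mul_inv_cancel,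
      Equiv.Perm.one_apply]
  have all : ∀ i : ℤ, ∀ x, Γ.lbl (((A.τ * Γ.σ) ^ i) x) = Γ.lbl x := by
    intro i
    induction i using Int.induction_on with
    | zero => intro x; simp
    | succ n ih =>
      intro x; rw [zpow_add_one, Equiv.Perm.mul_apply, ih, step]
    | pred n ih =>
      intro x; rw [zpow_sub_one, Equiv.Perm.mul_apply, ih, step']
  rw [← hi, all]

/-- The vertices of `Γ / A`: the vertices of `Γ` outside `A`, and one for each vertex graph
in `A`. -/
abbrev QVx : Type :=
  {w : Γ.Vx // ∀ p ∈ A.pieces, w ∉ p.verts} ⊕ {p : Γ.Piece // A.IsVertexPiece p}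

theorem cases (h : {h : Γ.Hf // A.Survives h}) (hp : ¬ ∀ p ∈ A.pieces, Γ.src h.1 ∉ p.verts) :
    ∃ p, A.IsVertexPiece p ∧ Γ.src h.1 ∈ p.verts := by
  push Not at hp
  obtain ⟨p, hp, hm⟩ := hp
  obtain ⟨_, r | r, hr⟩ := A.gen p hp
  · exact ⟨p, ⟨hp, r, hr⟩, hm⟩
  · exact absurd hm (h.2.2 p ⟨hp, r, hr⟩)

open Classical in
/-- The vertex of `Γ / A` to which a half-line is attached. -/
def qsrc (h : {h : Γ.Hf // A.Survives h}) : A.QVx :=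
  if hp : ∀ p ∈ A.pieces, Γ.src h.1 ∉ p.verts then Sum.inl ⟨Γ.src h.1, hp⟩
  else Sum.inr ⟨(A.cases h hp).choose, (A.cases h hp).choose_spec.1⟩

theorem qsrc_inl (h : {h : Γ.Hf // A.Survives h}) (w) :
    A.qsrc h = Sum.inl w ↔ Γ.src h.1 = w.1 := by
  unfold qsrc
  split_ifs with hp
  · simp [Subtype.ext_iff]
  · simp only [false_iff]
    intro hw
    exact hp (hw ▸ w.2)

theorem qsrc_inr (h : {h : Γ.Hf // A.Survives h}) (p) :
    A.qsrc h = Sum.inr p ↔ Γ.src h.1 ∈ p.1.verts := by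
  unfold qsrc
  split_ifs with hp
  · simp only [false_iff]
    exact hp p.1 p.2.1
  · rw [Sum.inr.injEq, Subtype.ext_iff]
    have hc := (A.cases h hp).choose_spec
    constructor
    · intro hq
      rw [← hq]
      exact hc.2
    · intro hm
      exact A.eq_of_mem hc.1.1 p.2.1 hc.2 hm

instance : Finite Γ.Piece :=
  Finite.of_injective (fun p : Γ.Piece => (p.verts, p.halves)) (by
    rintro ⟨a, b, _, _, _⟩ ⟨c, d, _, _, _⟩ h
    simp only [Prod.mk.injEq] at h
    obtain ⟨rfl, rfl⟩ := h
    rfl)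

/-- The contracted graph `Γ / A`: each vertex graph in `A` is replaced by a vertex of the type of
its residue, and each edge graph in `A`, together with the two lines attached to it, by a line of
the type of its residue. -/
def contract : Graph T where
  Vx := A.QVx
  Hf := {h : Γ.Hf // A.Survives h}
  typ := Sum.elim (fun w => Γ.typ w.1) (fun p => p.2.2.choose)
  src := A.qsrc
  lbl h := Γ.lbl h.1
  σ := otherPerm A.Joined A.joined_pairing
  σ_σ h := other_other A.joined_pairing h
  lbl_σ h := A.lbl_joined (other_rel A.joined_pairing.equiv.refl h)
  valence w e := by
    rcases w with w | p
    · rw [Sum.elim_inl, ← Γ.valence w.1 e]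
      refine Nat.card_congr ⟨fun h => ⟨h.1.1, (A.qsrc_inl h.1 w).1 h.2.1, h.2.2⟩,
        fun h => ⟨⟨h.1, fun p hp hm => w.2 p hp (h.2.1 ▸ p.src_mem _ hm),
          fun p hp hm => w.2 p hp.1 (h.2.1 ▸ hm)⟩, (A.qsrc_inl _ w).2 h.2.1, h.2.2⟩,
        fun h => rfl, fun h => rfl⟩
    · rw [Sum.elim_inr]
      have hr := p.2.2.choose_spec e
      rw [p.1.card_leg] at hr
      refine Eq.trans ?_ hr
      have hne : ∀ q, A.IsEdgePiece q → q ≠ p.1 := by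
        classical
        rintro q hq rfl
        obtain ⟨e', he'⟩ := hq.2
        have h3 := T.three_le p.2.2.choose
        have h4 : ∀ e, T.N p.2.2.choose e = T.lines (Sum.inr e') e := fun e => by
          rw [← he' e]; exact (p.2.2.choose_spec e).symm
        simp [h4, FieldTheory.lines] at h3
      refine Nat.card_congr ⟨fun h => ⟨h.1.1, ⟨(A.qsrc_inr h.1 p).1 h.2.1, h.1.2.1 _ p.2.1⟩, h.2.2⟩,
        fun h => ⟨⟨h.1, fun q hq hm => ?_, fun q hq hm => ?_⟩, (A.qsrc_inr _ p).2 h.2.1.1, h.2.2⟩,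
        fun h => rfl, fun h => rfl⟩
      · have := A.eq_of_mem hq p.2.1 (q.src_mem _ hm) h.2.1.1
        exact h.2.1.2 (this ▸ hm)
      · exact hne q hq (A.eq_of_mem hq.1 p.2.1 hm h.2.1.1)

end Sub

end Graph

/-! ## The Hopf algebra of Feynman graphs -/

/-- 1PI graphs with residue in `R`. -/
abbrev Gen (T : FieldTheory) : Type 1 := {Γ : Graph T // Γ.IsGenerator}

instance genSetoid (T : FieldTheory) : Setoid (Gen T) where
  r Γ Γ' := Nonempty (Graph.Iso Γ.1 Γ'.1)
  iseqv := ⟨fun Γ => ⟨Graph.Iso.refl Γ.1⟩, fun ⟨φ⟩ => ⟨φ.symm⟩, fun ⟨φ⟩ ⟨ψ⟩ => ⟨φ.trans ψ⟩⟩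

/-- The free commutative `ℚ`-algebra generated by all 1PI Feynman graphs with residue in `R`
(up to isomorphism). -/
abbrev H (T : FieldTheory) : Type 1 := MvPolynomial (Quotient (genSetoid T)) ℚ

variable {T : FieldTheory}

open Classical in
/-- A 1PI graph with residue in `R` as an element of `H`. (The value `0` on other graphs is never
used.) -/
def gr (Γ : Graph T) : H T :=
  if h : Γ.IsGenerator then MvPolynomial.X (Quotient.mk (genSetoid T) ⟨Γ, h⟩) else 0

/-- A disjoint union of graphs is the product in `H`. -/
def Graph.Sub.toH {Γ : Graph T} (A : Γ.Sub) : H T := ∏ᶠ p : A.pieces, gr p.1.toGraph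

/-- `Δ(Γ) = Γ ⊗ 1 + 1 ⊗ Γ + ∑_{γ ⊊ Γ} γ ⊗ Γ/γ` on a graph. -/
def coprodGraph (Γ : Graph T) : H T ⊗[ℚ] H T :=
  gr Γ ⊗ₜ 1 + 1 ⊗ₜ gr Γ + ∑ᶠ A : {A : Γ.Sub // A.IsProper}, A.1.toH ⊗ₜ[ℚ] gr A.1.contract

/-- The coproduct. -/
def Δ (T : FieldTheory) : H T →ₐ[ℚ] H T ⊗[ℚ] H T :=
  MvPolynomial.aeval fun c => coprodGraph c.out.1

/-- The counit. -/
def ε (T : FieldTheory) : H T →ₐ[ℚ] ℚ := MvPolynomial.aeval fun _ => 0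

/-- The convolution product of characters. -/
def conv {K : Type*} [CommRing K] [Algebra ℚ K] (φ ψ : H T →ₐ[ℚ] K) : H T →ₐ[ℚ] K :=
  (Algebra.TensorProduct.lift φ ψ fun _ _ => Commute.all _ _).comp (Δ T)

/-- A Laurent series in `z` without pole at `z = 0`. -/
def IsRegular (f : LaurentSeries ℂ) : Prop := ∀ n < 0, f.coeff n = 0

/-- A Laurent series in `z` that equals its pole part. -/
def IsPolePart (f : LaurentSeries ℂ) : Prop := ∀ n, 0 ≤ n → f.coeff n = 0

/-- `U = C⁻¹ * R`, i.e. `R = C * U`, is the Birkhoff decomposition of the character `U`: `R` is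
regular at `z = 0`, and `C - ε` consists of pole parts. -/
structure IsBirkhoff (U C R : H T →ₐ[ℚ] LaurentSeries ℂ) : Prop where
  conv_eq : R = conv C U
  pole : ∀ x, ε T x = 0 → IsPolePart (C x)
  regular : ∀ x, IsRegular (R x)

/-! ## Green's functions -/

/-- 1PI graphs with residue `r` and labelled external lines. -/
structure LabelledGraph (T : FieldTheory) (r : T.R) where
  graph : Graph T
  onePI : graph.OnePI
  label : graph.Ext ≃ T.Slot r
  label_lbl : ∀ h, (label h).1 = graph.lbl h.1

/-- Isomorphism of graphs with labelled external lines. -/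
instance labelledSetoid (T : FieldTheory) (r : T.R) : Setoid (LabelledGraph T r) where
  r Γ Γ' := ∃ φ : Graph.Iso Γ.graph Γ'.graph,
    ∀ (h : Γ.graph.Ext) (h' : Γ'.graph.Ext), h'.1 = φ.hf h.1 → Γ'.label h' = Γ.label h
  iseqv :=
    { refl := fun Γ => ⟨Graph.Iso.refl _, fun h h' e => by
        have : h' = h := Subtype.ext e
        rw [this]⟩
      symm := by
        rintro Γ Γ' ⟨φ, hφ⟩
        refine ⟨φ.symm, fun h h' e => (hφ h' h ?_).symm⟩
        rw [e]
        exact (φ.hf.apply_symm_apply h.1).symm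
      trans := by
        rintro Γ Γ' Γ'' ⟨φ, hφ⟩ ⟨ψ, hψ⟩
        refine ⟨φ.trans ψ, fun h h'' e => ?_⟩
        have hx : Γ'.graph.σ (φ.hf h.1) = φ.hf h.1 := by rw [φ.σ_hf, h.2]
        rw [hψ ⟨φ.hf h.1, hx⟩ h'' e, hφ h ⟨φ.hf h.1, hx⟩ rfl] }

/-- Isomorphism classes of 1PI graphs with residue `r` and labelled external lines. -/
abbrev LClass (T : FieldTheory) (r : T.R) : Type 1 := Quotient (labelledSetoid T r)

/-- `Γ / Sym(Γ)` as an element of `H`. -/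
def LClass.term {r : T.R} (c : LClass T r) : H T :=
  (c.out.graph.symFactor : ℚ)⁻¹ • gr c.out.graph

/-- The sign in the Green's function: `+` for a vertex and `-` for an edge. -/
def sign : T.R → ℤ
  | Sum.inl _ => 1
  | Sum.inr _ => -1

/-- The 1PI Green's function `G^r = 1 ± ∑_{res Γ = r} Γ / Sym(Γ)`, in the completion of `H` with
respect to the loop number: its coefficient of order `L` is the part `G^r_L` at loop order `L`. -/
def green (r : T.R) : PowerSeries (H T) :=
  1 + sign r • PowerSeries.mk fun L => ∑ᶠ c : {c : LClass T r // c.out.graph.loops = L}, c.1.term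

/-- `f ^ q = ∑ₖ (q choose k) (f - 1) ^ k` for a series `f` with constant coefficient `1` and a
rational number `q`. -/
def ratPow {A : Type*} [CommRing A] [Algebra ℚ A] (f : PowerSeries A) (q : ℚ) : PowerSeries A :=
  (PowerSeries.binomialSeries ℚ q).subst (f - 1)

/-- `X_v = (G^v / ∏_e (G^e) ^ (N_e(v) / 2)) ^ (1 / (N(v) - 2))`. -/
def Xv (v : T.Vert) : PowerSeries (H T) :=
  ratPow
    (green (Sum.inl v) *
      ratPow (∏ e, ratPow (green (Sum.inr e)) ((T.lines (Sum.inl v) e : ℚ) / 2)) (-1))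
    (1 / ((T.valence (Sum.inl v) : ℚ) - 2))

/-- The ideal `I = ⟨X_v - X_v'⟩` of `H`, generated by the components of the `X_v - X_v'` at each
loop order. -/
def stIdeal (T : FieldTheory) : Ideal (H T) :=
  Ideal.span {x | ∃ (v v' : T.Vert) (L : ℕ), x = PowerSeries.coeff L (Xv v - Xv v')}

section Coupling

variable {K : Type*} [CommRing K] [Algebra ℚ K]

/-- `φ(G^r)(g)`, a formal power series in the coupling constant `g`: a graph carries the power of
`g` that the Feynman rules assign to it, and the zeroth order term `r` carries `g ^ (N(r) - 2)`. -/
def greenAt (φ : H T →ₐ[ℚ] K) (r : T.R) : PowerSeries K :=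
  PowerSeries.X ^ (T.valence r - 2) + sign r • PowerSeries.mk fun n =>
    ∑ᶠ c : {c : LClass T r // c.out.graph.couplingOrder = n}, φ c.1.term

/-- `φ(f)(g) = ∑_L φ(f_L) g ^ (2 L)` for a series `f = ∑_L f_L` in loop order. -/
def atCoupling (φ : H T →ₐ[ℚ] K) (f : PowerSeries (H T)) : PowerSeries K :=
  PowerSeries.expand 2 two_ne_zero (PowerSeries.map (φ : H T →+* K) f)

/-- `Z^e = C(G^e)`. -/
def Z (C : H T →ₐ[ℚ] K) (e : T.Edge) : PowerSeries K := greenAt C (Sum.inr e)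

/-- The bare coupling constant `g₀ = C(X_v) g`. -/
def bareCoupling (C : H T →ₐ[ℚ] K) (v : T.Vert) : PowerSeries K :=
  atCoupling C (Xv v) * PowerSeries.X

end Coupling

end FeynmanHopf

end

/-! ### Half-line counts, isomorphisms and labelled external lines. -/

noncomputable section

namespace FeynmanHopf

open scoped Classical

variable {T : FieldTheory}

/-! The proof rests on a formula for the Green's functions of a convolution product `C * U`. The
coproduct gives a double sum over graphs `Γ` and subgraphs `γ`, with terms `C(γ) U(Γ/γ) / Sym(Γ)`.
It is reorganized by the quotient `Γ' = Γ/γ`: one recovers `Γ` by inserting at each vertex of `Γ'`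
nothing or a vertex graph, and on each line of `Γ'` a chain of any number of self-energy graphs. So
`Γ'` contributes `U(Γ')/Sym(Γ')` times `insSeries`, the product of `C(G^v)` over its vertices and of
`1/C(G^e)` over its internal lines; the inverse is the geometric series over the chain lengths,
since `G^e` is `1` minus the sum of the self-energies. This is `coeff_gs_conv`.

The symmetry factors are handled by counting isomorphisms instead of insertion places. Isomorphisms
of an insertion with `Γ` are contractions of `Γ` onto the skeleton together with isomorphisms of the
pieces (`card_iso_ins`). Contractions onto `Γ'` with chains, all of whose pieces may be contracted,
are subgraphs `A` with an isomorphism of `Γ'` with `Γ/A` (`bijective_contractIso`). The chain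
lengths are read off from `τ σ`, which follows a line of `Γ/A` through the edge graphs on it.

The definition of `X_v` says `G^v = ∏_e (G^e)^(N_e(v)/2) X_v^(N(v)-2)`. In `insSeries` the two
half-powers at an internal line cancel `1/G^e`, which leaves the half-powers of the legs of `r` and
the product of the `X_v^(N(v)-2)` (`insSeries_eq`). If the `C(X_v)` all agree with `Y` below order
`L`, Euler's relation turns this into `C(G^r) Y^(2 L(Γ'))`. As `Γ'` has at least one loop, one order
is gained: `(C * U)(G^r)(t) = C(G^r)(t) U(G^r)(t Y²)` up to and including order `L`
(`modX_gs_conv`). Since `X_v` is multiplicative in the Green's functions, the same formula holds for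
the charges (`modX_charge_conv`).

Now induct on the loop order. As `U(X_v) = U(X_v')`, the formula shows that `R = C * U` and `C` take
the same value on the component of `X_v - X_v'` of the first undecided order (`conv_coeff_Xv`). That
value is regular and a pole part, so it is zero. Hence `C` and `R` vanish on the ideal, the formula
for `G^r` holds to all orders, and `t = g²` turns it into Dyson's formula. -/

instance (Γ : Graph T) : Fintype Γ.Vx := Fintype.ofFinite _
instance (Γ : Graph T) : Fintype Γ.Hf := Fintype.ofFinite _

/-! ## Counting lines -/

namespace FieldTheory

theorem valence_edge (e : T.Edge) : T.valence (Sum.inr e) = 2 := by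
  simp [valence, lines]

theorem three_le_valence (v : T.Vert) : 3 ≤ T.valence (Sum.inl v) := T.three_le v

theorem two_le_valence (r : T.R) : 2 ≤ T.valence r := by
  rcases r with v | e
  · exact (by norm_num : 2 ≤ 3).trans (T.three_le_valence v)
  · exact (T.valence_edge e).ge

theorem card_slot (r : T.R) : Nat.card (T.Slot r) = T.valence r := by
  simp [valence, Nat.card_eq_fintype_card]

/-- An element of `R` is determined by its lines. -/
theorem lines_injective : Function.Injective (T.lines) := by
  rintro (v | e) (v' | e') h
  · exact congrArg Sum.inl (T.N_injective h)
  · have h1 : T.valence (Sum.inl v) = T.valence (Sum.inr e') := by simp only [valence, h]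
    have := T.three_le_valence v
    rw [h1, valence_edge] at this
    omega
  · have h1 : T.valence (Sum.inr e) = T.valence (Sum.inl v') := by simp only [valence, h]
    have := T.three_le_valence v'
    rw [← h1, valence_edge] at this
    omega
  · have := congrFun h e
    simp only [lines, if_true] at this
    by_cases hee : e = e'
    · rw [hee]
    · simp [hee] at this

end FieldTheory

/-- A finite type whose elements carry line types in the numbers prescribed by `r` can be
identified with the slots of `r`. -/
theorem exists_slot_equiv {X : Type} [Finite X] (l : X → T.Edge) (r : T.R)
    (h : ∀ e, Nat.card {x // l x = e} = T.lines r e) :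
    ∃ f : X ≃ T.Slot r, ∀ x, (f x).1 = l x := by
  have : ∀ e, Nonempty ({x // l x = e} ≃ Fin (T.lines r e)) := fun e => by
    rw [← h e]; exact ⟨Finite.equivFin _⟩
  exact ⟨(Equiv.sigmaFiberEquiv l).symm.trans (Equiv.sigmaCongrRight fun e => (this e).some),
    fun _ => rfl⟩

theorem card_eq_of_slot_equiv {X : Type} {l : X → T.Edge} {r : T.R} (f : X ≃ T.Slot r)
    (hf : ∀ x, (f x).1 = l x) (e : T.Edge) : Nat.card {x // l x = e} = T.lines r e := by
  rw [← Nat.card_fin (T.lines r e)]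
  refine Nat.card_congr ((f.subtypeEquiv (q := fun s => s.1 = e) fun x => by rw [hf]).trans ?_)
  exact
    { toFun := fun s => s.2 ▸ s.1.2
      invFun := fun i => ⟨⟨e, i⟩, rfl⟩
      left_inv := by rintro ⟨⟨e', i⟩, rfl⟩; rfl
      right_inv := fun i => rfl }

namespace Graph

variable (Γ : Graph T)

theorem card_src (w : Γ.Vx) :
    Nat.card {h : Γ.Hf // Γ.src h = w} = T.valence (Sum.inl (Γ.typ w)) := by
  obtain ⟨f, hf⟩ := exists_slot_equiv (fun h : {h : Γ.Hf // Γ.src h = w} => Γ.lbl h.1)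
    (Sum.inl (Γ.typ w)) (fun e => by
      rw [FieldTheory.lines, ← Γ.valence w e]
      exact Nat.card_congr (Equiv.subtypeSubtypeEquivSubtypeInter _ (fun h => Γ.lbl h = e)))
  rw [Nat.card_congr f, T.card_slot]

/-- Valence at least three excludes isolated vertices. Hence vertices can be recovered from
half-lines, and isomorphisms can be handled through half-lines alone. -/
theorem src_surjective : Function.Surjective Γ.src := by
  intro w
  have h1 : 0 < Nat.card {h : Γ.Hf // Γ.src h = w} := by
    rw [Γ.card_src]
    have := T.three_le_valence (Γ.typ w)
    omega
  have := (Nat.card_pos_iff.1 h1).1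
  exact ⟨this.some.1, this.some.2⟩

theorem card_hf : Nat.card Γ.Hf = ∑ w, T.valence (Sum.inl (Γ.typ w)) := by
  rw [Nat.card_congr (Equiv.sigmaFiberEquiv Γ.src).symm, Nat.card_sigma]
  exact Finset.sum_congr rfl fun w _ => Γ.card_src w

theorem HasResidue.unique {Γ : Graph T} {r r' : T.R} (h : Γ.HasResidue r) (h' : Γ.HasResidue r') :
    r = r' :=
  T.lines_injective (funext fun e => (h e).symm.trans (h' e))

/-- One half-line of each internal line. -/
def Oriented (h : Γ.Hf) : Prop := Finite.equivFin Γ.Hf h < Finite.equivFin Γ.Hf (Γ.σ h)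

/-- Internal lines, each represented by one of its half-lines. -/
abbrev Lines : Type := {h : Γ.Hf // Γ.Oriented h}

theorem Oriented.ne {Γ : Graph T} {h : Γ.Hf} (hh : Γ.Oriented h) : Γ.σ h ≠ h := by
  intro h1
  unfold Oriented at hh
  rw [h1] at hh
  exact lt_irrefl _ hh

theorem Oriented.not_σ {Γ : Graph T} {h : Γ.Hf} (hh : Γ.Oriented h) : ¬ Γ.Oriented (Γ.σ h) := by
  unfold Oriented at *
  rw [Γ.σ_σ]
  exact hh.asymm

theorem oriented_or {h : Γ.Hf} (hh : Γ.σ h ≠ h) : Γ.Oriented h ∨ Γ.Oriented (Γ.σ h) := by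
  unfold Oriented
  rw [Γ.σ_σ]
  exact lt_or_gt_of_ne fun h1 => hh ((Finite.equivFin Γ.Hf).injective h1).symm

/-- `σ` exchanges the oriented half-lines with the other internal ones and preserves `P`, so each
line is counted twice. -/
theorem card_internal_eq (P : Γ.Hf → Prop) (hP : ∀ h, P (Γ.σ h) ↔ P h) :
    Nat.card {h : Γ.Hf // Γ.σ h ≠ h ∧ P h} = 2 * Nat.card {h : Γ.Lines // P h.1} := by
  have h1 : {h : Γ.Hf | Γ.σ h ≠ h ∧ P h} =
      {h | Γ.Oriented h ∧ P h} ∪ Γ.σ '' {h | Γ.Oriented h ∧ P h} := by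
    ext h
    simp only [Set.mem_ofPred_eq, Set.mem_union, Set.mem_image]
    constructor
    · rintro ⟨h1, h2⟩
      rcases Γ.oriented_or h1 with h3 | h3
      · exact Or.inl ⟨h3, h2⟩
      · exact Or.inr ⟨Γ.σ h, ⟨h3, (hP h).2 h2⟩, Γ.σ_σ h⟩
    · rintro (⟨h1, h2⟩ | ⟨h', ⟨h1, h2⟩, rfl⟩)
      · exact ⟨h1.ne, h2⟩
      · exact ⟨by rw [Γ.σ_σ]; exact h1.ne.symm, (hP h').2 h2⟩
  have h2 : Disjoint {h | Γ.Oriented h ∧ P h} (Γ.σ '' {h | Γ.Oriented h ∧ P h}) := by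
    rw [Set.disjoint_left]
    rintro h ⟨h1, _⟩ ⟨h', ⟨h3, _⟩, rfl⟩
    exact h3.not_σ h1
  have h3 : Nat.card {h : Γ.Lines // P h.1} = {h | Γ.Oriented h ∧ P h}.ncard :=
    Nat.card_congr (Equiv.subtypeSubtypeEquivSubtypeInter _ P)
  change {h : Γ.Hf | Γ.σ h ≠ h ∧ P h}.ncard = _
  rw [h1, Set.ncard_union_eq h2 (Set.toFinite _) (Set.toFinite _),
    Set.ncard_image_of_injective _ Γ.σ.injective, h3]
  ring

theorem card_internal : Nat.card {h : Γ.Hf // Γ.σ h ≠ h} = 2 * Nat.card Γ.Lines := by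
  have := Γ.card_internal_eq (fun _ => True) (fun _ => Iff.rfl)
  simpa using this

theorem numLines_eq : Γ.numLines = Nat.card Γ.Lines := by
  rw [numLines, card_internal]; omega

theorem card_internal' : Nat.card {h : Γ.Hf // Γ.σ h ≠ h} = 2 * Γ.numLines := by
  rw [numLines_eq, card_internal]

theorem card_hf_eq : Nat.card Γ.Hf = Nat.card Γ.Ext + 2 * Γ.numLines := by
  rw [← card_internal', ← Nat.card_sum]
  exact Nat.card_congr (Equiv.sumCompl _).symm

namespace Iso

variable {Γ} {Γ' : Graph T}

/-- An isomorphism is determined by its effect on half-lines. -/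
theorem ext_hf {φ ψ : Iso Γ Γ'} (h : ∀ x, φ.hf x = ψ.hf x) : φ = ψ := by
  have h1 : φ.hf = ψ.hf := Equiv.ext h
  have h2 : φ.vx = ψ.vx := by
    ext w
    obtain ⟨x, rfl⟩ := Γ.src_surjective w
    rw [← φ.src_hf, ← ψ.src_hf, h]
  cases φ; cases ψ
  simp_all

instance : Finite (Iso Γ Γ') :=
  Finite.of_injective (fun φ => φ.hf) fun _ _ h => ext_hf fun x => congrArg (fun f => f x) h

/-- An isomorphism can be given by its effect on half-lines. -/
def ofHf (f : Γ.Hf ≃ Γ'.Hf) (hs : ∀ x y, Γ'.src (f x) = Γ'.src (f y) ↔ Γ.src x = Γ.src y)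
    (hl : ∀ x, Γ'.lbl (f x) = Γ.lbl x) (hσ : ∀ x, Γ'.σ (f x) = f (Γ.σ x)) : Iso Γ Γ' := by
  let g : Γ.Vx → Γ'.Vx := fun w => Γ'.src (f (Γ.src_surjective w).choose)
  have hg : ∀ x, g (Γ.src x) = Γ'.src (f x) := fun x =>
    (hs _ _).2 (Γ.src_surjective (Γ.src x)).choose_spec
  have hb : Function.Bijective g := by
    constructor
    · intro a b hab
      obtain ⟨x, rfl⟩ := Γ.src_surjective a
      obtain ⟨y, rfl⟩ := Γ.src_surjective b
      rw [hg, hg] at hab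
      exact (hs _ _).1 hab
    · intro b
      obtain ⟨y, rfl⟩ := Γ'.src_surjective b
      exact ⟨Γ.src (f.symm y), by rw [hg, f.apply_symm_apply]⟩
  -- Vertex types need no hypothesis: a type is determined by its numbers of lines, which `f`
  -- preserves.
  refine ⟨Equiv.ofBijective g hb, f, fun w => T.N_injective (funext fun e => ?_),
    fun x => (hg x).symm, hl, hσ⟩
  rw [← Γ.valence w e, ← Γ'.valence _ e]
  refine (Nat.card_congr (f.subtypeEquiv fun x => ?_)).symm
  rw [Equiv.ofBijective_apply, hl, ← hg, hb.injective.eq_iff]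

theorem σ_eq_iff (φ : Iso Γ Γ') (x : Γ.Hf) : Γ'.σ (φ.hf x) = φ.hf x ↔ Γ.σ x = x := by
  rw [φ.σ_hf, φ.hf.injective.eq_iff]

theorem connectedWithout (φ : Iso Γ Γ') {D : Set Γ.Hf} (h : Γ.ConnectedWithout D) :
    Γ'.ConnectedWithout (φ.hf.symm ⁻¹' D) := by
  obtain ⟨⟨w⟩, h⟩ := h
  refine ⟨⟨φ.vx w⟩, fun a b => ?_⟩
  have := Relation.ReflTransGen.lift (p := fun a b => ∃ h, Γ'.σ h ≠ h ∧ h ∉ φ.hf.symm ⁻¹' D ∧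
    Γ'.src h = a ∧ Γ'.src (Γ'.σ h) = b) φ.vx (fun a b => by
      rintro ⟨x, h1, h2, rfl, rfl⟩
      exact ⟨φ.hf x, fun h => h1 ((φ.σ_eq_iff x).1 h), by simpa using h2, φ.src_hf x, by
        rw [φ.σ_hf, φ.src_hf]⟩) _ _ (h (φ.vx.symm a) (φ.vx.symm b))
  simpa [Function.onFun] using this

theorem numLines_eq (φ : Iso Γ Γ') : Γ'.numLines = Γ.numLines := by
  unfold numLines
  rw [Nat.card_congr (φ.hf.subtypeEquiv (q := fun x => Γ'.σ x ≠ x)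
    fun x => not_congr (φ.σ_eq_iff x).symm)]

theorem loops_eq (φ : Iso Γ Γ') : Γ'.loops = Γ.loops := by
  unfold loops
  rw [φ.numLines_eq, Nat.card_congr φ.vx]

theorem onePI (φ : Iso Γ Γ') (h : Γ.OnePI) : Γ'.OnePI where
  connected := by simpa using φ.connectedWithout h.connected
  not_tree := by rw [φ.loops_eq]; exact h.not_tree
  cut x hx := by
    have := φ.connectedWithout (h.cut (φ.hf.symm x) (by
      rwa [Ne, ← φ.σ_eq_iff, φ.hf.apply_symm_apply]))
    convert this using 1
    ext y
    simp only [Set.mem_insert_iff, Set.mem_singleton_iff, Set.mem_preimage,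
      φ.hf.symm.injective.eq_iff]
    rw [φ.hf.symm_apply_eq, ← φ.σ_hf, φ.hf.apply_symm_apply]

theorem hasResidue (φ : Iso Γ Γ') {r : T.R} (h : Γ.HasResidue r) : Γ'.HasResidue r := by
  intro e
  rw [← h e]
  refine (Nat.card_congr (Equiv.subtypeEquiv (Equiv.subtypeEquiv φ.hf fun x =>
    (φ.σ_eq_iff x).symm) fun x => ?_)).symm
  exact iff_of_eq (congrArg (· = e) (φ.lbl_hf x.1).symm)

end Iso

end Graph

theorem gr_eq_of_iso {Γ Γ' : Graph T} (φ : Graph.Iso Γ Γ') : gr Γ = gr Γ' := by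
  unfold gr
  by_cases h : Γ.IsGenerator
  · have h' : Γ'.IsGenerator := ⟨φ.onePI h.1, h.2.imp fun _ => φ.hasResidue⟩
    rw [dif_pos h, dif_pos h']
    exact congrArg MvPolynomial.X (Quotient.sound ⟨φ⟩)
  · have h' : ¬ Γ'.IsGenerator := fun h' =>
      h ⟨φ.symm.onePI h'.1, h'.2.imp fun _ => φ.symm.hasResidue⟩
    rw [dif_neg h, dif_neg h']

/-! ## Graphs with labelled external lines -/

/-- A Feynman graph whose external lines are labelled by the lines of `r`. -/
structure LegGraph (T : FieldTheory) (r : T.R) where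
  graph : Graph T
  label : graph.Ext ≃ T.Slot r
  label_lbl : ∀ h, (label h).1 = graph.lbl h.1

namespace LegGraph

variable {r : T.R}

theorem hasResidue (Γ : LegGraph T r) : Γ.graph.HasResidue r :=
  card_eq_of_slot_equiv Γ.label Γ.label_lbl

theorem card_ext (Γ : LegGraph T r) : Nat.card Γ.graph.Ext = T.valence r := by
  rw [Nat.card_congr Γ.label, T.card_slot]

/-- Isomorphisms that preserve the labels of the external lines. -/
@[ext]
structure Iso (Γ Γ' : LegGraph T r) where
  val : Graph.Iso Γ.graph Γ'.graph
  label : ∀ (h : Γ.graph.Ext) (h' : Γ'.graph.Ext), h'.1 = val.hf h.1 → Γ'.label h' = Γ.label h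

namespace Iso

variable {Γ Γ' Γ'' : LegGraph T r}

instance : Finite (Iso Γ Γ') := Finite.of_injective Iso.val fun _ _ => Iso.ext

instance : Fintype (Iso Γ Γ') := Fintype.ofFinite _

def refl (Γ : LegGraph T r) : Iso Γ Γ := ⟨Graph.Iso.refl _, fun h h' e => by
  have : h' = h := Subtype.ext e
  rw [this]⟩

def symm (φ : Iso Γ Γ') : Iso Γ' Γ := ⟨φ.1.symm, fun h h' e => (φ.2 h' h (by
  rw [e]; exact (φ.1.hf.apply_symm_apply h.1).symm)).symm⟩

def trans (φ : Iso Γ Γ') (ψ : Iso Γ' Γ'') : Iso Γ Γ'' := ⟨φ.1.trans ψ.1, fun h h'' e => by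
  have hx : Γ'.graph.σ (φ.1.hf h.1) = φ.1.hf h.1 := by rw [φ.1.σ_hf, h.2]
  rw [ψ.2 ⟨φ.1.hf h.1, hx⟩ h'' e, φ.2 h ⟨φ.1.hf h.1, hx⟩ rfl]⟩

theorem ext_hf {φ ψ : Iso Γ Γ'} (h : ∀ x, φ.1.hf x = ψ.1.hf x) : φ = ψ :=
  Iso.ext (Graph.Iso.ext_hf h)

theorem label_symm (φ : Iso Γ Γ') (s : T.Slot r) :
    φ.1.hf (Γ.label.symm s).1 = (Γ'.label.symm s).1 := by
  have hx : Γ'.graph.σ (φ.1.hf (Γ.label.symm s).1) = φ.1.hf (Γ.label.symm s).1 := by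
    rw [φ.1.σ_hf, (Γ.label.symm s).2]
  have := φ.2 (Γ.label.symm s) ⟨_, hx⟩ rfl
  rw [Equiv.apply_symm_apply] at this
  exact congrArg Subtype.val ((Equiv.eq_symm_apply _).2 this)

/-- Composition with a fixed isomorphism. -/
def congrRight (ψ : Iso Γ' Γ'') : Iso Γ Γ' ≃ Iso Γ Γ'' where
  toFun φ := φ.trans ψ
  invFun φ := φ.trans ψ.symm
  left_inv _ := ext_hf fun _ => ψ.1.hf.symm_apply_apply _
  right_inv _ := ext_hf fun _ => ψ.1.hf.apply_symm_apply _

def congrLeft (ψ : Iso Γ Γ') : Iso Γ' Γ'' ≃ Iso Γ Γ'' where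
  toFun φ := ψ.trans φ
  invFun φ := ψ.symm.trans φ
  left_inv φ := ext_hf fun _ => congrArg φ.1.hf (ψ.1.hf.apply_symm_apply _)
  right_inv φ := ext_hf fun _ => congrArg φ.1.hf (ψ.1.hf.symm_apply_apply _)

end Iso

/-- Labels are injective on external lines, so an automorphism preserves them exactly when it fixes
every external line. -/
theorem card_iso_self (Γ : LegGraph T r) : Nat.card (Iso Γ Γ) = Γ.graph.symFactor := by
  refine Nat.card_congr ⟨fun φ => ⟨φ.1, fun x hx => ?_⟩, fun φ => ⟨φ.1, fun x x' e => ?_⟩,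
    fun _ => rfl, fun _ => rfl⟩
  · have h1 : Γ.graph.σ (φ.1.hf x) = φ.1.hf x := by rw [φ.1.σ_hf, hx]
    exact congrArg Subtype.val (Γ.label.injective (φ.2 ⟨x, hx⟩ ⟨φ.1.hf x, h1⟩ rfl))
  · rw [φ.2 x.1 x.2] at e
    rw [Subtype.ext e]

theorem symFactor_pos (Γ : LegGraph T r) : 0 < Γ.graph.symFactor := by
  rw [← card_iso_self]
  have : Nonempty (Iso Γ Γ) := ⟨Iso.refl Γ⟩
  exact Nat.card_pos

/-- The isomorphisms between isomorphic graphs are a torsor under the automorphisms; this count is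
what cancels the factors `1/Sym`. -/
theorem card_iso_of_iso {Γ Γ' : LegGraph T r} (φ : Iso Γ Γ') :
    Nat.card (Iso Γ Γ') = Γ.graph.symFactor := by
  rw [← card_iso_self]
  exact (Nat.card_congr (Iso.congrRight φ)).symm

theorem card_iso_of_iso' {Γ Γ' : LegGraph T r} (φ : Iso Γ Γ') :
    Nat.card (Iso Γ Γ') = Γ'.graph.symFactor := by
  rw [← card_iso_self]
  exact (Nat.card_congr (Iso.congrLeft φ)).symm

end LegGraph

/-- Forget that a graph is 1PI. -/
abbrev LabelledGraph.leg {r : T.R} (Γ : LabelledGraph T r) : LegGraph T r :=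
  ⟨Γ.graph, Γ.label, Γ.label_lbl⟩

theorem LabelledGraph.equiv_iff {r : T.R} {Γ Γ' : LabelledGraph T r} :
    Γ ≈ Γ' ↔ Nonempty (LegGraph.Iso Γ.leg Γ'.leg) :=
  ⟨fun ⟨φ, h⟩ => ⟨⟨φ, h⟩⟩, fun ⟨φ⟩ => ⟨φ.1, φ.2⟩⟩

namespace LegGraph

variable {r : T.R}

/-- The class of a 1PI graph with labelled external lines. -/
def cls (Γ : LegGraph T r) (h : Γ.graph.OnePI) : LClass T r :=
  Quotient.mk _ ⟨Γ.graph, h, Γ.label, Γ.label_lbl⟩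

theorem nonempty_iso_cls (Γ : LegGraph T r) (h : Γ.graph.OnePI) :
    Nonempty (Iso (Γ.cls h).out.leg Γ) :=
  LabelledGraph.equiv_iff.1 (Quotient.mk_out (s := labelledSetoid T r)
    ⟨Γ.graph, h, Γ.label, Γ.label_lbl⟩)

theorem eq_cls_of_iso {Γ : LegGraph T r} (h : Γ.graph.OnePI) {c : LClass T r}
    (φ : Iso c.out.leg Γ) : c = Γ.cls h := by
  rw [← Quotient.out_eq c]
  exact Quotient.sound (LabelledGraph.equiv_iff.2 ⟨φ⟩)

end LegGraph

end FeynmanHopf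

end

/-! ### Insertion into a skeleton and its inverse, contraction onto a skeleton. -/

noncomputable section

namespace FeynmanHopf

open scoped Classical

variable {T : FieldTheory}

/-! ## Insertion of graphs into a skeleton -/

/-- A skeleton: a graph with vertices of any type in `R`, and labelled external lines. -/
structure Skeleton (T : FieldTheory) (r : T.R) where
  V : Type
  Hf : Type
  [finV : Finite V]
  [finHf : Finite Hf]
  ty : V → T.R
  src : Hf → V
  lbl : Hf → T.Edge
  σ : Hf → Hf
  σ_σ : ∀ h, σ (σ h) = h
  lbl_σ : ∀ h, lbl (σ h) = lbl h
  valence : ∀ p e, Nat.card {h : {h : Hf // src h = p} // lbl h.1 = e} = T.lines (ty p) e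
  label : {h : Hf // σ h = h} ≃ T.Slot r
  label_lbl : ∀ h, (label h).1 = lbl h.1

attribute [instance] Skeleton.finV Skeleton.finHf

namespace Skeleton

variable {r : T.R} (Q : Skeleton T r)

instance : Fintype Q.V := Fintype.ofFinite _

/-- A labelling of the half-lines at the vertex `p`. -/
def slot (p : Q.V) : {h : Q.Hf // Q.src h = p} ≃ T.Slot (Q.ty p) :=
  -- The choice is arbitrary; it is harmless because insertion and contraction use the same
  -- labelling.
  (exists_slot_equiv _ _ (Q.valence p)).choose

theorem slot_lbl (p : Q.V) (h) : (Q.slot p h).1 = Q.lbl h.1 :=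
  (exists_slot_equiv _ _ (Q.valence p)).choose_spec h

theorem card_hf : Nat.card Q.Hf = ∑ p, T.valence (Q.ty p) := by
  rw [Nat.card_congr (Equiv.sigmaFiberEquiv Q.src).symm, Nat.card_sigma]
  exact Finset.sum_congr rfl fun p _ => by rw [Nat.card_congr (Q.slot p), T.card_slot]

/-- Connected after cutting the lines in `D`. -/
def ConnectedWithout (D : Set Q.Hf) : Prop :=
  Nonempty Q.V ∧ ∀ a b, Relation.ReflTransGen
    (fun a b => ∃ h, Q.σ h ≠ h ∧ h ∉ D ∧ Q.src h = a ∧ Q.src (Q.σ h) = b) a b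

variable {Q} (d : ∀ p, LegGraph T (Q.ty p))

/-- Half-lines of the graphs to be inserted. -/
abbrev IHf : Type := Σ p, (d p).graph.Hf

/-- The external line of an inserted graph that is attached to a half-line of the skeleton. -/
def emb (x : Q.Hf) : IHf d := ⟨Q.src x, ((d (Q.src x)).label.symm (Q.slot _ ⟨x, rfl⟩)).1⟩

/-- The form with a free vertex `p`, which avoids transport along an equality `Q.src x = p`. -/
theorem emb_eq {p : Q.V} (x : {h : Q.Hf // Q.src h = p}) :
    emb d x.1 = ⟨p, ((d p).label.symm (Q.slot p x)).1⟩ := by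
  obtain ⟨x, rfl⟩ := x
  rfl

/-- The half-line of the skeleton to which an external line of an inserted graph is attached. -/
def port (p : Q.V) (y : (d p).graph.Ext) : Q.Hf := ((Q.slot p).symm ((d p).label y)).1

theorem emb_port (p : Q.V) (y : (d p).graph.Ext) : emb d (port d p y) = ⟨p, y.1⟩ := by
  rw [port, emb_eq]
  simp

theorem port_label_symm {p : Q.V} (x : {h : Q.Hf // Q.src h = p}) :
    port d p ((d p).label.symm (Q.slot p x)) = x.1 := by
  simp [port]

/-- The involution on the half-lines after insertion. -/
def insσ (z : IHf d) : IHf d :=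
  if h : (d z.1).graph.σ z.2 = z.2 then emb d (Q.σ (port d z.1 ⟨z.2, h⟩))
  else ⟨z.1, (d z.1).graph.σ z.2⟩

theorem insσ_emb (x : Q.Hf) : insσ d (emb d x) = emb d (Q.σ x) := by
  have h : (d (emb d x).1).graph.σ (emb d x).2 = (emb d x).2 :=
    ((d (Q.src x)).label.symm (Q.slot _ ⟨x, rfl⟩)).2
  rw [insσ, dif_pos h]
  exact congrArg (fun y => emb d (Q.σ y)) (port_label_symm d ⟨x, rfl⟩)

theorem insσ_internal {p : Q.V} {y : (d p).graph.Hf} (h : (d p).graph.σ y ≠ y) :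
    insσ d ⟨p, y⟩ = ⟨p, (d p).graph.σ y⟩ := dif_neg h

/-- A half-line after insertion lies on an internal line of an inserted graph or comes from the
skeleton. -/
theorem emb_or_internal (z : IHf d) :
    (∃ x, z = emb d x) ∨ ∃ p y, (d p).graph.σ y ≠ y ∧ z = ⟨p, y⟩ := by
  obtain ⟨p, y⟩ := z
  by_cases h : (d p).graph.σ y = y
  · exact Or.inl ⟨_, (emb_port d p ⟨y, h⟩).symm⟩
  · exact Or.inr ⟨p, y, h, rfl⟩

theorem emb_injective : Function.Injective (emb d) := by
  intro x x' h
  have h1 : Q.src x = Q.src x' := congrArg Sigma.fst h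
  have h2 := emb_eq d (⟨x, h1⟩ : {h : Q.Hf // Q.src h = Q.src x'})
  rw [h, emb] at h2
  have h3 := eq_of_heq (Sigma.mk.inj h2).2
  have h4 := (Q.slot _).injective ((d (Q.src x')).label.symm.injective (Subtype.ext h3))
  exact (congrArg Subtype.val h4).symm

theorem emb_ne_internal {p : Q.V} {y : (d p).graph.Hf} (h : (d p).graph.σ y ≠ y) (x : Q.Hf) :
    emb d x ≠ ⟨p, y⟩ := by
  rintro h1
  obtain rfl : Q.src x = p := congrArg Sigma.fst h1
  have h3 := eq_of_heq (Sigma.mk.inj h1).2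
  rw [← h3] at h
  exact h ((d (Q.src x)).label.symm (Q.slot _ ⟨x, rfl⟩)).2

theorem lbl_emb (x : Q.Hf) : (d (emb d x).1).graph.lbl (emb d x).2 = Q.lbl x := by
  change (d (Q.src x)).graph.lbl ((d (Q.src x)).label.symm (Q.slot _ ⟨x, rfl⟩)).1 = _
  rw [← (d (Q.src x)).label_lbl, Equiv.apply_symm_apply, Q.slot_lbl]

theorem insσ_insσ (z : IHf d) : insσ d (insσ d z) = z := by
  rcases emb_or_internal d z with ⟨x, rfl⟩ | ⟨p, y, h, rfl⟩
  · rw [insσ_emb, insσ_emb, Q.σ_σ]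
  · rw [insσ_internal d h, insσ_internal, (d p).graph.σ_σ]
    rw [(d p).graph.σ_σ]
    exact h.symm

theorem insσ_eq_iff (z : IHf d) : insσ d z = z ↔ ∃ x, Q.σ x = x ∧ emb d x = z := by
  rcases emb_or_internal d z with ⟨x, rfl⟩ | ⟨p, y, h, rfl⟩
  · rw [insσ_emb, (emb_injective d).eq_iff]
    constructor
    · intro h
      exact ⟨x, h, rfl⟩
    · rintro ⟨x', h, h'⟩
      rwa [← emb_injective d h']
  · rw [insσ_internal d h]
    constructor
    · intro h'
      exact absurd (eq_of_heq (Sigma.mk.inj h').2) h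
    · rintro ⟨x, -, h'⟩
      exact absurd h' (emb_ne_internal d h x)

/-- The graph obtained by insertion of `d p` at each vertex `p` of the skeleton. -/
def insGraph : Graph T where
  Vx := Σ p, (d p).graph.Vx
  Hf := IHf d
  typ w := (d w.1).graph.typ w.2
  src z := ⟨z.1, (d z.1).graph.src z.2⟩
  lbl z := (d z.1).graph.lbl z.2
  σ := ⟨insσ d, insσ d, insσ_insσ d, insσ_insσ d⟩
  σ_σ := insσ_insσ d
  lbl_σ z := by
    change (d (insσ d z).1).graph.lbl (insσ d z).2 = _
    rcases emb_or_internal d z with ⟨x, rfl⟩ | ⟨p, y, h, rfl⟩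
    · rw [insσ_emb, lbl_emb, lbl_emb, Q.lbl_σ]
    · rw [insσ_internal d h]
      exact (d p).graph.lbl_σ y
  valence w e := by
    obtain ⟨p, w⟩ := w
    rw [← (d p).graph.valence w e]
    symm
    refine Nat.card_congr (Equiv.ofBijective (fun h => ⟨⟨p, h.1⟩, by rw [h.2.1], h.2.2⟩) ⟨?_, ?_⟩)
    · intro h h' hh
      exact Subtype.ext (eq_of_heq (Sigma.mk.inj (congrArg Subtype.val hh)).2)
    · rintro ⟨⟨q, y⟩, h1, h2⟩
      obtain rfl : q = p := congrArg Sigma.fst h1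
      exact ⟨⟨y, eq_of_heq (Sigma.mk.inj h1).2, h2⟩, rfl⟩

/-- External lines of the skeleton are the external lines after insertion. -/
def extEquiv : {x : Q.Hf // Q.σ x = x} ≃ (insGraph d).Ext :=
  Equiv.ofBijective (fun x => ⟨emb d x.1, (insσ_eq_iff d _).2 ⟨x.1, x.2, rfl⟩⟩)
    ⟨fun _ _ h => Subtype.ext (emb_injective d (congrArg Subtype.val h)), fun z => by
      obtain ⟨x, hx, h⟩ := (insσ_eq_iff d z.1).1 z.2
      exact ⟨⟨x, hx⟩, Subtype.ext h⟩⟩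

/-- Insertion of `d p` at each vertex `p` of the skeleton. -/
def ins : LegGraph T r where
  graph := insGraph d
  label := (extEquiv d).symm.trans Q.label
  label_lbl z := by
    obtain ⟨x, rfl⟩ := (extEquiv d).surjective z
    rw [Equiv.trans_apply, Equiv.symm_apply_apply, Q.label_lbl]
    exact (lbl_emb d x.1).symm

theorem ins_label {x : Q.Hf} (hx : Q.σ x = x) (z : (ins d).graph.Ext) (hz : z.1 = emb d x) :
    (ins d).label z = Q.label ⟨x, hx⟩ := by
  have : z = extEquiv d ⟨x, hx⟩ := Subtype.ext hz
  rw [this]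
  exact congrArg Q.label ((extEquiv d).symm_apply_apply _)

theorem card_ins_vx : Nat.card (ins d).graph.Vx = ∑ p, Nat.card (d p).graph.Vx := by
  change Nat.card (Σ p, (d p).graph.Vx) = _
  rw [Nat.card_sigma]

theorem card_ins_hf : Nat.card (ins d).graph.Hf = ∑ p, Nat.card (d p).graph.Hf := by
  change Nat.card (Σ p, (d p).graph.Hf) = _
  rw [Nat.card_sigma]

/-- Insertion of connected graphs into a connected skeleton. -/
theorem ins_connectedWithout (D : Set (IHf d))
    (hd : ∀ p, (d p).graph.ConnectedWithout {y | ⟨p, y⟩ ∈ D})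
    (hQ : Q.ConnectedWithout {x | emb d x ∈ D}) : (ins d).graph.ConnectedWithout D := by
  obtain ⟨⟨p⟩, hQ⟩ := hQ
  refine ⟨⟨(⟨p, (hd p).1.some⟩ : Σ p, (d p).graph.Vx)⟩, ?_⟩
  set rel := fun a b : (insGraph d).Vx => ∃ h, (insGraph d).σ h ≠ h ∧ h ∉ D ∧
    (insGraph d).src h = a ∧ (insGraph d).src ((insGraph d).σ h) = b with hrel
  have key : ∀ p (a b : (d p).graph.Vx), Relation.ReflTransGen rel ⟨p, a⟩ ⟨p, b⟩ := by
    intro p a b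
    refine Relation.ReflTransGen.lift (p := rel) (fun a => (⟨p, a⟩ : Σ p, (d p).graph.Vx))
      (fun a b => ?_) _ _ ((hd p).2 a b)
    rintro ⟨y, h1, h2, rfl, rfl⟩
    refine ⟨⟨p, y⟩, fun h => h1 (eq_of_heq (Sigma.mk.inj ((insσ_internal d h1).symm.trans h)).2),
      h2, rfl, ?_⟩
    change (insGraph d).src (insσ d _) = _
    rw [insσ_internal d h1]
    rfl
  -- A path in the skeleton is followed edge by edge; inside each inserted graph, `key` joins the
  -- vertex of arrival to the vertex of departure.
  have key2 : ∀ p q, ∀ (a : (d p).graph.Vx) (b : (d q).graph.Vx),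
      Relation.ReflTransGen rel ⟨p, a⟩ ⟨q, b⟩ := by
    intro p q
    induction hQ p q with
    | refl => exact key p
    | tail _ h ih =>
      obtain ⟨x, h1, h2, rfl, rfl⟩ := h
      intro a b
      refine (ih a ((insGraph d).src (emb d x)).2).trans (.trans (.single ?_)
        (key _ ((insGraph d).src (emb d (Q.σ x))).2 b))
      refine ⟨emb d x, fun h => h1 ?_, h2, rfl, ?_⟩
      · exact emb_injective d ((insσ_emb d x).symm.trans h)
      · change (insGraph d).src (insσ d _) = _
        rw [insσ_emb]
        rfl
  rintro ⟨p, a⟩ ⟨q, b⟩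
  exact key2 p q a b

/-! ## Contraction onto a skeleton -/

/-- A way to contract disjoint subgraphs of `Γ` such that the result is the skeleton `Q`. -/
structure Contraction (Q : Skeleton T r) (Γ : LegGraph T r) where
  cV : Γ.graph.Vx → Q.V
  i : Q.Hf → Γ.graph.Hf
  i_inj : Function.Injective i
  src : ∀ x, cV (Γ.graph.src (i x)) = Q.src x
  lbl : ∀ x, Γ.graph.lbl (i x) = Q.lbl x
  σ : ∀ x, Γ.graph.σ (i x) = i (Q.σ x)
  inner : ∀ h, (∀ x, i x ≠ h) → Γ.graph.σ h ≠ h ∧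
    cV (Γ.graph.src (Γ.graph.σ h)) = cV (Γ.graph.src h)
  label : ∀ (x : {x : Q.Hf // Q.σ x = x}) (h : Γ.graph.Ext), h.1 = i x.1 →
    Γ.label h = Q.label x

namespace Contraction

variable {Γ : LegGraph T r} (κ : Contraction Q Γ)

theorem ext_iff' {κ κ' : Contraction Q Γ} (h : ∀ w, κ.cV w = κ'.cV w) (h' : ∀ x, κ.i x = κ'.i x) :
    κ = κ' := by
  have h1 := funext h
  have h2 := funext h'
  cases κ; cases κ'
  simp_all

instance : Finite (Contraction Q Γ) :=
  Finite.of_injective (fun κ => (κ.cV, κ.i)) fun _ _ h =>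
    ext_iff' (congrFun (congrArg Prod.fst h)) (congrFun (congrArg Prod.snd h))

instance : Fintype (Contraction Q Γ) := Fintype.ofFinite _

/-- The subgraph that is contracted to the vertex `p`. -/
def piece (p : Q.V) : Γ.graph.Piece where
  verts := {w | κ.cV w = p}
  halves := {h | (∀ x, κ.i x ≠ h) ∧ κ.cV (Γ.graph.src h) = p}
  internal h hh := (κ.inner h hh.1).1
  σ_mem h hh := by
    refine ⟨fun x hx => hh.1 (Q.σ x) ?_, (κ.inner h hh.1).2.trans hh.2⟩
    rw [← κ.σ, hx, Γ.graph.σ_σ]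
  src_mem h hh := hh.2

theorem mem_halves {p : Q.V} {h : Γ.graph.Hf} :
    h ∈ (κ.piece p).halves ↔ (∀ x, κ.i x ≠ h) ∧ κ.cV (Γ.graph.src h) = p := Iff.rfl

theorem mem_verts {p : Q.V} {w : Γ.graph.Vx} : w ∈ (κ.piece p).verts ↔ κ.cV w = p := Iff.rfl

/-- The half-lines of the skeleton at `p` are the external lines of the piece at `p`. -/
def legEquiv (p : Q.V) : {x : Q.Hf // Q.src x = p} ≃ (κ.piece p).toGraph.Ext :=
  Equiv.ofBijective (fun x => ⟨⟨κ.i x.1, (κ.src x.1).trans x.2⟩,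
      ((κ.piece p).isExt_iff _).2 fun h => h.1 x.1 rfl⟩)
    ⟨fun _ _ h => Subtype.ext (κ.i_inj (congrArg (fun z => z.1.1) h)), fun z => by
      have h1 := ((κ.piece p).isExt_iff z.1).1 z.2
      rw [mem_halves] at h1
      have h2 : κ.cV (Γ.graph.src z.1.1) = p := z.1.2
      push Not at h1
      by_cases h3 : ∃ x, κ.i x = z.1.1
      · obtain ⟨x, hx⟩ := h3
        refine ⟨⟨x, ?_⟩, Subtype.ext (Subtype.ext hx)⟩
        rw [← κ.src, hx, h2]
      · push Not at h3
        exact absurd h2 (h1 h3)⟩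

/-- The piece contracted to `p`, with its external lines labelled. -/
def block (p : Q.V) : LegGraph T (Q.ty p) where
  graph := (κ.piece p).toGraph
  label := (κ.legEquiv p).symm.trans (Q.slot p)
  label_lbl z := by
    obtain ⟨x, rfl⟩ := (κ.legEquiv p).surjective z
    rw [Equiv.trans_apply, Equiv.symm_apply_apply, Q.slot_lbl]
    exact (κ.lbl x.1).symm

theorem block_label_symm {p : Q.V} (x : {x : Q.Hf // Q.src x = p}) :
    (((κ.block p).label.symm (Q.slot p x)).1).1 = κ.i x.1 := by
  change (((κ.legEquiv p) ((Q.slot p).symm (Q.slot p x))).1).1 = _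
  rw [Equiv.symm_apply_apply]
  rfl

/-- Isomorphisms between the inserted graphs and the contracted pieces. -/
abbrev BlockIso (d : ∀ p, LegGraph T (Q.ty p)) (κ : Contraction Q Γ) : Type :=
  ∀ p, LegGraph.Iso (d p) (κ.block p)

variable {d} {κ}

/-- The bijection of half-lines glued from isomorphisms of pieces. -/
def glueHf (ψ : BlockIso d κ) : IHf d ≃ Γ.graph.Hf :=
  (Equiv.sigmaCongrRight fun p => (ψ p).1.hf).trans
    (Equiv.sigmaFiberEquiv fun h => κ.cV (Γ.graph.src h))

def glueVx (ψ : BlockIso d κ) : (Σ p, (d p).graph.Vx) ≃ Γ.graph.Vx :=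
  (Equiv.sigmaCongrRight fun p => (ψ p).1.vx).trans (Equiv.sigmaFiberEquiv κ.cV)

theorem glueHf_mk (ψ : BlockIso d κ) (p : Q.V) (y : (d p).graph.Hf) :
    glueHf ψ ⟨p, y⟩ = ((ψ p).1.hf y).1 := rfl

theorem glueHf_emb (ψ : BlockIso d κ) (x : Q.Hf) : glueHf ψ (emb d x) = κ.i x := by
  have := LegGraph.Iso.label_symm (ψ (Q.src x)) (Q.slot _ ⟨x, rfl⟩)
  exact (congrArg Subtype.val this).trans (κ.block_label_symm ⟨x, rfl⟩)

theorem glueHf_insσ (ψ : BlockIso d κ) (z : IHf d) :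
    Γ.graph.σ (glueHf ψ z) = glueHf ψ (insσ d z) := by
  rcases emb_or_internal d z with ⟨x, rfl⟩ | ⟨p, y, h, rfl⟩
  · rw [insσ_emb, glueHf_emb, glueHf_emb, κ.σ]
  · rw [insσ_internal d h, glueHf_mk, glueHf_mk, ← (ψ p).1.σ_hf]
    have h1 : ((ψ p).1.hf y).1 ∈ (κ.piece p).halves := by
      by_contra h2
      exact h (((ψ p).1.σ_eq_iff y).1 (((κ.piece p).isExt_iff _).2 h2))
    exact (congrArg Subtype.val ((κ.piece p).invol_pos h1)).symm

/-- Isomorphisms of pieces glue to an isomorphism of graphs. -/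
def glue (ψ : BlockIso d κ) : LegGraph.Iso (ins d) Γ where
  val :=
    { vx := glueVx ψ
      hf := glueHf ψ
      typ_vx := fun w => (ψ w.1).1.typ_vx w.2
      src_hf := fun z => congrArg Subtype.val ((ψ z.1).1.src_hf z.2)
      lbl_hf := fun z => (ψ z.1).1.lbl_hf z.2
      σ_hf := glueHf_insσ ψ }
  label := by
    intro z h e
    obtain ⟨x, hx, hz⟩ := (insσ_eq_iff d z.1).1 z.2
    rw [ins_label d hx z hz.symm]
    refine κ.label ⟨x, hx⟩ h (e.trans ?_)
    rw [← hz]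
    exact glueHf_emb ψ x

/-- The effect of an isomorphism with an insertion on half-lines. -/
def isoHf (θ : LegGraph.Iso (ins d) Γ) : IHf d ≃ Γ.graph.Hf := θ.1.hf

/-- The effect of an isomorphism with an insertion on vertices. -/
def isoVx (θ : LegGraph.Iso (ins d) Γ) : (Σ p, (d p).graph.Vx) ≃ Γ.graph.Vx := θ.1.vx

theorem src_isoHf (θ : LegGraph.Iso (ins d) Γ) (z : IHf d) :
    Γ.graph.src (isoHf θ z) = isoVx θ ⟨z.1, (d z.1).graph.src z.2⟩ := θ.1.src_hf z

theorem σ_isoHf (θ : LegGraph.Iso (ins d) Γ) (z : IHf d) :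
    Γ.graph.σ (isoHf θ z) = isoHf θ (insσ d z) := θ.1.σ_hf z

theorem fst_symm_src (θ : LegGraph.Iso (ins d) Γ) (z : IHf d) :
    ((isoVx θ).symm (Γ.graph.src (isoHf θ z))).1 = z.1 := by
  rw [src_isoHf, Equiv.symm_apply_apply]

/-- The contraction determined by an isomorphism with an insertion. -/
def ofIso (θ : LegGraph.Iso (ins d) Γ) : Contraction Q Γ where
  cV w := ((isoVx θ).symm w).1
  i x := isoHf θ (emb d x)
  i_inj := (isoHf θ).injective.comp (emb_injective d)
  src x := fst_symm_src θ _
  lbl x := (θ.1.lbl_hf _).trans (lbl_emb d x)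
  σ x := (σ_isoHf θ _).trans (congrArg (isoHf θ) (insσ_emb d x))
  inner h hh := by
    obtain ⟨z, rfl⟩ := (isoHf θ).surjective h
    rcases emb_or_internal d z with ⟨x, rfl⟩ | ⟨p, y, h, rfl⟩
    · exact absurd rfl (hh x)
    · rw [σ_isoHf, insσ_internal d h, fst_symm_src, fst_symm_src]
      exact ⟨fun h' => h (eq_of_heq (Sigma.mk.inj ((isoHf θ).injective h')).2), rfl⟩
  label x h e := by
    rw [θ.2 (extEquiv d x) h e]
    exact ins_label d x.2 _ rfl

/-- The isomorphisms of pieces determined by an isomorphism with an insertion. -/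
def blockIso (θ : LegGraph.Iso (ins d) Γ) : BlockIso d (ofIso θ) := fun p =>
  ⟨Graph.Iso.ofHf
    (Equiv.ofBijective (fun y => (⟨isoHf θ ⟨p, y⟩, fst_symm_src θ ⟨p, y⟩⟩ :
        {h : Γ.graph.Hf // Γ.graph.src h ∈ ((ofIso θ).piece p).verts}))
      ⟨fun y y' h => eq_of_heq (Sigma.mk.inj ((isoHf θ).injective (congrArg Subtype.val h))).2, by
        rintro ⟨h, hh⟩
        obtain ⟨⟨q, y⟩, rfl⟩ := (isoHf θ).surjective h
        obtain rfl : q = p := (fst_symm_src θ ⟨q, y⟩).symm.trans hh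
        exact ⟨y, rfl⟩⟩)
    (by
      intro x y
      refine Subtype.ext_iff.trans ?_
      change Γ.graph.src (isoHf θ ⟨p, x⟩) = Γ.graph.src (isoHf θ ⟨p, y⟩) ↔ _
      rw [src_isoHf, src_isoHf, (isoVx θ).injective.eq_iff]
      exact ⟨fun h => eq_of_heq (Sigma.mk.inj h).2, fun h => congrArg (Sigma.mk p) h⟩)
    (fun x => θ.1.lbl_hf ⟨p, x⟩)
    (by
      intro x
      by_cases h : (d p).graph.σ x = x
      · rw [h]
        refine (((ofIso θ).piece p).isExt_iff _).2 fun h1 => h1.1 (port d p ⟨x, h⟩) ?_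
        exact congrArg (isoHf θ) (emb_port d p ⟨x, h⟩)
      · have h1 : isoHf θ ⟨p, x⟩ ∈ ((ofIso θ).piece p).halves :=
          ⟨fun x' h' => emb_ne_internal d h x' ((isoHf θ).injective h'), fst_symm_src θ ⟨p, x⟩⟩
        refine Subtype.ext ((congrArg Subtype.val (((ofIso θ).piece p).invol_pos
          (h := ⟨isoHf θ ⟨p, x⟩, fst_symm_src θ ⟨p, x⟩⟩) h1)).trans ?_)
        exact (σ_isoHf θ _).trans (congrArg (isoHf θ) (insσ_internal d h))),
   by
    intro y z e
    have h1 : z = (ofIso θ).legEquiv p ⟨port d p y, ((Q.slot p).symm ((d p).label y)).2⟩ := by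
      refine Subtype.ext (Subtype.ext ((congrArg Subtype.val e).trans ?_))
      exact congrArg (isoHf θ) (emb_port d p y).symm
    rw [h1]
    change Q.slot p (((ofIso θ).legEquiv p).symm (((ofIso θ).legEquiv p) _)) = _
    rw [Equiv.symm_apply_apply]
    exact (Q.slot p).apply_symm_apply _⟩

end Contraction

/-- Isomorphisms of an insertion with `Γ` correspond to contractions of `Γ` with isomorphisms of
the pieces. -/
def glueEquiv (Γ : LegGraph T r) :
    (Σ κ : Contraction Q Γ, Contraction.BlockIso d κ) ≃ LegGraph.Iso (ins d) Γ :=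
  Equiv.ofBijective (fun x => Contraction.glue x.2) (by
    constructor
    · rintro ⟨κ, ψ⟩ ⟨κ', ψ'⟩ h
      have hh : ∀ z, Contraction.glueHf ψ z = Contraction.glueHf ψ' z := fun z =>
        congrArg (fun θ => Contraction.isoHf θ z) h
      have hv : ∀ w, Contraction.glueVx ψ w = Contraction.glueVx ψ' w := fun w =>
        congrArg (fun θ => Contraction.isoVx θ w) h
      -- The glued isomorphism remembers the contraction: the piece of a vertex is the first
      -- component of its preimage, and `i` is the effect on the embedded skeleton half-lines.
      have hc : κ = κ' := by
        refine Contraction.ext_iff' (fun w => ?_) (fun x => ?_)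
        · obtain ⟨⟨p, u⟩, rfl⟩ := (Contraction.glueVx ψ).surjective w
          have h1 : κ.cV (Contraction.glueVx ψ ⟨p, u⟩) = p := ((ψ p).1.vx u).2
          have h2 : κ'.cV (Contraction.glueVx ψ' ⟨p, u⟩) = p := ((ψ' p).1.vx u).2
          rw [h1, hv, h2]
        · rw [← Contraction.glueHf_emb ψ, ← Contraction.glueHf_emb ψ', hh]
      subst hc
      refine congrArg _ (funext fun p => LegGraph.Iso.ext_hf fun y => Subtype.ext (hh ⟨p, y⟩))
    · intro θ
      exact ⟨⟨Contraction.ofIso θ, Contraction.blockIso θ⟩, LegGraph.Iso.ext_hf fun x => rfl⟩)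

/-- The double count behind all symmetry factors. Isomorphisms are counted on both sides, so no
quotient by automorphisms of the skeleton or of the pieces has to be described. -/
theorem card_iso_ins (Γ : LegGraph T r) :
    Nat.card (LegGraph.Iso (ins d) Γ) =
      ∑ κ : Contraction Q Γ, ∏ p, Nat.card (LegGraph.Iso (d p) (κ.block p)) := by
  rw [Nat.card_congr (glueEquiv d Γ).symm, Nat.card_sigma]
  exact Finset.sum_congr rfl fun κ _ => by rw [Nat.card_pi]

end Skeleton

end FeynmanHopf

end

/-! ### Graphs with chains of two-valent vertices on their lines. -/

noncomputable section

namespace FeynmanHopf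

open scoped Classical

variable {T : FieldTheory}

/-! ## Chains of edge graphs -/

namespace Chain

variable {r : T.R} {Γ : LegGraph T r} (n : Γ.graph.Lines → ℕ)

/-- The length of the chain on the line of a half-line. -/
def len (h : Γ.graph.Hf) : ℕ :=
  if o : Γ.graph.Oriented h then n ⟨h, o⟩
  else if o : Γ.graph.Oriented (Γ.graph.σ h) then n ⟨Γ.graph.σ h, o⟩ else 0

theorem len_line (l : Γ.graph.Lines) : len n l.1 = n l := by
  rw [len, dif_pos l.2]

theorem len_σ (h : Γ.graph.Hf) : len n (Γ.graph.σ h) = len n h := by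
  by_cases h0 : Γ.graph.σ h = h
  · rw [h0]
  · rcases Γ.graph.oriented_or h0 with o | o
    · rw [len, dif_neg o.not_σ, len, dif_pos o, dif_pos (by rwa [Γ.graph.σ_σ])]
      exact congrArg n (Subtype.ext (Γ.graph.σ_σ h))
    · have o' : ¬ Γ.graph.Oriented h := by simpa [Γ.graph.σ_σ] using o.not_σ
      rw [len, dif_pos o, len, dif_neg o', dif_pos o]

theorem len_ext {h : Γ.graph.Hf} (h0 : Γ.graph.σ h = h) : len n h = 0 := by
  have : ¬ Γ.graph.Oriented h := fun o => o.ne h0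
  rw [len, dif_neg this, dif_neg (by rwa [h0])]

theorem ne_of_len {h : Γ.graph.Hf} (h0 : 0 < len n h) : Γ.graph.σ h ≠ h := fun h1 => by
  rw [len_ext n h1] at h0
  exact lt_irrefl _ h0

/-- Half-lines of the graph with chains of `2`-valent vertices inserted on its lines:
`(h, j)` is the `j`-th half-line that one enters when following the chain from `h`. -/
abbrev CHf : Type := {x : Γ.graph.Hf × ℕ // x.2 ≤ len n x.1}

instance : Finite (CHf n) := by
  have : Finite (Σ h, Fin (len n h + 1)) := inferInstance
  refine Finite.of_injective
    (fun x : CHf n => (⟨x.1.1, ⟨x.1.2, Nat.lt_succ_of_le x.2⟩⟩ : Σ h, Fin (len n h + 1))) ?_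
  rintro ⟨⟨h, j⟩, hj⟩ ⟨⟨h', j'⟩, hj'⟩ e
  obtain ⟨rfl, e⟩ := Sigma.mk.inj e
  have := congrArg Fin.val (eq_of_heq e)
  simp only at this
  subst this
  rfl

/-- Vertices of the graph with chains inserted. -/
abbrev CV : Type := Γ.graph.Vx ⊕ Σ l : Γ.graph.Lines, Fin (n l)

def link (h : Γ.graph.Hf) (j : ℕ) (hj : j ≤ len n h) : CHf n := ⟨(h, j), hj⟩

/-- A line carrying `len` chain vertices is cut into segments `0, …, len`, and `(h, j)` is the near
end of segment `j` counted from `h`. Counted from `σ h`, the same segment has number `len - j`. -/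
def cσ (x : CHf n) : CHf n := link n (Γ.graph.σ x.1.1) (len n x.1.1 - x.1.2) (by
  rw [len_σ]; exact Nat.sub_le _ _)

theorem cσ_cσ (x : CHf n) : cσ n (cσ n x) = x := by
  obtain ⟨⟨h, j⟩, hj⟩ := x
  refine Subtype.ext (Prod.ext (Γ.graph.σ_σ h) ?_)
  change len n (Γ.graph.σ h) - (len n h - j) = j
  rw [len_σ]
  simp only at hj
  omega

theorem cσ_eq_iff (x : CHf n) : cσ n x = x ↔ Γ.graph.σ x.1.1 = x.1.1 := by
  constructor
  · intro h
    exact congrArg (fun x => x.1.1) h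
  · intro h
    refine Subtype.ext (Prod.ext h ?_)
    change len n x.1.1 - x.1.2 = x.1.2
    have := x.2
    rw [len_ext n h] at this ⊢
    omega

theorem sigma_fin_ext {l l' : Γ.graph.Lines} {i : Fin (n l)} {i' : Fin (n l')} (h : l = l')
    (hi : i.1 = i'.1) : (⟨l, i⟩ : Σ l, Fin (n l)) = ⟨l', i'⟩ := by
  subst h
  rw [Fin.ext hi]

/-- Position `0` is the original vertex, and `(h, j)` with `j > 0` sits at the `j`-th chain vertex
counted from `h`. Chain vertices are indexed from zero along the oriented half-line, which gives `j
- 1` in that direction and `len - j` in the opposite one. -/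
def csrc (x : CHf n) : CV n :=
  if h0 : x.1.2 = 0 then Sum.inl (Γ.graph.src x.1.1)
  else if o : Γ.graph.Oriented x.1.1 then Sum.inr ⟨⟨x.1.1, o⟩, ⟨x.1.2 - 1, by
    have h1 := x.2; have h2 := len_line n ⟨x.1.1, o⟩; simp only at h2; omega⟩⟩
  else Sum.inr ⟨⟨Γ.graph.σ x.1.1, (Γ.graph.oriented_or
      (ne_of_len n (lt_of_lt_of_le (Nat.pos_of_ne_zero h0) x.2))).resolve_left o⟩,
    ⟨len n x.1.1 - x.1.2, by
      have h1 := x.2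
      have h2 := len_line n ⟨Γ.graph.σ x.1.1, (Γ.graph.oriented_or
        (ne_of_len n (lt_of_lt_of_le (Nat.pos_of_ne_zero h0) x.2))).resolve_left o⟩
      have h3 := len_σ n x.1.1
      simp only at h2; omega⟩⟩

theorem csrc_eq_inl (x : CHf n) (w : Γ.graph.Vx) :
    csrc n x = Sum.inl w ↔ x.1.2 = 0 ∧ Γ.graph.src x.1.1 = w := by
  unfold csrc
  split_ifs with h0 o <;> simp [h0]

theorem csrc_eq_inr (x : CHf n) (l : Γ.graph.Lines) (i : Fin (n l)) :
    csrc n x = Sum.inr ⟨l, i⟩ ↔ x.1 = (l.1, i.1 + 1) ∨ x.1 = (Γ.graph.σ l.1, n l - i.1) := by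
  obtain ⟨⟨h, j⟩, hj⟩ := x
  obtain ⟨l, hl⟩ := l
  have hi := i.2
  unfold csrc
  simp only at hj ⊢
  split_ifs with h0 o
  · subst h0
    simp only [reduceCtorEq, Prod.mk.injEq, false_iff, not_or, not_and]
    exact ⟨fun _ => not_false, fun _ => by omega⟩
  · simp only [Sum.inr.injEq, Prod.mk.injEq]
    constructor
    · intro e
      obtain ⟨e1, e2⟩ := Sigma.mk.inj e
      obtain rfl : h = l := congrArg Subtype.val e1
      have := congrArg Fin.val (eq_of_heq e2)
      simp only at this
      exact Or.inl ⟨rfl, by omega⟩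
    · rintro (⟨rfl, rfl⟩ | ⟨rfl, -⟩)
      · rfl
      · exact absurd o hl.not_σ
  · rw [Sum.inr.injEq]
    simp only [Prod.mk.injEq]
    have hl2 := len_line n ⟨l, hl⟩
    simp only at hl2
    constructor
    · intro e
      obtain ⟨e1, e2⟩ := Sigma.mk.inj e
      obtain rfl : Γ.graph.σ h = l := congrArg Subtype.val e1
      have := congrArg Fin.val (eq_of_heq e2)
      rw [len_σ] at hl2
      simp only at this
      exact Or.inr ⟨(Γ.graph.σ_σ h).symm, by omega⟩
    · rintro (⟨rfl, -⟩ | ⟨rfl, hj'⟩)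
      · exact absurd hl o
      · have e1 : Γ.graph.σ (Γ.graph.σ l) = l := Γ.graph.σ_σ l
        have hk : len n (Γ.graph.σ l) - j = i.1 := by
          rw [len_σ]; omega
        exact sigma_fin_ext n (l' := ⟨l, hl⟩) (i' := i) (Subtype.ext e1) hk

/-- The chain vertex at which the half-line `(h, j)`, `j ≠ 0`, is attached has exactly one other
half-line. -/
def cτ (x : CHf n) : CHf n :=
  if hx : x.1.2 = 0 then x
  else link n (Γ.graph.σ x.1.1) (len n x.1.1 + 1 - x.1.2) (by rw [len_σ]; omega)

theorem cτ_zero {x : CHf n} (hx : x.1.2 = 0) : cτ n x = x := dif_pos hx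

theorem cτ_pos {x : CHf n} (hx : x.1.2 ≠ 0) :
    (cτ n x).1 = (Γ.graph.σ x.1.1, len n x.1.1 + 1 - x.1.2) := by
  rw [cτ, dif_neg hx]
  rfl

theorem csrc_pos_eq_iff {x y : CHf n} (hx : x.1.2 ≠ 0) :
    csrc n x = csrc n y ↔ y = x ∨ y = cτ n x := by
  obtain ⟨⟨h, j⟩, hj⟩ := x
  simp only at hj hx
  rw [eq_comm, Subtype.ext_iff, Subtype.ext_iff, cτ_pos n (x := ⟨(h, j), hj⟩) hx]
  rcases hs : csrc n ⟨(h, j), hj⟩ with w | ⟨l, i⟩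
  · rw [csrc_eq_inl] at hs
    exact absurd hs.1 hx
  · rw [csrc_eq_inr]
    have hi := i.2
    have hl := len_line n l
    rw [csrc_eq_inr] at hs
    simp only [Prod.mk.injEq] at hs
    simp only
    rcases hs with ⟨rfl, rfl⟩ | ⟨rfl, rfl⟩
    · rw [hl, show n l + 1 - (i.1 + 1) = n l - i.1 by omega]
    · rw [Γ.graph.σ_σ, len_σ, hl, show n l + 1 - (n l - i.1) = i.1 + 1 by omega]
      exact or_comm

theorem csrc_cτ (x : CHf n) : csrc n (cτ n x) = csrc n x := by
  by_cases hx : x.1.2 = 0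
  · rw [cτ_zero n hx]
  · exact ((csrc_pos_eq_iff n hx).2 (Or.inr rfl)).symm

/-- The type of a vertex of the graph with chains inserted. -/
def cty : CV n → T.R
  | Sum.inl w => Sum.inl (Γ.graph.typ w)
  | Sum.inr l => Sum.inr (Γ.graph.lbl l.1.1)

theorem valence_inl (w : Γ.graph.Vx) (e : T.Edge) :
    Nat.card {x : {x : CHf n // csrc n x = Sum.inl w} // Γ.graph.lbl x.1.1.1 = e} =
      T.N (Γ.graph.typ w) e := by
  rw [← Γ.graph.valence w e]
  refine Nat.card_congr ⟨fun x => ⟨x.1.1.1.1, ((csrc_eq_inl n _ _).1 x.1.2).2, x.2⟩,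
    fun h => ⟨⟨link n h.1 0 (Nat.zero_le _), (csrc_eq_inl n _ _).2 ⟨rfl, h.2.1⟩⟩, h.2.2⟩,
    fun x => ?_, fun h => rfl⟩
  have := ((csrc_eq_inl n _ _).1 x.1.2).1
  exact Subtype.ext (Subtype.ext (Subtype.ext (Prod.ext rfl this.symm)))

theorem valence_inr (l : Γ.graph.Lines) (i : Fin (n l)) (e : T.Edge) :
    Nat.card {x : {x : CHf n // csrc n x = Sum.inr ⟨l, i⟩} // Γ.graph.lbl x.1.1.1 = e} =
      if e = Γ.graph.lbl l.1 then 2 else 0 := by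
  have hl := len_line n l
  have hi := i.2
  have hlbl : ∀ x : {x : CHf n // csrc n x = Sum.inr ⟨l, i⟩},
      Γ.graph.lbl x.1.1.1 = Γ.graph.lbl l.1 := by
    rintro ⟨x, hx⟩
    rcases (csrc_eq_inr n _ _ _).1 hx with h | h
    · rw [h]
    · rw [h]; exact Γ.graph.lbl_σ _
  split_ifs with he
  · rw [Nat.card_eq_two_iff]
    subst he
    refine ⟨⟨⟨link n l.1 (i.1 + 1) (by omega), (csrc_eq_inr n _ _ _).2 (Or.inl rfl)⟩, hlbl _⟩,
      ⟨⟨link n (Γ.graph.σ l.1) (n l - i.1) (by rw [len_σ]; omega),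
        (csrc_eq_inr n _ _ _).2 (Or.inr rfl)⟩, hlbl _⟩, fun h => ?_, ?_⟩
    · exact l.2.ne (congrArg (fun x => x.1.1.1.1) h).symm
    · ext ⟨x, hx⟩
      simp only [Set.mem_insert_iff, Set.mem_singleton_iff, Set.mem_univ, iff_true]
      rcases (csrc_eq_inr n _ _ _).1 x.2 with h | h
      · exact Or.inl (Subtype.ext (Subtype.ext (Subtype.ext h)))
      · exact Or.inr (Subtype.ext (Subtype.ext (Subtype.ext h)))
  · rw [Nat.card_eq_zero]
    exact Or.inl ⟨fun x => he (x.2.symm.trans (hlbl x.1))⟩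

def cExt : {x : CHf n // cσ n x = x} ≃ Γ.graph.Ext where
  toFun x := ⟨x.1.1.1, (cσ_eq_iff n _).1 x.2⟩
  invFun h := ⟨link n h.1 0 (Nat.zero_le _), (cσ_eq_iff n _).2 h.2⟩
  left_inv x := by
    have h1 := x.1.2
    rw [len_ext n ((cσ_eq_iff n _).1 x.2)] at h1
    exact Subtype.ext (Subtype.ext (Prod.ext rfl (Nat.le_zero.1 h1).symm))
  right_inv _ := rfl

end Chain

open Chain in
/-- The skeleton obtained from `Γ` by putting `n l` vertices of edge type on each line `l`. -/
def chain {r : T.R} (Γ : LegGraph T r) (n : Γ.graph.Lines → ℕ) : Skeleton T r where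
  V := CV n
  Hf := CHf n
  ty := cty n
  src := csrc n
  lbl x := Γ.graph.lbl x.1.1
  σ := cσ n
  σ_σ := cσ_cσ n
  lbl_σ x := Γ.graph.lbl_σ _
  valence p e := by
    rcases p with w | ⟨l, i⟩
    · exact valence_inl n w e
    · exact valence_inr n l i e
  label := (cExt n).trans Γ.label
  label_lbl x := Γ.label_lbl _

namespace Chain

variable {r : T.R} {Γ : LegGraph T r} (n : Γ.graph.Lines → ℕ)

/-- Used for several multiplicative weights on `R`: valences written multiplicatively, powers of two
that bound the chain lengths, and the series of insertions. -/
theorem prod_chain {A : Type*} [CommMonoid A] (f : T.R → A) :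
    ∏ p, f ((chain Γ n).ty p) = (∏ w, f (Sum.inl (Γ.graph.typ w))) *
      ∏ l : Γ.graph.Lines, f (Sum.inr (Γ.graph.lbl l.1)) ^ n l := by
  have h1 : ∏ p, f ((chain Γ n).ty p) = ∏ p : CV n, f (cty n p) :=
    Fintype.prod_equiv (ι := (chain Γ n).V) (κ := CV n) (Equiv.refl (CV n)) _ _ fun _ => rfl
  rw [h1, Fintype.prod_sum_type, Fintype.prod_sigma]
  simp [cty]

theorem card_chain_v : Nat.card (chain Γ n).V = Nat.card Γ.graph.Vx + ∑ l, n l := by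
  change Nat.card (CV n) = _
  rw [Nat.card_sum, Nat.card_sigma]
  simp

theorem card_chain_hf : Nat.card (chain Γ n).Hf = Nat.card Γ.graph.Hf + 2 * ∑ l, n l := by
  -- In `Multiplicative ℕ` the product formula becomes a sum of valences, where each chain vertex
  -- counts two.
  have h := prod_chain n (fun r => Multiplicative.ofAdd (T.valence r))
  have h2 := congrArg Multiplicative.toAdd h
  simp only [toAdd_prod, toAdd_mul, toAdd_ofAdd, toAdd_pow, T.valence_edge] at h2
  rw [(chain Γ n).card_hf, h2, Γ.graph.card_hf, Finset.mul_sum]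
  simp [mul_comm]

/-- Cutting one segment damages only one line of `Γ`, without which `Γ` is still connected. Each
chain vertex on that line still reaches an end of the line, on its own side of the cut. -/
theorem connectedWithout (hΓ : Γ.graph.OnePI) (x0 : (chain Γ n).Hf)
    (hx0 : (chain Γ n).σ x0 ≠ x0) : (chain Γ n).ConnectedWithout {x0, (chain Γ n).σ x0} := by
  change CHf n at x0
  change cσ n x0 ≠ x0 at hx0
  change (chain Γ n).ConnectedWithout {x0, cσ n x0}
  refine ⟨⟨(Sum.inl hΓ.connected.1.some : CV n)⟩, ?_⟩
  change ∀ a b : CV n, Relation.ReflTransGen (fun a b => ∃ h, cσ n h ≠ h ∧ h ∉ ({x0, cσ n x0} :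
    Set (CHf n)) ∧ csrc n h = a ∧ csrc n (cσ n h) = b) a b
  set rel := fun a b : CV n => ∃ h, cσ n h ≠ h ∧ h ∉ ({x0, cσ n x0} :
    Set (CHf n)) ∧ csrc n h = a ∧ csrc n (cσ n h) = b with hrel
  have hD : ∀ x, cσ n x ∈ ({x0, cσ n x0} : Set (CHf n)) ↔ x ∈ ({x0, cσ n x0} : Set (CHf n)) := by
    intro x
    simp only [Set.mem_insert_iff, Set.mem_singleton_iff]
    constructor
    · rintro (h | h)
      · exact Or.inr (by rw [← h, cσ_cσ])
      · exact Or.inl (Function.LeftInverse.injective (cσ_cσ n) h)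
    · rintro (rfl | rfl)
      · exact Or.inr rfl
      · exact Or.inl (cσ_cσ n _)
  have symm : ∀ a b, Relation.ReflTransGen rel a b → Relation.ReflTransGen rel b a := by
    have : Std.Symm rel := ⟨?_⟩
    · exact fun a b h => Std.Symm.symm (r := Relation.ReflTransGen rel) a b h
    rintro a b ⟨x, h1, h2, h3, h4⟩
    refine ⟨cσ n x, ?_, fun h => h2 ((hD x).1 h), h4, ?_⟩
    · rw [cσ_cσ]; exact h1.symm
    · rw [cσ_cσ]; exact h3
  have step : ∀ h j (hj : j + 1 ≤ len n h), link n h j (by omega) ∉ ({x0, cσ n x0} : Set (CHf n)) →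
      rel (csrc n (link n h j (by omega))) (csrc n (link n h (j + 1) hj)) := by
    intro h j hj hx
    have h1 : Γ.graph.σ h ≠ h := ne_of_len n (by omega)
    refine ⟨_, fun h2 => h1 ((cσ_eq_iff n _).1 h2), hx, rfl, ?_⟩
    rw [← csrc_cτ n (link n h (j + 1) hj)]
    congr 1
    refine Subtype.ext ?_
    rw [cτ_pos n (by simp [link])]
    refine Prod.ext rfl ?_
    change len n h - j = len n h + 1 - (j + 1)
    omega
  have walk : ∀ h b (hb : b ≤ len n h) k (hk : k ≤ b), (∀ j (hj : j ≤ len n h), b - k ≤ j → j < b →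
      link n h j hj ∉ ({x0, cσ n x0} : Set (CHf n))) →
      Relation.ReflTransGen rel (csrc n (link n h (b - k) (by omega))) (csrc n (link n h b hb)) := by
    intro h b hb k
    induction k with
    | zero => intro _ _; exact .refl
    | succ k ih =>
      intro hk hc
      refine .head ?_ (ih (by omega) fun j hj h1 h2 => hc j hj (by omega) h2)
      have := step h (b - (k + 1)) (by omega) (hc _ _ (by omega) (by omega))
      convert this using 3
      omega
  have walkEnd : ∀ h (hh : Γ.graph.σ h ≠ h) a (ha : a ≤ len n h), (∀ j (hj : j ≤ len n h), a ≤ j →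
      link n h j hj ∉ ({x0, cσ n x0} : Set (CHf n))) →
      Relation.ReflTransGen rel (csrc n (link n h a ha)) (Sum.inl (Γ.graph.src (Γ.graph.σ h))) := by
    intro h hh a ha hc
    have h1 := walk h (len n h) le_rfl (len n h - a) (by omega) fun j hj h1 h2 =>
      hc j hj (by omega)
    have h2 : rel (csrc n (link n h (len n h) le_rfl)) (Sum.inl (Γ.graph.src (Γ.graph.σ h))) :=
      ⟨_, fun h2 => hh ((cσ_eq_iff n _).1 h2), hc _ _ ha, rfl,
        (csrc_eq_inl n _ _).2 ⟨Nat.sub_self _, rfl⟩⟩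
    have h3 := h1.tail h2
    have h4 : len n h - (len n h - a) = a := by omega
    simpa only [h4] using h3
  -- Seen from a given `h`, the cut segment can occur only at a single position `c`. If it is not on
  -- this line, any `c` will do.
  have cut : ∀ h, ∃ c, ∀ j (hj : j ≤ len n h),
      link n h j hj ∈ ({x0, cσ n x0} : Set (CHf n)) → j = c := by
    intro h
    have hh0 : Γ.graph.σ x0.1.1 ≠ x0.1.1 := fun h2 => hx0 ((cσ_eq_iff n _).2 h2)
    by_cases h1 : h = x0.1.1
    · refine ⟨x0.1.2, fun j hj h2 => ?_⟩
      rcases h2 with h2 | h2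
      · rw [← h2]; rfl
      · exact absurd (congrArg (fun x => x.1.1) h2 : h = Γ.graph.σ x0.1.1)
          (by rw [h1]; exact hh0.symm)
    · refine ⟨(cσ n x0).1.2, fun j hj h2 => ?_⟩
      rcases h2 with h2 | h2
      · exact absurd (congrArg (fun x => x.1.1) h2) h1
      · exact congrArg (fun x => x.1.2) h2
  have toInl : ∀ p, ∃ w, Relation.ReflTransGen rel p (Sum.inl w) := by
    rintro (w | ⟨l, i⟩)
    · exact ⟨w, .refl⟩
    · have hl := len_line n l
      have hi := i.2
      have hs : csrc n (link n l.1 (i.1 + 1) (by omega)) = Sum.inr ⟨l, i⟩ :=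
        (csrc_eq_inr n _ _ _).2 (Or.inl rfl)
      rw [← hs]
      obtain ⟨c, hc⟩ := cut l.1
      -- Before the cut one walks back to the start of the line, after it forward to the end.
      by_cases hic : i.1 + 1 ≤ c
      · refine ⟨Γ.graph.src l.1, symm _ _ ?_⟩
        have := walk l.1 (i.1 + 1) (by omega) (i.1 + 1) le_rfl fun j hj _ h2 h3 => by
          have := hc j hj h3
          omega
        simp only [Nat.sub_self] at this
        rwa [(csrc_eq_inl n (link n l.1 0 (by omega)) (Γ.graph.src l.1)).2 ⟨rfl, rfl⟩] at this
      · exact ⟨_, walkEnd l.1 l.2.ne _ _ fun j hj h2 h3 => by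
          have := hc j hj h3
          omega⟩
  have inlInl : ∀ a b, Relation.ReflTransGen rel (Sum.inl a) (Sum.inl b) := by
    intro a b
    have hh0 : Γ.graph.σ x0.1.1 ≠ x0.1.1 := fun h2 => hx0 ((cσ_eq_iff n _).2 h2)
    induction (hΓ.cut x0.1.1 hh0).2 a b with
    | refl => exact .refl
    | tail _ h ih =>
      obtain ⟨h, h1, h2, rfl, rfl⟩ := h
      refine ih.trans ?_
      have := walkEnd h h1 0 (Nat.zero_le _) fun j hj _ h3 => h2 (by
        rcases h3 with h3 | h3
        · exact Or.inl (congrArg (fun x : CHf n => x.1.1) h3)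
        · exact Or.inr (congrArg (fun x : CHf n => x.1.1) h3))
      rwa [(csrc_eq_inl n (link n h 0 (by omega)) (Γ.graph.src h)).2 ⟨rfl, rfl⟩] at this
  intro a b
  obtain ⟨w, hw⟩ := toInl a
  obtain ⟨w', hw'⟩ := toInl b
  exact hw.trans ((inlInl w w').trans (symm _ _ hw'))

end Chain

end FeynmanHopf

end

/-! ### Loop numbers, finiteness, and the graphs to be inserted. -/

noncomputable section

namespace FeynmanHopf

open scoped Classical

variable {T : FieldTheory}

/-! ## Loop numbers and irreducibility of insertions -/

namespace Graph

variable {Γ : Graph T}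

theorem ConnectedWithout.mono {D D' : Set Γ.Hf} (h : Γ.ConnectedWithout D')
    (hD : ∀ x, Γ.σ x ≠ x → x ∈ D → x ∈ D') : Γ.ConnectedWithout D :=
  ⟨h.1, fun a b => Relation.ReflTransGen.mono (fun _ _ ⟨x, h1, h2, h3⟩ =>
    ⟨x, h1, fun h4 => h2 (hD x h1 h4), h3⟩) _ _ (h.2 a b)⟩

theorem OnePI.card_add_loops (h : Γ.OnePI) : Nat.card Γ.Vx + Γ.loops = Γ.numLines + 1 := by
  have := h.not_tree
  unfold loops at *
  omega

theorem OnePI.exists_internal (h : Γ.OnePI) : ∃ x, Γ.σ x ≠ x := by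
  by_contra hc
  have h1 : IsEmpty {x : Γ.Hf // Γ.σ x ≠ x} := ⟨fun x => hc ⟨x.1, x.2⟩⟩
  have h2 : Γ.numLines = 0 := by simp [numLines]
  have h3 := h.card_add_loops
  have h4 := h.not_tree
  have := h.connected.1
  have h5 : 0 < Nat.card Γ.Vx := Nat.card_pos
  omega

end Graph

theorem Skeleton.ConnectedWithout.mono {r : T.R} {Q : Skeleton T r} {D D' : Set Q.Hf}
    (h : Q.ConnectedWithout D') (hD : D ⊆ D') : Q.ConnectedWithout D :=
  ⟨h.1, fun a b => Relation.ReflTransGen.mono (fun _ _ ⟨x, h1, h2, h3⟩ =>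
    ⟨x, h1, fun h4 => h2 (hD h4), h3⟩) _ _ (h.2 a b)⟩

namespace LegGraph

variable {r : T.R}

/-- A single vertex without internal lines. -/
def IsTrivial (B : LegGraph T r) : Prop :=
  Nonempty B.graph.Vx ∧ Subsingleton B.graph.Vx ∧ ∀ h, B.graph.σ h = h

/-- The graphs that contribute to the vertex function at a vertex, and to the self-energy at an
edge. -/
def IsGood (B : LegGraph T r) : Prop :=
  -- The trivial graph is allowed only at a vertex: the bare line is represented by the chain of
  -- length zero.
  B.graph.OnePI ∨ (∃ v, r = Sum.inl v) ∧ B.IsTrivial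

theorem IsTrivial.numLines {B : LegGraph T r} (h : B.IsTrivial) : B.graph.numLines = 0 := by
  have h1 : IsEmpty {x : B.graph.Hf // B.graph.σ x ≠ x} := ⟨fun x => x.2 (h.2.2 x.1)⟩
  simp [Graph.numLines]

theorem IsTrivial.card {B : LegGraph T r} (h : B.IsTrivial) : Nat.card B.graph.Vx = 1 := by
  have := h.1
  have := h.2.1
  exact Nat.card_unique

theorem IsTrivial.loops {B : LegGraph T r} (h : B.IsTrivial) : B.graph.loops = 0 := by
  rw [Graph.loops, h.numLines, h.card]

theorem IsTrivial.not_onePI {B : LegGraph T r} (h : B.IsTrivial) : ¬ B.graph.OnePI :=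
  fun h' => h'.not_tree h.loops

theorem IsTrivial.of_iso {B B' : LegGraph T r} (φ : Iso B B') (h : B.IsTrivial) : B'.IsTrivial := by
  refine ⟨h.1.map φ.1.vx, ⟨fun a b => ?_⟩, fun x => ?_⟩
  · have := h.2.1
    exact φ.1.vx.symm.injective (Subsingleton.elim _ _)
  · rw [← φ.1.hf.apply_symm_apply x, φ.1.σ_eq_iff]
    exact h.2.2 _

theorem IsGood.of_iso {B B' : LegGraph T r} (φ : Iso B B') (h : B.IsGood) : B'.IsGood :=
  h.imp φ.1.onePI fun h => ⟨h.1, h.2.of_iso φ⟩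

theorem IsGood.connected {B : LegGraph T r} (h : B.IsGood) : B.graph.ConnectedWithout ∅ := by
  rcases h with h | ⟨-, h⟩
  · exact h.connected
  · refine ⟨h.1, fun a b => ?_⟩
    have := h.2.1
    rw [Subsingleton.elim a b]

theorem IsGood.card_add_loops {B : LegGraph T r} (h : B.IsGood) :
    Nat.card B.graph.Vx + B.graph.loops = B.graph.numLines + 1 := by
  rcases h with h | ⟨-, h⟩
  · exact h.card_add_loops
  · rw [h.loops, h.card, h.numLines]

theorem IsGood.cut {B : LegGraph T r} (h : B.IsGood) {y : B.graph.Hf} (hy : B.graph.σ y ≠ y) :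
    B.graph.ConnectedWithout {y, B.graph.σ y} := by
  rcases h with h | ⟨-, h⟩
  · exact h.cut y hy
  · exact absurd (h.2.2 y) hy

variable {Γ : LegGraph T r} {n : Γ.graph.Lines → ℕ} {d : ∀ p, LegGraph T ((chain Γ n).ty p)}

theorem card_hf_leg (B : LegGraph T r) :
    Nat.card B.graph.Hf = T.valence r + 2 * B.graph.numLines := by
  rw [B.graph.card_hf_eq, B.card_ext]

/-- Half-lines and vertices add up over the inserted graphs, and Euler's relation holds for each of
them and for `Γ`. A chain vertex adds one vertex and one line to the skeleton, so it does not change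
the count. -/
theorem loops_ins (hΓ : Γ.graph.OnePI) (hd : ∀ p, (d p).IsGood) :
    (Skeleton.ins d).graph.loops = Γ.graph.loops + ∑ p, (d p).graph.loops := by
  have h1 := Skeleton.card_ins_hf d
  rw [card_hf_leg, Finset.sum_congr rfl fun p _ => (d p).card_hf_leg, Finset.sum_add_distrib,
    ← (chain Γ n).card_hf, Chain.card_chain_hf, Γ.card_hf_leg, ← Finset.mul_sum] at h1
  have h2 := Skeleton.card_ins_vx d
  have h3 : ∑ p, (Nat.card (d p).graph.Vx + (d p).graph.loops) =
      ∑ p, ((d p).graph.numLines + 1) := Finset.sum_congr rfl fun p _ => (hd p).card_add_loops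
  rw [Finset.sum_add_distrib, Finset.sum_add_distrib] at h3
  have h4 : ∑ p : (chain Γ n).V, 1 = Nat.card (chain Γ n).V := by
    rw [Finset.sum_const, Nat.card_eq_fintype_card, smul_eq_mul, mul_one]; rfl
  rw [h4, Chain.card_chain_v, ← h2] at h3
  have h5 := hΓ.card_add_loops
  unfold Graph.loops at *
  omega

/-- A cut line belongs either to an inserted graph, which stays connected, or to the skeleton, which
stays connected by `Chain.connectedWithout`; everything else is untouched. -/
theorem onePI_ins (hΓ : Γ.graph.OnePI) (hd : ∀ p, (d p).IsGood) :
    (Skeleton.ins d).graph.OnePI := by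
  have hQ : (chain Γ n).ConnectedWithout ∅ := by
    obtain ⟨x, hx⟩ := hΓ.exists_internal
    exact (Chain.connectedWithout n hΓ (Chain.link n x 0 (Nat.zero_le _))
      fun h => hx ((Chain.cσ_eq_iff n _).1 h)).mono (Set.empty_subset _)
  refine ⟨?_, ?_, fun z hz => ?_⟩
  · exact Skeleton.ins_connectedWithout d ∅ (fun p => (hd p).connected) hQ
  · rw [loops_ins hΓ hd]
    have := hΓ.not_tree
    omega
  · change Skeleton.insσ d z ≠ z at hz
    change (Skeleton.ins d).graph.ConnectedWithout {z, Skeleton.insσ d z}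
    apply Skeleton.ins_connectedWithout d
    · intro p
      rcases Skeleton.emb_or_internal d z with ⟨x, rfl⟩ | ⟨q, y, h, rfl⟩
      · refine (hd p).connected.mono fun y hy hyD => ?_
        rw [Skeleton.insσ_emb] at hyD
        rcases hyD with h | h
        · exact Skeleton.emb_ne_internal d hy _ h.symm
        · exact Skeleton.emb_ne_internal d hy _ h.symm
      · rw [Skeleton.insσ_internal d h]
        by_cases hpq : p = q
        · subst hpq
          refine ((hd p).cut h).mono fun y' _ hy' => ?_
          rcases hy' with h | h
          · exact Or.inl (eq_of_heq (Sigma.mk.inj h).2)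
          · exact Or.inr (eq_of_heq (Sigma.mk.inj h).2)
        · refine (hd p).connected.mono fun y' _ hy' => ?_
          rcases hy' with h | h
          · exact hpq (congrArg Sigma.fst h)
          · exact hpq (congrArg Sigma.fst h)
    · rcases Skeleton.emb_or_internal d z with ⟨x, rfl⟩ | ⟨q, y, h, rfl⟩
      · rw [Skeleton.insσ_emb] at hz ⊢
        refine (Chain.connectedWithout n hΓ x fun h => hz (congrArg _ h)).mono fun x' hx' => ?_
        exact hx'.imp (fun h => Skeleton.emb_injective d h) (fun h => Skeleton.emb_injective d h)
      · rw [Skeleton.insσ_internal d h]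
        refine hQ.mono fun x' hx' => ?_
        rcases hx' with h1 | h1
        · exact absurd h1 (Skeleton.emb_ne_internal d h x')
        · exact absurd h1 (Skeleton.emb_ne_internal d (by
            rw [(d q).graph.σ_σ]; exact h.symm) x')

end LegGraph

/-! ## Finiteness -/

theorem Graph.three_mul_card_le (Γ : Graph T) : 3 * Nat.card Γ.Vx ≤ Nat.card Γ.Hf := by
  rw [Γ.card_hf, Nat.card_eq_fintype_card, mul_comm, ← smul_eq_mul, ← Finset.card_univ]
  exact Finset.card_nsmul_le_sum _ _ _ fun w _ => T.three_le_valence _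

/-- The sum of the `N(w) - 2` is the number of half-lines minus twice the number of vertices, that
is `N(r) + 2 I - 2 V`, and Euler's relation gives `I - V = L - 1`. -/
theorem LegGraph.couplingOrder {r : T.R} {Γ : LegGraph T r} (h : Γ.graph.OnePI) :
    Γ.graph.couplingOrder + 2 = 2 * Γ.graph.loops + T.valence r := by
  have h1 : ∑ w, (T.valence (Sum.inl (Γ.graph.typ w)) - 2 + 2) = Nat.card Γ.graph.Hf := by
    rw [Γ.graph.card_hf]
    exact Finset.sum_congr rfl fun w _ => Nat.sub_add_cancel (T.two_le_valence _)
  rw [Finset.sum_add_distrib, Finset.sum_const, Finset.card_univ, ← Nat.card_eq_fintype_card,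
    Γ.card_hf_leg, smul_eq_mul] at h1
  rw [Graph.couplingOrder, finsum_eq_sum_of_fintype]
  have := h.card_add_loops
  omega

theorem finite_lclass_card (r : T.R) (a b : ℕ) :
    {c : LClass T r | Nat.card c.out.graph.Vx = a ∧ Nat.card c.out.graph.Hf = b}.Finite := by
  have f : ∀ c : {c : LClass T r // Nat.card c.out.graph.Vx = a ∧ Nat.card c.out.graph.Hf = b},
      Nonempty ((c.1.out.graph.Vx ≃ Fin a) × (c.1.out.graph.Hf ≃ Fin b)) := fun c =>
    ⟨Finite.equivFinOfCardEq c.2.1, Finite.equivFinOfCardEq c.2.2⟩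
  let e1 := fun c => (f c).some.1
  let e2 := fun c => (f c).some.2
  -- After a numbering of vertices and half-lines, all structure maps take values in finite sets,
  -- and equal codes give an isomorphism that preserves labels.
  let code : {c : LClass T r // Nat.card c.out.graph.Vx = a ∧ Nat.card c.out.graph.Hf = b} →
      (Fin a → T.Vert) × (Fin b → Fin a) × (Fin b → T.Edge) × (Fin b → Fin b) ×
        (T.Slot r → Fin b) := fun c =>
    (fun i => c.1.out.graph.typ ((e1 c).symm i), fun j => e1 c (c.1.out.graph.src ((e2 c).symm j)),
      fun j => c.1.out.graph.lbl ((e2 c).symm j),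
      fun j => e2 c (c.1.out.graph.σ ((e2 c).symm j)), fun s => e2 c (c.1.out.label.symm s).1)
  refine Set.finite_coe_iff.1 (Finite.of_injective code fun c c' h => Subtype.ext ?_)
  simp only [code, Prod.mk.injEq, funext_iff] at h
  obtain ⟨h1, h2, h3, h4, h5⟩ := h
  rw [← Quotient.out_eq c.1, ← Quotient.out_eq c'.1]
  refine Quotient.sound ?_
  change ∃ φ : Graph.Iso c.1.out.graph c'.1.out.graph, ∀ (h : c.1.out.graph.Ext)
    (h' : c'.1.out.graph.Ext), h'.1 = φ.hf h.1 → c'.1.out.label h' = c.1.out.label h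
  refine ⟨⟨(e1 c).trans (e1 c').symm,
    (e2 c).trans (e2 c').symm, fun w => ?_, fun x => ?_, fun x => ?_, fun x => ?_⟩,
    fun x x' hx => ?_⟩
  · simpa using (h1 (e1 c w)).symm
  · rw [Equiv.trans_apply, Equiv.trans_apply, Equiv.eq_symm_apply]
    simpa using (h2 (e2 c x)).symm
  · simpa using (h3 (e2 c x)).symm
  · rw [Equiv.trans_apply, Equiv.trans_apply, Equiv.eq_symm_apply]
    simpa using (h4 (e2 c x)).symm
  · have h6 := h5 (c.1.out.label x)
    rw [Equiv.symm_apply_apply] at h6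
    simp only [Equiv.trans_apply] at hx
    rw [Equiv.eq_symm_apply] at hx
    have h7 := (e2 c').injective (hx.trans h6)
    exact ((Equiv.symm_apply_eq _).1 (Subtype.ext h7.symm)).symm

/-- Trivalence gives `3 V ≤ N(r) + 2 I` and Euler's relation `I = V + L - 1`, so `V` and then the
number of half-lines are bounded in terms of `N(r)` and `L`. -/
theorem finite_lclass_loops_le (r : T.R) (L : ℕ) :
    {c : LClass T r | c.out.graph.loops ≤ L}.Finite := by
  refine Set.Finite.subset (Set.Finite.biUnion (Set.finite_Iic (T.valence r + 2 * L)) fun a _ =>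
    Set.Finite.biUnion (Set.finite_Iic (T.valence r + 2 * (a + L))) fun b _ =>
      finite_lclass_card r a b) fun c hc => ?_
  have h1 := c.out.graph.three_mul_card_le
  have h2 := c.out.leg.card_hf_leg
  have h3 := c.out.onePI.card_add_loops
  simp only [Set.mem_ofPred_eq] at hc h2
  simp only [Set.mem_iUnion, Set.mem_Iic]
  exact ⟨_, by omega, _, by omega, rfl, rfl⟩

instance (r : T.R) (L : ℕ) : Fintype {c : LClass T r // c.out.graph.loops ≤ L} :=
  (finite_lclass_loops_le r L).fintype

/-! ## Decorations -/

/-- The graph with the single vertex `v` and no internal lines. -/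
def trivialGraph (v : T.Vert) : LegGraph T (Sum.inl v) where
  graph :=
    { Vx := Unit
      Hf := T.Slot (Sum.inl v)
      typ := fun _ => v
      src := fun _ => ()
      lbl := fun s => s.1
      σ := 1
      σ_σ := fun _ => rfl
      lbl_σ := fun _ => rfl
      valence := fun w e => by
        refine Eq.trans (Nat.card_congr (Equiv.subtypeEquivRight fun s => ?_))
          (card_eq_of_slot_equiv (Equiv.refl (T.Slot (Sum.inl v))) (fun _ => rfl) e)
        exact and_iff_right (Subsingleton.elim _ _) }
  label := Equiv.subtypeUnivEquiv fun _ => rfl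
  label_lbl _ := rfl

theorem trivialGraph_isTrivial (v : T.Vert) : (trivialGraph v).IsTrivial :=
  ⟨⟨()⟩, inferInstanceAs (Subsingleton Unit), fun _ => rfl⟩

theorem nonempty_iso_trivialGraph {v : T.Vert} {B : LegGraph T (Sum.inl v)} (h : B.IsTrivial) :
    Nonempty (LegGraph.Iso (trivialGraph v) B) := by
  have hs := h.2.1
  let f : T.Slot (Sum.inl v) ≃ B.graph.Hf := B.label.symm.trans (Equiv.subtypeUnivEquiv h.2.2)
  have hl : ∀ s, B.graph.lbl (f s) = s.1 := fun s => by
    refine (B.label_lbl (B.label.symm s)).symm.trans ?_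
    rw [Equiv.apply_symm_apply]
  refine ⟨⟨Graph.Iso.ofHf f (fun x y => iff_of_true (Subsingleton.elim _ _) rfl) hl
    (fun s => h.2.2 _), fun s s' e => ?_⟩⟩
  exact (Equiv.eq_symm_apply _).1 (Subtype.ext e)

/-- Isomorphism classes of the graphs that may be inserted at a vertex or an edge. -/
def Dec (T : FieldTheory) : T.R → Type 1
  | Sum.inl v => Option (LClass T (Sum.inl v))
  | Sum.inr e => LClass T (Sum.inr e)

/-- A representative of a class of insertable graphs. -/
def Dec.block : ∀ {r : T.R}, Dec T r → LegGraph T r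
  | Sum.inl v, none => trivialGraph v
  | Sum.inl _, some c => c.out.leg
  | Sum.inr _, c => Quotient.out (s := labelledSetoid T _) c |>.leg

theorem Dec.isGood : ∀ {r : T.R} (c : Dec T r), c.block.IsGood
  | Sum.inl v, none => Or.inr ⟨⟨v, rfl⟩, trivialGraph_isTrivial v⟩
  | Sum.inl _, some c => Or.inl c.out.onePI
  | Sum.inr _, c => Or.inl (Quotient.out (s := labelledSetoid T _) c).onePI

/-- At a vertex, the class `none` cannot coincide with a 1PI class, because the trivial graph has no
loops. -/
theorem LegGraph.IsGood.existsUnique_dec {r : T.R} {B : LegGraph T r} (h : B.IsGood) :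
    ∃! c : Dec T r, Nonempty (LegGraph.Iso c.block B) := by
  rcases r with v | e
  · by_cases h1 : B.graph.OnePI
    · refine ⟨some (B.cls h1), B.nonempty_iso_cls h1, fun c hc => ?_⟩
      rcases c with _ | c
      · exact absurd h1 ((trivialGraph_isTrivial v).of_iso hc.some).not_onePI
      · exact congrArg some (LegGraph.eq_cls_of_iso h1 hc.some)
    · refine ⟨none, nonempty_iso_trivialGraph (h.resolve_left h1).2, fun c hc => ?_⟩
      rcases c with _ | c
      · rfl
      · exact absurd (hc.some.1.onePI c.out.onePI) h1
  · have h1 := h.resolve_right fun h => by simpa using h.1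
    exact ⟨B.cls h1, B.nonempty_iso_cls h1, fun c hc => LegGraph.eq_cls_of_iso h1 hc.some⟩

/-- Insertable graphs of bounded loop number. -/
abbrev BDec (T : FieldTheory) (L : ℕ) (r : T.R) : Type 1 :=
  {c : Dec T r // c.block.graph.loops ≤ L}

instance (L : ℕ) (r : T.R) : Finite (BDec T L r) := by
  rcases r with v | e
  · refine Finite.of_injective (β := Option {c : LClass T (Sum.inl v) // c.out.graph.loops ≤ L})
      (fun c => match c with
        | ⟨none, _⟩ => none
        | ⟨some c, h⟩ => some ⟨c, h⟩) ?_
    rintro ⟨_ | c, h⟩ ⟨_ | c', h'⟩ e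
    · rfl
    · simp at e
    · simp at e
    · obtain rfl : c = c' := congrArg Subtype.val (Option.some.inj e)
      rfl
  · exact (finite_lclass_loops_le (Sum.inr e) L).to_subtype

instance (L : ℕ) (r : T.R) : Fintype (BDec T L r) := Fintype.ofFinite _

/-- Summation over the isomorphisms of the insertable graphs with a given graph. -/
theorem sum_bdec {K : Type*} [Field K] [CharZero K] {r : T.R} {L : ℕ} (F : Dec T r → K)
    (B : LegGraph T r) (hL : B.IsGood → B.graph.loops ≤ L) (F' : K)
    (hF : ∀ c : Dec T r, Nonempty (LegGraph.Iso c.block B) → F c = F') :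
    ∑ c : BDec T L r, (c.1.block.graph.symFactor : K)⁻¹ * F c.1 *
      (Nat.card (LegGraph.Iso c.1.block B) : K) = if B.IsGood then F' else 0 := by
  have h0 : ∀ c : BDec T L r, ¬ Nonempty (LegGraph.Iso c.1.block B) →
      (c.1.block.graph.symFactor : K)⁻¹ * F c.1 *
      (Nat.card (LegGraph.Iso c.1.block B) : K) = 0 := fun c hc => by
    have := not_nonempty_iff.1 hc
    simp
  split_ifs with hB
  · obtain ⟨c, hc, hu⟩ := hB.existsUnique_dec
    have hc' : c.block.graph.loops ≤ L := by rw [← hc.some.1.loops_eq]; exact hL hB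
    -- Only the class of `B` admits isomorphisms with `B`, and their number is the symmetry factor
    -- in the denominator.
    rw [Finset.sum_eq_single ⟨c, hc'⟩]
    · rw [hF c hc, LegGraph.card_iso_of_iso hc.some]
      have : (c.block.graph.symFactor : K) ≠ 0 := Nat.cast_ne_zero.2 (c.block.symFactor_pos).ne'
      field_simp
    · intro c' _ hne
      exact h0 c' fun h => hne (Subtype.ext (hu _ h))
    · simp
  · exact Finset.sum_eq_zero fun c _ => h0 c fun h => hB (c.1.isGood.of_iso h.some)

end FeynmanHopf

end

/-! ### The walk `τ σ` outside a subgraph, and quotients obtained from contractions. -/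

noncomputable section

namespace FeynmanHopf

open scoped Classical

variable {T : FieldTheory}

/-! ## Half-lines outside a subgraph -/

theorem other_eq_of_rel {α : Type} {r : α → α → Prop} (hr : IsPairing r) {x y : α} (h : r x y)
    (hxy : y ≠ x) : other r x = y := by
  have h' : ∃ y, y ≠ x ∧ r x y := ⟨y, hxy, h⟩
  rw [other, dif_pos h']
  exact hr.two x _ _ h'.choose_spec.2 h h'.choose_spec.1 hxy

theorem other_eq_self {α : Type} {r : α → α → Prop} {x : α} (h : ∀ y, r x y → y = x) :
    other r x = x :=
  dif_neg fun ⟨y, h1, h2⟩ => h1 (h y h2)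

namespace Graph

variable {Γ : Graph T}

namespace Piece

variable {p : Γ.Piece}

theorem exists_leg {r : T.R} (hp : p.toGraph.HasResidue r) : ∃ z, p.IsLeg z := by
  by_contra h
  push Not at h
  have h1 : T.valence r = 0 := Finset.sum_eq_zero fun e _ => by
    rw [← hp e, p.card_leg, Nat.card_eq_zero]
    exact Or.inl ⟨fun z => h z.1 z.2.1⟩
  have := T.two_le_valence r
  omega

theorem exists_other_leg {e : T.Edge} (hp : p.toGraph.HasResidue (Sum.inr e)) {x : Γ.Hf}
    (hx : p.IsLeg x) : ∃ y, p.IsLeg y ∧ y ≠ x := by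
  have h1 := hp e
  rw [p.card_leg] at h1
  simp only [FieldTheory.lines, if_true] at h1
  rw [Nat.card_eq_two_iff' ⟨x, hx, p.lbl_of_residue hp hx⟩] at h1
  obtain ⟨y, hy, -⟩ := h1
  exact ⟨y.1, y.2.1, fun h => hy (Subtype.ext h)⟩

/-- If one leg of an edge graph is external in `Γ`, the piece is joined to the rest by its other leg
alone. Irreducibility forbids a vertex behind that single line. -/
theorem verts_eq_univ_of_ext_leg (hΓ : Γ.OnePI) {e : T.Edge}
    (hp : p.toGraph.HasResidue (Sum.inr e)) {x : Γ.Hf} (hx : p.IsLeg x) (hσ : Γ.σ x = x) :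
    p.verts = Set.univ := by
  obtain ⟨y, hy, hyx⟩ := p.exists_other_leg hp hx
  have hc : ∃ D : Set Γ.Hf, Γ.ConnectedWithout D ∧ (Γ.σ y ≠ y → y ∈ D) := by
    by_cases h : Γ.σ y = y
    · exact ⟨∅, hΓ.connected, fun h' => absurd h h'⟩
    · exact ⟨_, hΓ.cut y h, fun _ => Or.inl rfl⟩
  obtain ⟨D, hD, hyD⟩ := hc
  refine Set.eq_univ_of_forall fun w => ?_
  induction hD.2 (Γ.src x) w with
  | refl => exact hx.1
  | tail _ h ih =>
    obtain ⟨z, h1, h2, rfl, rfl⟩ := h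
    by_cases hz : z ∈ p.halves
    · exact p.src_mem _ (p.σ_mem _ hz)
    · have hzx : z ≠ x := fun h => h1 (by rw [h, hσ])
      have : z = y := p.leg_two hp hx ⟨ih, hz⟩ hy hzx hyx
      subst this
      exact absurd (hyD h1) h2

end Piece

namespace Sub

variable (A : Γ.Sub)

theorem ext_pieces {A B : Γ.Sub} (h : A.pieces = B.pieces) : A = B := by
  cases A; cases B
  cases h
  rfl

instance : Finite Γ.Sub :=
  Finite.of_injective Sub.pieces fun _ _ => ext_pieces

instance : Fintype Γ.Sub := Fintype.ofFinite _

/-- The half-line does not lie on a line of `A`. -/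
def Outer (z : Γ.Hf) : Prop := ∀ p ∈ A.pieces, z ∉ p.halves

variable {A}

theorem outer_of_leg {p : Γ.Piece} (hp : p ∈ A.pieces) {z : Γ.Hf} (hz : p.IsLeg z) :
    A.Outer z := fun q hq hzq => by
  have := A.eq_of_mem hp hq hz.1 (q.src_mem _ hzq)
  exact hz.2 (this ▸ hzq)

theorem Outer.σ {z : Γ.Hf} (hz : A.Outer z) : A.Outer (Γ.σ z) := fun p hp h =>
  hz p hp (by simpa [Γ.σ_σ] using p.σ_mem _ h)

theorem Outer.τ {z : Γ.Hf} (hz : A.Outer z) : A.Outer (A.τ z) := by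
  rcases other_rel A.through_pairing.equiv.refl z with h1 | ⟨p, hp, _, h2⟩
  · change A.Outer (other A.Through z)
    rwa [← h1]
  · exact outer_of_leg hp.1 h2

theorem Outer.pow {z : Γ.Hf} (hz : A.Outer z) (k : ℕ) : A.Outer (((A.τ * Γ.σ) ^ k) z) := by
  induction k with
  | zero => exact hz
  | succ k ih => rw [pow_succ', Equiv.Perm.mul_apply]; exact ih.σ.τ

theorem Survives.outer {z : Γ.Hf} (hz : A.Survives z) : A.Outer z := hz.1

theorem Outer.survives_or {z : Γ.Hf} (hz : A.Outer z) :
    A.Survives z ∨ ∃ p, A.IsEdgePiece p ∧ p.IsLeg z := by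
  by_cases h : A.Survives z
  · exact Or.inl h
  · refine Or.inr ?_
    have h2 : ¬ ∀ p, A.IsEdgePiece p → Γ.src z ∉ p.verts := fun h2 => h ⟨hz, h2⟩
    push Not at h2
    obtain ⟨p, hp, hm⟩ := h2
    exact ⟨p, hp, hm, hz p hp.1⟩

theorem τ_leg {p : Γ.Piece} (hp : A.IsEdgePiece p) {x y : Γ.Hf} (hx : p.IsLeg x) (hy : p.IsLeg y)
    (hyx : y ≠ x) : A.τ x = y :=
  other_eq_of_rel A.through_pairing (Or.inr ⟨p, hp, hx, hy⟩) hyx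

theorem leg_τ {p : Γ.Piece} (hp : A.IsEdgePiece p) {x : Γ.Hf} (hx : p.IsLeg x) :
    p.IsLeg (A.τ x) ∧ A.τ x ≠ x := by
  obtain ⟨e, he⟩ := hp.2
  obtain ⟨y, hy, hyx⟩ := p.exists_other_leg he hx
  rw [τ_leg hp hx hy hyx]
  exact ⟨hy, hyx⟩

theorem eq_or_eq_τ {p : Γ.Piece} (hp : A.IsEdgePiece p) {x y : Γ.Hf} (hx : p.IsLeg x)
    (hy : p.IsLeg y) : y = x ∨ y = A.τ x := by
  by_cases h : y = x
  · exact Or.inl h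
  · exact Or.inr (τ_leg hp hx hy h).symm

/-- An edge graph has exactly two legs, which `τ` exchanges, so `τ` moves every leg of an edge
graph. -/
theorem Outer.survives_iff {z : Γ.Hf} (hz : A.Outer z) : A.Survives z ↔ A.τ z = z := by
  refine ⟨A.τ_of_survives, fun h => hz.survives_or.resolve_right ?_⟩
  rintro ⟨p, hp, hl⟩
  exact (leg_τ hp hl).2 h

variable (A)

/-- Two vertices become equal in `Γ / A`. -/
def Sim (a b : Γ.Vx) : Prop := a = b ∨ ∃ p ∈ A.pieces, a ∈ p.verts ∧ b ∈ p.verts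

variable {A}

theorem Sim.symm {a b : Γ.Vx} (h : A.Sim a b) : A.Sim b a :=
  h.imp Eq.symm fun ⟨p, hp, h1, h2⟩ => ⟨p, hp, h2, h1⟩

theorem Sim.mem {a b : Γ.Vx} (h : A.Sim a b) {p : Γ.Piece} (hp : p ∈ A.pieces)
    (ha : a ∈ p.verts) : b ∈ p.verts := by
  rcases h with rfl | ⟨q, hq, h1, h2⟩
  · exact ha
  · have := A.eq_of_mem hp hq ha h1
    exact this ▸ h2

theorem Sim.trans {a b c : Γ.Vx} (h : A.Sim a b) (h' : A.Sim b c) : A.Sim a c := by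
  rcases h with rfl | ⟨p, hp, h1, h2⟩
  · exact h'
  · exact Or.inr ⟨p, hp, h1, h'.mem hp h2⟩

theorem qsrc_eq_iff (x y : {h : Γ.Hf // A.Survives h}) :
    A.qsrc x = A.qsrc y ↔ A.Sim (Γ.src x.1) (Γ.src y.1) := by
  rcases h : A.qsrc y with w | p
  · rw [A.qsrc_inl]
    rw [A.qsrc_inl] at h
    rw [h]
    refine ⟨Or.inl, fun h1 => h1.resolve_right ?_⟩
    rintro ⟨p, hp, -, h2⟩
    exact w.2 p hp h2
  · rw [A.qsrc_inr]
    rw [A.qsrc_inr] at h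
    exact ⟨fun h1 => Or.inr ⟨p.1, p.2.1, h1, h⟩, fun h1 => h1.symm.mem p.2.1 h⟩

/-- If `Γ / A` has a vertex, no edge graph of `A` contains all vertices. -/
theorem verts_ne_univ (h : Nonempty A.QVx) {p : Γ.Piece} (hp : A.IsEdgePiece p) :
    p.verts ≠ Set.univ := by
  intro hu
  obtain ⟨w | q⟩ := h
  · exact w.2 p hp.1 (hu ▸ Set.mem_univ _)
  · obtain ⟨⟨w, hw⟩⟩ := (A.gen q.1 q.2.1).1.connected.1
    have := A.eq_of_mem hp.1 q.2.1 (hu ▸ Set.mem_univ _) hw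
    obtain ⟨e, he⟩ := hp.2
    obtain ⟨v, hv⟩ := q.2.2
    rw [← this] at hv
    exact absurd (he.unique hv) (by simp)

theorem σ_ne_of_leg (hΓ : Γ.OnePI) (h : Nonempty A.QVx) {p : Γ.Piece} (hp : A.IsEdgePiece p)
    {x : Γ.Hf} (hx : p.IsLeg x) : Γ.σ x ≠ x := fun hσ => by
  obtain ⟨e, he⟩ := hp.2
  exact verts_ne_univ h hp (p.verts_eq_univ_of_ext_leg hΓ he hx hσ)

theorem exists_pow_of_zpow {α : Type} [Finite α] (π : Equiv.Perm α) (k : ℤ) (x : α) :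
    ∃ m : ℕ, (π ^ m) x = (π ^ k) x := by
  have h : Equiv.Perm.SameCycle π x ((π ^ k) x) := ⟨k, rfl⟩
  obtain ⟨m, -, hm⟩ := h.exists_pow_eq'
  exact ⟨m, hm⟩

/-- Every half-line outside `A` is reached from a half-line of `Γ / A`. -/
theorem Outer.exists_survives (hΓ : Γ.OnePI) (h : Nonempty A.QVx) (hext : Nonempty Γ.Ext)
    {z : Γ.Hf} (hz : A.Outer z) :
    ∃ y, A.Survives y ∧ ∃ k : ℕ, ((A.τ * Γ.σ) ^ k) y = z := by
  by_contra hc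
  set π := A.τ * Γ.σ with hπ
  have hk : ∀ k : ℕ, ¬ A.Survives ((π ^ k) z) := fun k hs => hc ⟨_, hs, by
    obtain ⟨m, hm⟩ := exists_pow_of_zpow π (-k) ((π ^ k) z)
    refine ⟨m, hm.trans ?_⟩
    rw [← zpow_natCast, ← Equiv.Perm.mul_apply, ← zpow_add]
    simp⟩
  have leg : ∀ k : ℕ, ∃ p, A.IsEdgePiece p ∧ p.IsLeg ((π ^ k) z) := fun k =>
    (hz.pow k).survives_or.resolve_left (hk k)
  -- If the orbit of `z` never meets `Γ/A`, it runs through legs of edge graphs only. Leaving one of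
  -- these graphs by `σ` leads to the next or the previous one on the orbit, so by connectedness
  -- they cover all vertices. The external line of `Γ` would then be a leg of an edge graph, which
  -- `σ_ne_of_leg` excludes.
  have hW : ∀ w, ∃ k : ℕ, ∃ p, A.IsEdgePiece p ∧ p.IsLeg ((π ^ k) z) ∧ w ∈ p.verts := by
    intro w
    induction hΓ.connected.2 (Γ.src z) w with
    | refl =>
      obtain ⟨p, hp, hl⟩ := leg 0
      exact ⟨0, p, hp, hl, hl.1⟩
    | tail _ hs ih =>
      obtain ⟨y, h1, -, rfl, rfl⟩ := hs
      obtain ⟨k, p, hp, hl, hy⟩ := ih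
      by_cases hyp : y ∈ p.halves
      · exact ⟨k, p, hp, hl, p.src_mem _ (p.σ_mem _ hyp)⟩
      · rcases eq_or_eq_τ hp hl ⟨hy, hyp⟩ with rfl | rfl
        · obtain ⟨q, hq, hlq⟩ := leg (k + 1)
          refine ⟨k + 1, q, hq, hlq, ?_⟩
          have h2 : A.τ ((π ^ (k + 1)) z) = Γ.σ ((π ^ k) z) := by
            rw [pow_succ', Equiv.Perm.mul_apply, hπ, Equiv.Perm.mul_apply, A.τ_τ]
          rw [← h2]
          exact (leg_τ hq hlq).1.1
        · obtain ⟨m, hm⟩ := exists_pow_of_zpow π ((k : ℤ) - 1) z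
          obtain ⟨q, hq, hlq⟩ := leg m
          refine ⟨m, q, hq, hlq, ?_⟩
          have h2 : Γ.σ (A.τ ((π ^ k) z)) = (π ^ m) z := by
            apply π.injective
            rw [hm, ← Equiv.Perm.mul_apply π (π ^ ((k : ℤ) - 1)), ← zpow_one_add,
              add_sub_cancel, zpow_natCast, hπ, Equiv.Perm.mul_apply, Γ.σ_σ, A.τ_τ]
          rw [h2]
          exact hlq.1
  obtain ⟨x, hx⟩ := hext
  obtain ⟨k, p, hp, hl, hxp⟩ := hW (Γ.src x)
  exact σ_ne_of_leg hΓ h hp ⟨hxp, fun hh => p.internal _ hh hx⟩ hx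

end Sub

end Graph

/-! ## From contractions to quotients -/

/-- Isomorphisms of `Γ'` with `Γ / A` that preserve the labels of the external lines. -/
structure ContractIso {r : T.R} (Γ' Γ : LegGraph T r) (A : Γ.graph.Sub) where
  val : Graph.Iso Γ'.graph A.contract
  label : ∀ (h : Γ'.graph.Ext) (z : Γ.graph.Ext), z.1 = (val.hf h.1).1 → Γ.label z = Γ'.label h

/-- The half-line of `Γ` that corresponds to a half-line of a graph isomorphic to `Γ / A`. -/
def Graph.Iso.half {Γ' Γ : Graph T} {A : Γ.Sub} (φ : Graph.Iso Γ' A.contract) (h : Γ'.Hf) : Γ.Hf :=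
  (φ.hf h).1

namespace ContractIso

variable {r : T.R} {Γ' Γ : LegGraph T r} {A : Γ.graph.Sub}

theorem ext_half {φ ψ : ContractIso Γ' Γ A} (h : ∀ x, φ.val.half x = ψ.val.half x) : φ = ψ := by
  have h1 : φ.val = ψ.val := Graph.Iso.ext_hf fun x => Subtype.ext (h x)
  cases φ; cases ψ
  cases h1
  rfl

theorem sigma_ext {x y : Σ A : Γ.graph.Sub, ContractIso Γ' Γ A} (hA : x.1 = y.1)
    (h : ∀ z, x.2.val.half z = y.2.val.half z) : x = y := by
  obtain ⟨A, φ⟩ := x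
  obtain ⟨B, ψ⟩ := y
  obtain rfl : A = B := hA
  exact congrArg (Sigma.mk A) (ext_half h)

instance : Finite (ContractIso Γ' Γ A) :=
  Finite.of_injective (fun φ => φ.val.half) fun _ _ h => ext_half (congrFun h)

instance : Fintype (ContractIso Γ' Γ A) := Fintype.ofFinite _

end ContractIso

namespace Skeleton.Contraction

open Chain

variable {r : T.R} {Q : Skeleton T r} {Γ' Γ : LegGraph T r}

/-- The disjoint union of the 1PI pieces of a contraction. -/
def toSub (κ : Contraction Q Γ) : Γ.graph.Sub where
  pieces := {q | ∃ p, q = κ.piece p ∧ q.toGraph.OnePI}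
  gen := by
    rintro _ ⟨p, rfl, h⟩
    exact ⟨h, _, (κ.block p).hasResidue⟩
  disj := by
    rintro _ ⟨p, rfl, -⟩ _ ⟨q, rfl, -⟩ hpq
    rw [Set.disjoint_left]
    intro w hw hw'
    exact hpq (congrArg κ.piece (hw.symm.trans hw'))

/-- All pieces may be contracted. -/
def AllGood (κ : Contraction Q Γ) : Prop := ∀ p, (κ.block p).IsGood

theorem cV_eq_of_sim (κ : Contraction Q Γ) {a b : Γ.graph.Vx} (h : κ.toSub.Sim a b) :
    κ.cV a = κ.cV b := by
  rcases h with rfl | ⟨_, ⟨p, rfl, -⟩, h1, h2⟩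
  · rfl
  · exact h1.trans h2.symm

/-- A good piece is either 1PI, hence a component of `toSub`, or a single vertex. -/
theorem AllGood.sim_of_cV_eq {κ : Contraction Q Γ} (hκ : κ.AllGood) {a b : Γ.graph.Vx}
    (h : κ.cV a = κ.cV b) : κ.toSub.Sim a b := by
  rcases hκ (κ.cV b) with h1 | ⟨-, h1⟩
  · exact Or.inr ⟨_, ⟨_, rfl, h1⟩, h, rfl⟩
  · have : Subsingleton (κ.piece (κ.cV b)).verts := h1.2.1
    exact Or.inl (congrArg Subtype.val (Subsingleton.elim
      (⟨a, h⟩ : (κ.piece (κ.cV b)).verts) ⟨b, rfl⟩))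

theorem AllGood.outer_iff {κ : Contraction Q Γ} (hκ : κ.AllGood) (z : Γ.graph.Hf) :
    κ.toSub.Outer z ↔ ∃ x, κ.i x = z := by
  constructor
  · intro hz
    by_contra hc
    push Not at hc
    have hm : z ∈ (κ.piece (κ.cV (Γ.graph.src z))).halves := ⟨hc, rfl⟩
    rcases hκ (κ.cV (Γ.graph.src z)) with h1 | ⟨-, h1⟩
    · exact hz _ ⟨_, rfl, h1⟩ hm
    · exact ((κ.piece _).isExt_iff ⟨z, rfl⟩).1 (h1.2.2 _) hm
  · rintro ⟨x, rfl⟩ _ ⟨p, rfl, -⟩ h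
    exact h.1 x rfl

variable {n : Γ'.graph.Lines → ℕ} {κ : Contraction (chain Γ' n) Γ}

/-- Half-lines of `Γ` that come from a skeleton with chains. -/
def ci (κ : Contraction (chain Γ' n) Γ) (x : CHf n) : Γ.graph.Hf := κ.i x

theorem cV_ci (κ : Contraction (chain Γ' n) Γ) (x : CHf n) :
    κ.cV (Γ.graph.src (κ.ci x)) = csrc n x := κ.src x

theorem σ_ci (κ : Contraction (chain Γ' n) Γ) (x : CHf n) :
    Γ.graph.σ (κ.ci x) = κ.ci (cσ n x) := κ.σ x

theorem ci_inj (κ : Contraction (chain Γ' n) Γ) : Function.Injective κ.ci := κ.i_inj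

theorem isLeg_ci (κ : Contraction (chain Γ' n) Γ) (x : CHf n) :
    (κ.piece (csrc n x)).IsLeg (κ.ci x) :=
  ⟨κ.src x, fun h => h.1 x rfl⟩

theorem AllGood.isEdgePiece (hκ : κ.AllGood) (c : Σ l : Γ'.graph.Lines, Fin (n l)) :
    κ.toSub.IsEdgePiece (κ.piece (Sum.inr c : CV n)) := by
  refine ⟨⟨_, rfl, (hκ (Sum.inr c : CV n)).resolve_right ?_⟩, _, (κ.block (Sum.inr c : CV n)).hasResidue⟩
  rintro ⟨⟨v, hv⟩, -⟩
  exact absurd hv (by simp [chain, cty])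

theorem exists_of_isEdgePiece {q : Γ.graph.Piece} (h : κ.toSub.IsEdgePiece q) :
    ∃ c, q = κ.piece (Sum.inr c : CV n) := by
  obtain ⟨⟨p, rfl, -⟩, e, he⟩ := h
  have h1 := (κ.block p).hasResidue.unique he
  rcases p with w | c
  · exact absurd h1 Sum.inl_ne_inr
  · exact ⟨c, rfl⟩

/-- Position zero is attached to an original vertex, so it is not a leg of an edge graph. The other
positions are paired at the chain vertices, which are contracted edge graphs. -/
theorem AllGood.τ_ci (hκ : κ.AllGood) (x : CHf n) : κ.toSub.τ (κ.ci x) = κ.ci (cτ n x) := by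
  by_cases hx : x.1.2 = 0
  · rw [cτ_zero n hx]
    refine other_eq_self fun y hy => ?_
    rcases hy with rfl | ⟨q, hq, h1, -⟩
    · rfl
    · obtain ⟨c, rfl⟩ := exists_of_isEdgePiece hq
      have h2 := (κ.cV_ci x).symm.trans h1.1
      rw [(csrc_eq_inl n x _).2 ⟨hx, rfl⟩] at h2
      exact absurd h2 (by simp)
  · rcases hs : csrc n x with w | c
    · exact absurd ((csrc_eq_inl n x w).1 hs).1 hx
    · refine Graph.Sub.τ_leg (hκ.isEdgePiece c) (hs ▸ κ.isLeg_ci x) ?_ fun h => ?_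
      · rw [← hs, ← csrc_cτ]
        exact κ.isLeg_ci _
      · have h1 := congrArg (fun x : CHf n => x.1.1) (κ.ci_inj h)
        simp only [cτ_pos n hx] at h1
        exact ne_of_len n (lt_of_lt_of_le (Nat.pos_of_ne_zero hx) x.2) h1

/-- `σ` crosses a segment and `τ` passes through the edge graph at its far end, so `τ σ` advances
one position along the chain. -/
theorem AllGood.π_ci_of_lt (hκ : κ.AllGood) (h : Γ'.graph.Hf) (j : ℕ) (hj : j + 1 ≤ len n h) :
    (κ.toSub.τ * Γ.graph.σ) (κ.ci (link n h j (by omega))) = κ.ci (link n h (j + 1) hj) := by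
  rw [Equiv.Perm.mul_apply, σ_ci, hκ.τ_ci]
  congr 1
  refine Subtype.ext ?_
  have h1 : (cσ n (link n h j (by omega))).1 = (Γ'.graph.σ h, len n h - j) := rfl
  rw [cτ_pos, h1, Γ'.graph.σ_σ, len_σ]
  · exact Prod.ext rfl (by simp only [link]; omega)
  · rw [h1]; simp only; omega

theorem AllGood.π_ci_end (hκ : κ.AllGood) (h : Γ'.graph.Hf) :
    (κ.toSub.τ * Γ.graph.σ) (κ.ci (link n h (len n h) le_rfl)) =
      κ.ci (link n (Γ'.graph.σ h) 0 (Nat.zero_le _)) := by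
  rw [Equiv.Perm.mul_apply, σ_ci, hκ.τ_ci]
  congr 1
  rw [cτ_zero]
  · exact Subtype.ext (Prod.ext rfl (Nat.sub_self _))
  · exact Nat.sub_self _

theorem AllGood.π_pow_ci (hκ : κ.AllGood) (h : Γ'.graph.Hf) (j : ℕ) (hj : j ≤ len n h) :
    ((κ.toSub.τ * Γ.graph.σ) ^ j) (κ.ci (link n h 0 (Nat.zero_le _))) = κ.ci (link n h j hj) := by
  induction j with
  | zero => rfl
  | succ j ih => rw [pow_succ', Equiv.Perm.mul_apply, ih (by omega), hκ.π_ci_of_lt h j hj]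

theorem AllGood.π_pow_ci_end (hκ : κ.AllGood) (h : Γ'.graph.Hf) :
    ((κ.toSub.τ * Γ.graph.σ) ^ (len n h + 1)) (κ.ci (link n h 0 (Nat.zero_le _))) =
      κ.ci (link n (Γ'.graph.σ h) 0 (Nat.zero_le _)) := by
  rw [pow_succ', Equiv.Perm.mul_apply, hκ.π_pow_ci h _ le_rfl, hκ.π_ci_end]

theorem AllGood.survives_ci (hκ : κ.AllGood) (x : CHf n) :
    κ.toSub.Survives (κ.ci x) ↔ x.1.2 = 0 := by
  rw [((hκ.outer_iff _).2 ⟨x, rfl⟩ : κ.toSub.Outer (κ.ci x)).survives_iff, hκ.τ_ci,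
    κ.ci_inj.eq_iff]
  constructor
  · intro h
    by_contra hx
    have h1 := congrArg (fun x : CHf n => x.1.1) h
    simp only [cτ_pos n hx] at h1
    exact ne_of_len n (lt_of_lt_of_le (Nat.pos_of_ne_zero hx) x.2) h1
  · exact cτ_zero n

/-- Half-lines of `Γ / A` for a contraction. -/
def survEquiv (hκ : κ.AllGood) : Γ'.graph.Hf ≃ {z // κ.toSub.Survives z} :=
  Equiv.ofBijective (fun h => ⟨κ.ci (link n h 0 (Nat.zero_le _)), (hκ.survives_ci _).2 rfl⟩)
    ⟨fun h h' e => congrArg (fun x : CHf n => x.1.1) (κ.ci_inj (congrArg Subtype.val e)), by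
      rintro ⟨z, hz⟩
      obtain ⟨x, rfl⟩ := (hκ.outer_iff z).1 hz.outer
      have := (hκ.survives_ci x).1 hz
      exact ⟨(show CHf n from x).1.1, Subtype.ext (congrArg κ.ci
        (Subtype.ext (Prod.ext rfl this.symm)))⟩⟩

/-- A contraction onto `Γ'` with chains identifies `Γ'` with a quotient of `Γ`. -/
def contractIso (hκ : κ.AllGood) : ContractIso Γ' Γ κ.toSub where
  val := Graph.Iso.ofHf (survEquiv hκ)
    (fun x y => by
      refine (Graph.Sub.qsrc_eq_iff (survEquiv hκ x) (survEquiv hκ y)).trans ?_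
      have hc : ∀ x, κ.cV (Γ.graph.src (survEquiv hκ x).1) = Sum.inl (Γ'.graph.src x) := fun x =>
        (κ.cV_ci _).trans ((csrc_eq_inl n _ _).2 ⟨rfl, rfl⟩)
      constructor
      · intro h
        have := κ.cV_eq_of_sim h
        rw [hc, hc] at this
        exact Sum.inl_injective this
      · intro h
        refine hκ.sim_of_cV_eq ?_
        rw [hc, hc, h])
    (fun x => κ.lbl (link n x 0 (Nat.zero_le _)))
    (fun x => by
      change other κ.toSub.Joined _ = _
      by_cases hx : Γ'.graph.σ x = x
      · rw [hx]
        -- An external line carries no chain, so `τ σ` fixes its half-line and the cycle contains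
        -- nothing else.
        refine other_eq_self fun y hy => ?_
        obtain ⟨k, hk⟩ := hy
        refine Subtype.ext (hk.symm.trans (Equiv.Perm.zpow_apply_eq_self_of_apply_eq_self ?_ k))
        have := hκ.π_pow_ci_end x
        rw [show len n x + 1 = 1 by rw [len_ext n hx], pow_one] at this
        refine this.trans (congrArg κ.ci (Subtype.ext (Prod.ext hx rfl)))
      · refine other_eq_of_rel κ.toSub.joined_pairing ⟨(len n x + 1 : ℕ), ?_⟩ fun h =>
          hx ((survEquiv hκ).injective h)
        rw [zpow_natCast]
        exact hκ.π_pow_ci_end x)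
  label h z e := by
    have h1 : cσ n (link n h.1 0 (Nat.zero_le _)) = link n h.1 0 (Nat.zero_le _) :=
      (cσ_eq_iff n _).2 h.2
    exact κ.label ⟨link n h.1 0 (Nat.zero_le _), h1⟩ z e

end Skeleton.Contraction

end FeynmanHopf

end

/-! ### Contractions obtained from quotients, and the bijection between the two. -/

noncomputable section

namespace FeynmanHopf

open scoped Classical

variable {T : FieldTheory}

/-! ## From quotients to contractions -/

theorem LegGraph.nonempty_ext {r : T.R} (Γ : LegGraph T r) : Nonempty Γ.graph.Ext := by
  have h := Γ.card_ext
  have h2 := T.two_le_valence r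
  exact (Nat.card_pos_iff.1 (by omega)).1

namespace Graph.Iso

variable {Γ' Γ : Graph T} {A : Γ.Sub} (φ : Graph.Iso Γ' A.contract)

theorem survives_half (h : Γ'.Hf) : A.Survives (φ.half h) := (φ.hf h).2

theorem half_inj : Function.Injective φ.half := fun _ _ h =>
  φ.hf.injective (Subtype.ext h)

theorem exists_half {z : Γ.Hf} (hz : A.Survives z) : ∃ h, φ.half h = z := by
  obtain ⟨h, hh⟩ := φ.hf.surjective (⟨z, hz⟩ : {z // A.Survives z})
  exact ⟨h, congrArg Subtype.val hh⟩

theorem sim_half_iff (h h' : Γ'.Hf) :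
    A.Sim (Γ.src (φ.half h)) (Γ.src (φ.half h')) ↔
      Γ'.src h = Γ'.src h' := by
  refine (Graph.Sub.qsrc_eq_iff (φ.hf h) (φ.hf h')).symm.trans ?_
  have h1 : ∀ h, A.qsrc (φ.hf h) = φ.vx (Γ'.src h) := φ.src_hf
  rw [h1, h1]
  exact φ.vx.injective.eq_iff

theorem exists_return (h : Γ'.Hf) :
    ∃ k : ℕ, A.Survives (((A.τ * Γ.σ) ^ (k + 1)) (φ.half h)) := by
  refine ⟨orderOf (A.τ * Γ.σ) - 1, ?_⟩
  rw [Nat.sub_add_cancel (orderOf_pos _), pow_orderOf_eq_one]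
  exact φ.survives_half h

/-- The number of edge graphs on the line through a half-line. -/
def period (h : Γ'.Hf) : ℕ := Nat.find (φ.exists_return h)

theorem survives_period (h : Γ'.Hf) :
    A.Survives (((A.τ * Γ.σ) ^ (φ.period h + 1)) (φ.half h)) :=
  Nat.find_spec (φ.exists_return h)

theorem not_survives {h : Γ'.Hf} {a : ℕ} (h0 : 0 < a) (ha : a ≤ φ.period h) :
    ¬ A.Survives (((A.τ * Γ.σ) ^ a) (φ.half h)) := by
  have := Nat.find_min (φ.exists_return h) (m := a - 1) (by unfold period at ha; omega)
  rwa [Nat.sub_add_cancel h0] at this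

theorem period_eq {h : Γ'.Hf} {k : ℕ}
    (h1 : A.Survives (((A.τ * Γ.σ) ^ (k + 1)) (φ.half h)))
    (h2 : ∀ a, 0 < a → a ≤ k → ¬ A.Survives (((A.τ * Γ.σ) ^ a) (φ.half h))) :
    φ.period h = k := by
  refine (Nat.find_eq_iff _).2 ⟨h1, fun a ha => h2 (a + 1) (by omega) (by omega)⟩

theorem outer_pow (h : Γ'.Hf) (k : ℕ) :
    A.Outer (((A.τ * Γ.σ) ^ k) (φ.half h)) := (φ.survives_half h).outer.pow k

theorem other_joined (h : Γ'.Hf) :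
    other A.Joined (φ.hf h : {z // A.Survives z}) = φ.hf (Γ'.σ h) :=
  φ.σ_hf h

/-- A cycle of `τ σ` meets at most two surviving half-lines, so the first return is the other end of
the line unless it is `h` itself. In that case survivors occur only at multiples of `period + 1`,
where the walk is back at `h`; hence `σ h = h`. -/
theorem pow_period (h : Γ'.Hf) :
    ((A.τ * Γ.σ) ^ (φ.period h + 1)) (φ.half h) = φ.half (Γ'.σ h) := by
  set k : {z // A.Survives z} := ⟨_, φ.survives_period h⟩ with hk
  have hj : A.Joined (φ.hf h) k := ⟨(φ.period h + 1 : ℕ), by rw [zpow_natCast]; rfl⟩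
  by_cases hkh : k = φ.hf h
  · by_cases hσ : Γ'.σ h = h
    · rw [hσ]
      exact congrArg Subtype.val hkh
    · exfalso
      have hj' : A.Joined (φ.hf h) (φ.hf (Γ'.σ h)) := by
        rw [← φ.other_joined h]
        exact other_rel A.joined_pairing.equiv.refl _
      obtain ⟨m, -, hm⟩ := Equiv.Perm.SameCycle.exists_pow_eq' hj'
      have hper : ((A.τ * Γ.σ) ^ (φ.period h + 1)) (φ.half h) = φ.half h :=
        congrArg Subtype.val hkh
      have hmul : ∀ q : ℕ, ((A.τ * Γ.σ) ^ ((φ.period h + 1) * q)) (φ.half h) = φ.half h := by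
        intro q
        rw [pow_mul]
        induction q with
        | zero => rfl
        | succ q ih => rw [pow_succ, Equiv.Perm.mul_apply, hper, ih]
      have hmod : ((A.τ * Γ.σ) ^ (m % (φ.period h + 1))) (φ.half h) =
          φ.half (Γ'.σ h) := by
        rw [← Nat.mod_add_div m (φ.period h + 1), pow_add, Equiv.Perm.mul_apply] at hm
        rw [← hmul (m / (φ.period h + 1))]
        exact hm
      rcases Nat.eq_zero_or_pos (m % (φ.period h + 1)) with h0 | h0
      · rw [h0] at hmod
        exact hσ (φ.half_inj hmod).symm
      · refine φ.not_survives h0 (Nat.lt_succ_iff.1 (Nat.mod_lt _ (Nat.succ_pos _))) ?_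
        rw [hmod]
        exact φ.survives_half _
  · have := other_eq_of_rel A.joined_pairing hj hkh
    rw [φ.other_joined] at this
    exact (congrArg Subtype.val this).symm

/-- Reversal of the line through a half-line. -/
theorem σ_pow (h : Γ'.Hf) (j : ℕ) (hj : j ≤ φ.period h) :
    Γ.σ (((A.τ * Γ.σ) ^ j) (φ.half h)) =
      ((A.τ * Γ.σ) ^ (φ.period h - j)) (φ.half (Γ'.σ h)) := by
  have h1 : ∀ x, Γ.σ x = A.τ ((A.τ * Γ.σ) x) := fun x => by
    rw [Equiv.Perm.mul_apply, A.τ_τ]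
  obtain ⟨i, hi⟩ : ∃ i, i = φ.period h - j := ⟨_, rfl⟩
  induction i generalizing j with
  | zero =>
    obtain rfl : j = φ.period h := by omega
    rw [h1, ← Equiv.Perm.mul_apply (A.τ * Γ.σ), ← pow_succ', φ.pow_period, Nat.sub_self,
      A.τ_of_survives (φ.survives_half _)]
    rfl
  | succ i ih =>
    have h2 := ih (j + 1) (by omega) (by omega)
    rw [show φ.period h - j = (φ.period h - (j + 1)) + 1 by omega,
      pow_succ' _ (φ.period h - (j + 1)), Equiv.Perm.mul_apply, ← h2]
    simp only [pow_succ', Equiv.Perm.mul_apply, Γ.σ_σ, A.τ_τ]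

theorem τ_pow (h : Γ'.Hf) (j : ℕ) (h0 : 0 < j) (hj : j ≤ φ.period h) :
    A.τ (((A.τ * Γ.σ) ^ j) (φ.half h)) =
      ((A.τ * Γ.σ) ^ (φ.period h + 1 - j)) (φ.half (Γ'.σ h)) := by
  obtain ⟨i, rfl⟩ : ∃ i, j = i + 1 := ⟨j - 1, by omega⟩
  rw [pow_succ', Equiv.Perm.mul_apply, Equiv.Perm.mul_apply, A.τ_τ, φ.σ_pow h i (by omega)]
  congr 2
  omega

theorem period_σ (h : Γ'.Hf) : φ.period (Γ'.σ h) = φ.period h := by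
  refine φ.period_eq ?_ fun a h0 ha hs => ?_
  · have h1 := φ.σ_pow h 0 (Nat.zero_le _)
    rw [Nat.sub_zero] at h1
    rw [pow_succ', Equiv.Perm.mul_apply, ← h1, Equiv.Perm.mul_apply, Γ.σ_σ, pow_zero,
      Equiv.Perm.one_apply, A.τ_of_survives (φ.survives_half h)]
    exact φ.survives_half h
  · have h1 := φ.τ_pow h (φ.period h + 1 - a) (by omega) (by omega)
    rw [show φ.period h + 1 - (φ.period h + 1 - a) = a by omega] at h1
    have h2 := A.τ_of_survives hs
    rw [← h1, A.τ_τ] at h2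
    rw [← h1, ← h2] at hs
    exact φ.not_survives (by omega) (by omega) hs



theorem nonempty_qvx (φ : Graph.Iso Γ' A.contract) (hΓ' : Γ'.OnePI) : Nonempty A.QVx :=
  ⟨φ.vx hΓ'.connected.1.some⟩

/-- For an external line the walk is its own reversal. With edge graphs on it, its midpoint would be
fixed by `σ` (even period: an external leg of an edge graph) or by `τ` (odd period: a survivor
before the first return); both are impossible. -/
theorem period_ext (hΓ : Γ.OnePI) (hΓ' : Γ'.OnePI) {h : Γ'.Hf}
    (hσ : Γ'.σ h = h) : φ.period h = 0 := by
  by_contra h0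
  rcases Nat.even_or_odd' (φ.period h) with ⟨j, hj | hj⟩
  · have h1 := φ.σ_pow h j (by omega)
    rw [show φ.period h - j = j by omega, hσ] at h1
    obtain ⟨p, hp, hl⟩ := (φ.outer_pow h j).survives_or.resolve_left
      (φ.not_survives (by omega) (by omega))
    exact Graph.Sub.σ_ne_of_leg hΓ (φ.nonempty_qvx hΓ') hp hl h1
  · have h1 := φ.τ_pow h (j + 1) (by omega) (by omega)
    rw [show φ.period h + 1 - (j + 1) = j + 1 by omega, hσ] at h1
    exact φ.not_survives (by omega) (by omega) ((φ.outer_pow h (j + 1)).survives_iff.2 h1)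

/-- An external line of `Γ/A` passes through no edge graph, so `τ σ x = x`; since `τ` fixes
survivors, `σ x = x`. -/
theorem contract_ext_iff (hΓ : Γ.OnePI) (hA : A.contract.OnePI) (x : {z : Γ.Hf // A.Survives z}) :
    A.contract.σ x = x ↔ Γ.σ x.1 = x.1 := by
  constructor
  · intro h
    have h1 := (refl A.contract).pow_period x
    rw [(refl A.contract).period_ext hΓ hA h, zero_add, pow_one, h] at h1
    change A.τ (Γ.σ x.1) = x.1 at h1
    have h2 := congrArg A.τ h1
    rwa [A.τ_τ, A.τ_of_survives x.2] at h2
  · intro h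
    have h1 : (A.τ * Γ.σ) x.1 = x.1 := by
      rw [Equiv.Perm.mul_apply, h, A.τ_of_survives x.2]
    exact other_eq_self fun y ⟨k, hk⟩ => Subtype.ext
      (hk.symm.trans (Equiv.Perm.zpow_apply_eq_self_of_apply_eq_self h1 k))

end Graph.Iso

namespace ContractIso

open Chain

variable {r : T.R} {Γ' Γ : LegGraph T r} {A : Γ.graph.Sub} (φ : ContractIso Γ' Γ A)

/-- The numbers of edge graphs on the lines of `Γ'`. -/
def num (l : Γ'.graph.Lines) : ℕ := φ.val.period l.1

theorem len_num (hΓ : Γ.graph.OnePI) (hΓ' : Γ'.graph.OnePI) (h : Γ'.graph.Hf) :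
    len φ.num h = φ.val.period h := by
  unfold len
  split_ifs with o o'
  · rfl
  · exact φ.val.period_σ h
  · refine (φ.val.period_ext hΓ hΓ' ?_).symm
    by_contra hσ
    exact (Γ'.graph.oriented_or hσ).elim o o'

/-- The half-line of `Γ` that corresponds to a half-line of `Γ'` with chains. -/
def lift (x : CHf φ.num) : Γ.graph.Hf := ((A.τ * Γ.graph.σ) ^ x.1.2) (φ.val.half x.1.1)

variable {φ}

theorem le_period (hΓ : Γ.graph.OnePI) (hΓ' : Γ'.graph.OnePI) (x : CHf φ.num) :
    x.1.2 ≤ φ.val.period x.1.1 := (x.2).trans_eq (φ.len_num hΓ hΓ' _)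

theorem outer_lift (x : CHf φ.num) : A.Outer (φ.lift x) := φ.val.outer_pow _ _

theorem survives_lift_iff (hΓ : Γ.graph.OnePI) (hΓ' : Γ'.graph.OnePI) (x : CHf φ.num) :
    A.Survives (φ.lift x) ↔ x.1.2 = 0 := by
  constructor
  · intro h
    by_contra h0
    exact φ.val.not_survives (Nat.pos_of_ne_zero h0) (le_period hΓ hΓ' x) h
  · intro h
    rw [lift, h]
    exact φ.val.survives_half _

theorem σ_lift (hΓ : Γ.graph.OnePI) (hΓ' : Γ'.graph.OnePI) (x : CHf φ.num) :
    Γ.graph.σ (φ.lift x) = φ.lift (cσ φ.num x) := by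
  have h1 : (cσ φ.num x).1 = (Γ'.graph.σ x.1.1, len φ.num x.1.1 - x.1.2) := rfl
  rw [lift, φ.val.σ_pow _ _ (le_period hΓ hΓ' x), lift, h1, φ.len_num hΓ hΓ']

theorem τ_lift (hΓ : Γ.graph.OnePI) (hΓ' : Γ'.graph.OnePI) (x : CHf φ.num) :
    A.τ (φ.lift x) = φ.lift (cτ φ.num x) := by
  by_cases h0 : x.1.2 = 0
  · rw [cτ_zero _ h0]
    exact A.τ_of_survives ((survives_lift_iff hΓ hΓ' x).2 h0)
  · rw [lift, φ.val.τ_pow _ _ (Nat.pos_of_ne_zero h0) (le_period hΓ hΓ' x), lift, cτ_pos _ h0,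
      φ.len_num hΓ hΓ']

/-- If two positions coincide, going back along the smaller one exhibits a survivor strictly inside
the other walk unless the positions are equal. -/
theorem lift_inj (hΓ : Γ.graph.OnePI) (hΓ' : Γ'.graph.OnePI) : Function.Injective φ.lift := by
  have key : ∀ x y : CHf φ.num, x.1.2 ≤ y.1.2 → φ.lift x = φ.lift y → x = y := by
    intro x y hxy h
    have h1 : φ.val.half x.1.1 = ((A.τ * Γ.graph.σ) ^ (y.1.2 - x.1.2)) (φ.val.half y.1.1) := by
      apply ((A.τ * Γ.graph.σ) ^ x.1.2).injective
      rw [← Equiv.Perm.mul_apply, ← pow_add, Nat.add_sub_cancel' hxy]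
      exact h
    have h2 : y.1.2 - x.1.2 = 0 := by
      by_contra h0
      refine φ.val.not_survives (Nat.pos_of_ne_zero h0)
        ((Nat.sub_le _ _).trans (le_period hΓ hΓ' y)) ?_
      rw [← h1]
      exact φ.val.survives_half _
    rw [h2] at h1
    exact Subtype.ext (Prod.ext (φ.val.half_inj h1) (by omega))
  intro x y h
  rcases le_total x.1.2 y.1.2 with h1 | h1
  · exact key x y h1 h
  · exact (key y x h1 h.symm).symm

theorem exists_lift (hΓ : Γ.graph.OnePI) (hΓ' : Γ'.graph.OnePI) {z : Γ.graph.Hf}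
    (hz : A.Outer z) : ∃ x, φ.lift x = z := by
  obtain ⟨y, hy, k, rfl⟩ := hz.exists_survives hΓ (φ.val.nonempty_qvx hΓ') Γ.nonempty_ext
  clear hz
  induction k using Nat.strong_induction_on generalizing y with
  | _ k ih =>
    obtain ⟨h, rfl⟩ := φ.val.exists_half hy
    by_cases hk : k ≤ φ.val.period h
    · exact ⟨link φ.num h k (hk.trans_eq (φ.len_num hΓ hΓ' h).symm), rfl⟩
    · have := ih (k - (φ.val.period h + 1)) (by omega) (φ.val.half (Γ'.graph.σ h)) (φ.val.survives_half _)
      rwa [← φ.val.pow_period, ← Equiv.Perm.mul_apply, ← pow_add, Nat.sub_add_cancel (by omega)]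
        at this

theorem sim_lift_of_pos (hΓ : Γ.graph.OnePI) (hΓ' : Γ'.graph.OnePI) {x : CHf φ.num}
    (hx : x.1.2 ≠ 0) (y : CHf φ.num) :
    A.Sim (Γ.graph.src (φ.lift x)) (Γ.graph.src (φ.lift y)) ↔
      csrc φ.num x = csrc φ.num y := by
  obtain ⟨p, hp, hl⟩ := (outer_lift x).survives_or.resolve_left
    fun h => hx ((survives_lift_iff hΓ hΓ' x).1 h)
  rw [csrc_pos_eq_iff _ hx]
  constructor
  · intro h
    have h1 := h.mem hp.1 hl.1
    refine (Graph.Sub.eq_or_eq_τ hp hl ⟨h1, outer_lift y p hp.1⟩).imp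
      (fun h => lift_inj hΓ hΓ' h) fun h => lift_inj hΓ hΓ' ?_
    rw [h, τ_lift hΓ hΓ']
  · rintro (rfl | rfl)
    · exact Or.inl rfl
    · rw [← τ_lift hΓ hΓ']
      exact Or.inr ⟨p, hp.1, hl.1, (Graph.Sub.leg_τ hp hl).1.1⟩

theorem sim_lift_iff (hΓ : Γ.graph.OnePI) (hΓ' : Γ'.graph.OnePI) (x y : CHf φ.num) :
    A.Sim (Γ.graph.src (φ.lift x)) (Γ.graph.src (φ.lift y)) ↔
      csrc φ.num x = csrc φ.num y := by
  by_cases hx : x.1.2 = 0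
  · by_cases hy : y.1.2 = 0
    · rw [(csrc_eq_inl _ y _).2 ⟨hy, rfl⟩, csrc_eq_inl, lift, lift, hx, hy]
      exact (φ.val.sim_half_iff _ _).trans (by simp)
    · exact ⟨fun h => ((sim_lift_of_pos hΓ hΓ' hy x).1 h.symm).symm,
        fun h => ((sim_lift_of_pos hΓ hΓ' hy x).2 h.symm).symm⟩
  · exact sim_lift_of_pos hΓ hΓ' hx y

/-- Each component of `A` has a leg, because residues have at least two lines, and each vertex
outside `A` has a half-line; both lie outside `A` and hence come from the skeleton. -/
theorem exists_sim_lift (hΓ : Γ.graph.OnePI) (hΓ' : Γ'.graph.OnePI) (w : Γ.graph.Vx) :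
    ∃ x : CHf φ.num, A.Sim w (Γ.graph.src (φ.lift x)) := by
  by_cases hw : ∃ p ∈ A.pieces, w ∈ p.verts
  · obtain ⟨p, hp, hw⟩ := hw
    obtain ⟨r, hr⟩ := (A.gen p hp).2
    obtain ⟨z, hz⟩ := p.exists_leg hr
    obtain ⟨x, rfl⟩ := exists_lift (φ := φ) hΓ hΓ' (Graph.Sub.outer_of_leg hp hz)
    exact ⟨x, Or.inr ⟨p, hp, hw, hz.1⟩⟩
  · obtain ⟨z, rfl⟩ := Γ.graph.src_surjective w
    obtain ⟨x, rfl⟩ := exists_lift (φ := φ) (z := z) hΓ hΓ' fun p hp hz => hw ⟨p, hp, p.src_mem _ hz⟩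
    exact ⟨x, Or.inl rfl⟩

/-- The vertex of the skeleton to which a vertex is contracted. -/
def liftV (φ : ContractIso Γ' Γ A) (hΓ : Γ.graph.OnePI) (hΓ' : Γ'.graph.OnePI)
    (w : Γ.graph.Vx) : CV φ.num :=
  csrc φ.num (exists_sim_lift (φ := φ) hΓ hΓ' w).choose

theorem liftV_eq (hΓ : Γ.graph.OnePI) (hΓ' : Γ'.graph.OnePI) {w : Γ.graph.Vx} {x : CHf φ.num}
    (h : A.Sim w (Γ.graph.src (φ.lift x))) : liftV φ hΓ hΓ' w = csrc φ.num x :=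
  (sim_lift_iff hΓ hΓ' _ _).1 ((exists_sim_lift (φ := φ) hΓ hΓ' w).choose_spec.symm.trans h)

theorem liftV_eq_iff (hΓ : Γ.graph.OnePI) (hΓ' : Γ'.graph.OnePI) (w w' : Γ.graph.Vx) :
    liftV φ hΓ hΓ' w = liftV φ hΓ hΓ' w' ↔ A.Sim w w' := by
  obtain ⟨x, hx⟩ := exists_sim_lift (φ := φ) hΓ hΓ' w
  obtain ⟨y, hy⟩ := exists_sim_lift (φ := φ) hΓ hΓ' w'
  rw [liftV_eq hΓ hΓ' hx, liftV_eq hΓ hΓ' hy, ← sim_lift_iff hΓ hΓ']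
  exact ⟨fun h => hx.trans (h.trans hy.symm), fun h => hx.symm.trans (h.trans hy)⟩

/-- A quotient isomorphic to `Γ'` gives a contraction onto `Γ'` with chains. -/
def contraction (φ : ContractIso Γ' Γ A) (hΓ : Γ.graph.OnePI) (hΓ' : Γ'.graph.OnePI) :
    Skeleton.Contraction (chain Γ' φ.num) Γ where
  cV := liftV φ hΓ hΓ'
  i := φ.lift
  i_inj := lift_inj hΓ hΓ'
  src x := liftV_eq hΓ hΓ' (Or.inl rfl)
  lbl x := by
    have h1 : ∀ z, Γ.graph.lbl ((A.τ * Γ.graph.σ) z) = Γ.graph.lbl z := fun z => by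
      rw [Equiv.Perm.mul_apply, A.lbl_τ, Γ.graph.lbl_σ]
    have h2 : ∀ k z, Γ.graph.lbl (((A.τ * Γ.graph.σ) ^ k) z) = Γ.graph.lbl z := fun k => by
      induction k with
      | zero => exact fun _ => rfl
      | succ k ih => exact fun z => by rw [pow_succ', Equiv.Perm.mul_apply, h1, ih]
    exact (h2 _ _).trans (φ.val.lbl_hf _)
  σ x := σ_lift hΓ hΓ' x
  inner z hz := by
    have h1 : ¬ A.Outer z := fun h => by
      obtain ⟨x, hx⟩ := exists_lift (φ := φ) hΓ hΓ' h
      exact hz x hx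
    unfold Graph.Sub.Outer at h1
    push Not at h1
    obtain ⟨p, hp, h1⟩ := h1
    exact ⟨p.internal _ h1, (liftV_eq_iff hΓ hΓ' _ _).2
      (Or.inr ⟨p, hp, p.src_mem _ (p.σ_mem _ h1), p.src_mem _ h1⟩)⟩
  label x z e := by
    have h0 : Γ'.graph.σ x.1.1.1 = x.1.1.1 := (cσ_eq_iff _ _).1 x.2
    have h1 := le_period hΓ hΓ' x.1
    rw [φ.val.period_ext hΓ hΓ' h0] at h1
    refine φ.label ⟨x.1.1.1, h0⟩ z (e.trans ?_)
    change ((A.τ * Γ.graph.σ) ^ x.1.1.2) (φ.val.half x.1.1.1) = _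
    rw [Nat.le_zero.1 h1]
    rfl

theorem piece_contraction (hΓ : Γ.graph.OnePI) (hΓ' : Γ'.graph.OnePI) {q : Γ.graph.Piece}
    (hq : q ∈ A.pieces) {w : Γ.graph.Vx} (hw : w ∈ q.verts) :
    (contraction φ hΓ hΓ').piece (liftV φ hΓ hΓ' w) = q := by
  have hv : ((contraction φ hΓ hΓ').piece (liftV φ hΓ hΓ' w)).verts = q.verts := by
    ext w'
    refine (liftV_eq_iff hΓ hΓ' w' w).trans ⟨fun h => h.symm.mem hq hw,
      fun h => Or.inr ⟨q, hq, h, hw⟩⟩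
  have hh : ((contraction φ hΓ hΓ').piece (liftV φ hΓ hΓ' w)).halves = q.halves := by
    ext z
    constructor
    · rintro ⟨h1, h2⟩
      have h3 : Γ.graph.src z ∈ q.verts := by rw [← hv]; exact h2
      by_contra hz
      obtain ⟨x, hx⟩ := exists_lift (φ := φ) hΓ hΓ' (Graph.Sub.outer_of_leg hq ⟨h3, hz⟩)
      exact h1 x hx
    · intro hz
      refine ⟨fun x hx => outer_lift x q hq ?_, ?_⟩
      · change φ.lift x = z at hx
        rwa [hx]
      · have := q.src_mem _ hz
        rw [← hv] at this
        exact this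
  have ext : ∀ p q : Γ.graph.Piece, p.verts = q.verts → p.halves = q.halves → p = q := by
    rintro ⟨a, b, _, _, _⟩ ⟨c, d, _, _, _⟩ h h'
    cases h; cases h'
    rfl
  exact ext _ _ hv hh

theorem trivial_of_bare (hΓ : Γ.graph.OnePI) (hΓ' : Γ'.graph.OnePI) {w : Γ.graph.Vx}
    (hw : ∀ q ∈ A.pieces, w ∉ q.verts) :
    ((contraction φ hΓ hΓ').block (liftV φ hΓ hΓ' w)).IsTrivial := by
  have h1 : ∀ w', liftV φ hΓ hΓ' w' = liftV φ hΓ hΓ' w → w' = w := fun w' h =>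
    ((liftV_eq_iff hΓ hΓ' w' w).1 h).resolve_right fun ⟨q, hq, _, h2⟩ => hw q hq h2
  refine ⟨⟨⟨w, rfl⟩⟩, ⟨fun a b => Subtype.ext ((h1 _ a.2).trans (h1 _ b.2).symm)⟩, fun z => ?_⟩
  refine (((contraction φ hΓ hΓ').piece _).isExt_iff z).2 fun hz => ?_
  have h2 : Γ.graph.src z.1 = w := h1 _ z.2
  obtain ⟨x, hx⟩ := exists_lift (φ := φ) (z := z.1) hΓ hΓ' fun q hq hzq =>
    hw q hq (h2 ▸ q.src_mem _ hzq)
  exact hz.1 x hx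

theorem liftV_surjective (hΓ : Γ.graph.OnePI) (hΓ' : Γ'.graph.OnePI) :
    Function.Surjective (liftV φ hΓ hΓ') := by
  rintro (w | ⟨l, i⟩)
  · obtain ⟨h, rfl⟩ := Γ'.graph.src_surjective w
    exact ⟨_, (liftV_eq hΓ hΓ' (x := link _ h 0 (Nat.zero_le _)) (Or.inl rfl)).trans
      ((csrc_eq_inl _ _ _).2 ⟨rfl, rfl⟩)⟩
  · have hl := len_line φ.num l
    have hi := i.2
    exact ⟨_, (liftV_eq hΓ hΓ' (x := link _ l.1 (i.1 + 1) (by omega)) (Or.inl rfl)).trans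
      ((csrc_eq_inr _ _ _ _).2 (Or.inl rfl))⟩

theorem contraction_allGood (hΓ : Γ.graph.OnePI) (hΓ' : Γ'.graph.OnePI) :
    (contraction φ hΓ hΓ').AllGood := by
  intro p
  obtain ⟨w, rfl⟩ := liftV_surjective (φ := φ) hΓ hΓ' p
  by_cases hw : ∃ q ∈ A.pieces, w ∈ q.verts
  · obtain ⟨q, hq, hwq⟩ := hw
    refine Or.inl ?_
    change ((contraction φ hΓ hΓ').piece (liftV φ hΓ hΓ' w)).toGraph.OnePI
    rw [piece_contraction hΓ hΓ' hq hwq]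
    exact (A.gen q hq).1
  · push Not at hw
    refine Or.inr ⟨?_, trivial_of_bare hΓ hΓ' hw⟩
    rcases hp : liftV φ hΓ hΓ' w with u | c
    · exact ⟨_, rfl⟩
    -- A vertex outside `A` cannot lie over a chain vertex: the half-lines there are at positions `j
    -- > 0`, which are legs of edge graphs of `A`.
    · exfalso
      obtain ⟨x, hx⟩ := exists_sim_lift (φ := φ) hΓ hΓ' w
      have h1 : csrc φ.num x = Sum.inr c := (liftV_eq hΓ hΓ' hx).symm.trans hp
      rcases (outer_lift x).survives_or with h2 | ⟨q, hq, hl⟩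
      · rw [(csrc_eq_inl _ x _).2 ⟨(survives_lift_iff hΓ hΓ' x).1 h2, rfl⟩] at h1
        exact absurd h1 (by simp)
      · exact hw q hq.1 (hx.symm.mem hq.1 hl.1)

theorem contraction_toSub (hΓ : Γ.graph.OnePI) (hΓ' : Γ'.graph.OnePI) :
    (contraction φ hΓ hΓ').toSub = A := by
  refine Graph.Sub.ext_pieces (Set.ext fun q => ⟨?_, fun hq => ?_⟩)
  · rintro ⟨p, rfl, h⟩
    obtain ⟨w, rfl⟩ := liftV_surjective (φ := φ) hΓ hΓ' p
    by_cases hw : ∃ q ∈ A.pieces, w ∈ q.verts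
    · obtain ⟨q, hq, hwq⟩ := hw
      rwa [piece_contraction hΓ hΓ' hq hwq]
    · push Not at hw
      exact absurd h (trivial_of_bare hΓ hΓ' hw).not_onePI
  · obtain ⟨⟨w, hw⟩⟩ := (A.gen q hq).1.connected.1
    exact ⟨liftV φ hΓ hΓ' w, (piece_contraction hΓ hΓ' hq hw).symm, (A.gen q hq).1⟩

end ContractIso

/-! ## The correspondence -/

open Chain Skeleton Skeleton.Contraction

variable {r : T.R} {Γ' Γ : LegGraph T r}

/-- The subgraph and the ends of the lines fix the walk `τ σ`, and the chain length is the time it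
needs to reach the other end. A longer chain would still be inside at that moment. -/
theorem len_le_of_toSub_eq {n n' : Γ'.graph.Lines → ℕ} {κ : Contraction (chain Γ' n) Γ}
    {κ' : Contraction (chain Γ' n') Γ} (hκ : κ.AllGood) (hκ' : κ'.AllGood)
    (hA : κ.toSub = κ'.toSub)
    (h0 : ∀ h, κ.ci (link n h 0 (Nat.zero_le _)) = κ'.ci (link n' h 0 (Nat.zero_le _)))
    (h : Γ'.graph.Hf) : len n' h ≤ len n h := by
  by_contra hlt
  have h1 := hκ.π_pow_ci_end h
  rw [hA, h0, h0, hκ'.π_pow_ci h (len n h + 1) (by omega)] at h1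
  exact absurd (congrArg (fun x : CHf n' => x.1.2) (κ'.ci_inj h1)) (by simp [link])

/-- The interior of each chain is recovered by iterating `τ σ` from its end. Every vertex then lies
in the piece of one of these half-lines. -/
theorem contraction_eq {n : Γ'.graph.Lines → ℕ} {κ κ' : Contraction (chain Γ' n) Γ}
    (hκ : κ.AllGood) (hκ' : κ'.AllGood) (hA : κ.toSub = κ'.toSub)
    (h0 : ∀ h, κ.ci (link n h 0 (Nat.zero_le _)) = κ'.ci (link n h 0 (Nat.zero_le _))) :
    κ = κ' := by
  have hi : ∀ x : CHf n, κ.ci x = κ'.ci x := by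
    rintro ⟨⟨h, j⟩, hj⟩
    have h1 := hκ.π_pow_ci h j hj
    rw [hA, h0, hκ'.π_pow_ci h j hj] at h1
    exact h1.symm
  refine ext_iff' (fun w => ?_) hi
  obtain ⟨z, hz⟩ := (κ.piece (κ.cV w)).exists_leg (κ.block (κ.cV w)).hasResidue
  have h1 : κ.toSub.Sim w (Γ.graph.src z) := hκ.sim_of_cV_eq hz.1.symm
  have h2 : ∃ x : CHf n, κ.ci x = z := by
    by_contra hc
    push Not at hc
    exact hz.2 ⟨hc, hz.1⟩
  obtain ⟨x, rfl⟩ := h2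
  rw [κ.cV_eq_of_sim h1, κ.cV_ci]
  rw [hA] at h1
  rw [κ'.cV_eq_of_sim h1, hi, κ'.cV_ci]

/-- Contractions of `Γ` onto `Γ'` with chains of edge vertices correspond to subgraphs `A` with an
isomorphism of `Γ'` with `Γ / A`. -/
theorem bijective_contractIso (hΓ : Γ.graph.OnePI) (hΓ' : Γ'.graph.OnePI) {B : ℕ}
    (hB : ∀ (n : Γ'.graph.Lines → ℕ) (κ : Contraction (chain Γ' n) Γ), κ.AllGood → ∀ l, n l < B) :
    Function.Bijective (fun x : Σ n : Γ'.graph.Lines → Fin B,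
      {κ : Contraction (chain Γ' fun l => (n l : ℕ)) Γ // κ.AllGood} =>
      (⟨x.2.1.toSub, contractIso x.2.2⟩ : Σ A : Γ.graph.Sub, ContractIso Γ' Γ A)) := by
  constructor
  · rintro ⟨n, κ, hκ⟩ ⟨n', κ', hκ'⟩ h
    have hA : κ.toSub = κ'.toSub := congrArg Sigma.fst h
    have h0 : ∀ z, κ.ci (link _ z 0 (Nat.zero_le _)) = κ'.ci (link _ z 0 (Nat.zero_le _)) :=
      fun z => congrArg (fun x : Σ A : Γ.graph.Sub, ContractIso Γ' Γ A => x.2.val.half z) h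
    have hn : n = n' := by
      funext l
      have h1 := len_le_of_toSub_eq hκ hκ' hA h0 l.1
      have h2 := len_le_of_toSub_eq hκ' hκ hA.symm (fun z => (h0 z).symm) l.1
      rw [len_line, len_line] at h1 h2
      exact Fin.ext (le_antisymm h2 h1)
    subst hn
    obtain rfl := contraction_eq hκ hκ' hA h0
    rfl
  · rintro ⟨A, φ⟩
    have hκ := ContractIso.contraction_allGood (φ := φ) hΓ hΓ'
    exact ⟨⟨fun l => ⟨φ.num l, hB _ _ hκ l⟩, ⟨φ.contraction hΓ hΓ', hκ⟩⟩,
      ContractIso.sigma_ext (ContractIso.contraction_toSub hΓ hΓ') fun z => rfl⟩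

end FeynmanHopf

end

/-! ### The sum over subgraphs as a sum over insertions. -/

noncomputable section

namespace FeynmanHopf

open scoped Classical

variable {T : FieldTheory}

/-! ## The sum over subgraphs as a sum over insertions -/

section Main

variable {K : Type*} [Field K] [Algebra ℚ K] (C U : H T →ₐ[ℚ] K)

/-- The value of a character on an insertable graph. -/
def LegGraph.wt {r : T.R} (B : LegGraph T r) : K := C (if B.graph.OnePI then gr B.graph else 1)

theorem LegGraph.wt_of_iso {r : T.R} {B B' : LegGraph T r} (φ : LegGraph.Iso B B') :
    B.wt C = B'.wt C := by
  have h : B.graph.OnePI ↔ B'.graph.OnePI := ⟨φ.1.onePI, φ.symm.1.onePI⟩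
  unfold LegGraph.wt
  by_cases hB : B.graph.OnePI
  · rw [if_pos hB, if_pos (h.1 hB), gr_eq_of_iso φ.1]
  · rw [if_neg hB, if_neg (fun h' => hB (h.2 h'))]

/-- Says multiplicatively that a self-energy graph has at least one loop, in a form suited to
`prod_chain`. -/
theorem LegGraph.IsGood.le_two_pow {r : T.R} {B : LegGraph T r} (h : B.IsGood) :
    (Sum.elim (fun _ => 1) fun _ => 2 : T.R → ℕ) r ≤ 2 ^ B.graph.loops := by
  rcases r with v | e
  · exact Nat.one_le_two_pow
  · rcases h with h | ⟨⟨v, hv⟩, -⟩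
    · exact Nat.le_self_pow h.not_tree 2
    · simp at hv

namespace Skeleton.Contraction

open Chain

variable {r : T.R} {Q : Skeleton T r} {Γ' Γ : LegGraph T r}

theorem toH_toSub (κ : Contraction Q Γ) :
    κ.toSub.toH = ∏ p, if (κ.block p).graph.OnePI then gr (κ.block p).graph else 1 := by
  have h1 : (∏ᶠ p : {p : Q.V // (κ.block p).graph.OnePI}, gr (κ.block p.1).graph) =
      κ.toSub.toH := by
    refine finprod_eq_of_bijective (fun p => ⟨κ.piece p.1, p.1, rfl, p.2⟩) ⟨fun p q h => ?_, ?_⟩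
      fun p => rfl
    · obtain ⟨w, hw⟩ := p.2.connected.1.some
      have h2 : κ.piece p.1 = κ.piece q.1 := congrArg Subtype.val h
      have h3 : w ∈ (κ.piece q.1).verts := h2 ▸ hw
      exact Subtype.ext ((κ.mem_verts.1 hw).symm.trans (κ.mem_verts.1 h3))
    · rintro ⟨_, p, rfl, hp⟩
      exact ⟨⟨p, hp⟩, rfl⟩
  rw [← h1, finprod_eq_prod_of_fintype, ← Finset.prod_filter]
  exact (Finset.prod_subtype (Finset.univ.filter fun p => (κ.block p).graph.OnePI)
    (fun p => Finset.mem_filter_univ p) fun p => gr (κ.block p).graph).symm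

/-- Gluing the identities of the pieces presents `Γ` as an insertion of its own pieces. -/
theorem loops_eq {n : Γ'.graph.Lines → ℕ} {κ : Contraction (chain Γ' n) Γ}
    (hΓ' : Γ'.graph.OnePI) (hκ : κ.AllGood) :
    Γ.graph.loops = Γ'.graph.loops + ∑ p, (κ.block p).graph.loops := by
  rw [← LegGraph.loops_ins hΓ' hκ]
  exact (glue (d := κ.block) (κ := κ) fun p => LegGraph.Iso.refl _).1.loops_eq

/-- Each chain vertex carries a graph with at least one loop, and the loops add up to at most those
of `Γ`. This bound makes the sums over chain lengths finite. -/
theorem num_le {n : Γ'.graph.Lines → ℕ} {κ : Contraction (chain Γ' n) Γ}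
    (hΓ' : Γ'.graph.OnePI) (hκ : κ.AllGood) (l : Γ'.graph.Lines) : n l ≤ Γ.graph.loops := by
  have h1 := prod_chain (Γ := Γ') n (Sum.elim (fun _ => 1) fun _ => 2 : T.R → ℕ)
  simp only [Sum.elim_inl, Sum.elim_inr, Finset.prod_const_one, one_mul,
    Finset.prod_pow_eq_pow_sum] at h1
  have h2 : ∏ p, (Sum.elim (fun _ => 1) fun _ => 2 : T.R → ℕ) ((chain Γ' n).ty p) ≤
      ∏ p, 2 ^ (κ.block p).graph.loops := by
    refine Finset.prod_le_prod (fun _ _ => Nat.zero_le _) fun p _ => (hκ p).le_two_pow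
  rw [h1, Finset.prod_pow_eq_pow_sum] at h2
  have h3 := (Nat.pow_le_pow_iff_right (by norm_num)).1 h2
  have h4 := Finset.single_le_sum (f := n) (fun _ _ => Nat.zero_le _) (Finset.mem_univ l)
  have h5 := loops_eq hΓ' hκ
  omega

end Skeleton.Contraction

open Chain Skeleton Skeleton.Contraction

variable {r : T.R} {Γ' Γ : LegGraph T r}

/-- The weight of a decoration of the chains. -/
def decWeight {L : ℕ} {n : Γ'.graph.Lines → ℕ} (d : ∀ p, BDec T L ((chain Γ' n).ty p)) : K :=
  ∏ p, ((d p).1.block.graph.symFactor : K)⁻¹ * (d p).1.block.wt C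

/-- For a fixed contraction, the sum over decorations factors over the skeleton vertices. Each
factor retains only the class of the actual piece, with its symmetry factor cancelled, and vanishes
if the piece is not good. -/
theorem sum_decWeight (hΓ' : Γ'.graph.OnePI) {L : ℕ} (hL : Γ.graph.loops ≤ L)
    (n : Γ'.graph.Lines → ℕ) :
    ∑ d : ∀ p, BDec T L ((chain Γ' n).ty p),
      decWeight C d * (Nat.card (LegGraph.Iso (ins fun p => (d p).1.block) Γ) : K) =
    ∑ κ : Contraction (chain Γ' n) Γ, if κ.AllGood then C κ.toSub.toH else 0 := by
  have : CharZero K := algebraRat.charZero K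
  simp_rw [card_iso_ins, Nat.cast_sum, Finset.mul_sum]
  rw [Finset.sum_comm]
  refine Finset.sum_congr rfl fun κ _ => ?_
  simp_rw [Nat.cast_prod, decWeight, ← Finset.prod_mul_distrib]
  -- Distributivity: a sum over decorations of a product over vertices is a product of sums.
  rw [← Fintype.piFinset_univ, ← Finset.prod_univ_sum (t := fun p => Finset.univ)
    (f := fun p (c : BDec T L ((chain Γ' n).ty p)) =>
      (c.1.block.graph.symFactor : K)⁻¹ * c.1.block.wt C *
        (Nat.card (LegGraph.Iso c.1.block (κ.block p)) : K))]
  split_ifs with hκ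
  · rw [toH_toSub, map_prod]
    refine Finset.prod_congr rfl fun p _ => ?_
    have h1 := sum_bdec (L := L) (fun c => c.block.wt C) (κ.block p) (fun _ => ?_)
      ((κ.block p).wt C) fun c hc => LegGraph.wt_of_iso C hc.some
    · rw [h1, if_pos (hκ p)]; rfl
    · have h2 := loops_eq hΓ' hκ
      have h3 := Finset.single_le_sum (f := fun p => (κ.block p).graph.loops)
        (fun _ _ => Nat.zero_le _) (Finset.mem_univ p)
      exact (Nat.le_add_left _ _).trans ((Nat.add_le_add_left h3 _).trans (h2.symm.le.trans hL))
  · unfold AllGood at hκ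
    push Not at hκ
    obtain ⟨p, hp⟩ := hκ
    refine Finset.prod_eq_zero (Finset.mem_univ p) ?_
    rw [sum_bdec (fun c => c.block.wt C) (κ.block p) (fun h => absurd h hp)
      ((κ.block p).wt C) fun c hc => LegGraph.wt_of_iso C hc.some, if_neg hp]

theorem sum_contractIso {M : Type*} [CommSemiring M] (hΓ : Γ.graph.OnePI) (hΓ' : Γ'.graph.OnePI) {L : ℕ}
    (hL : Γ.graph.loops ≤ L) (F : Γ.graph.Sub → M) :
    ∑ n : Γ'.graph.Lines → Fin (L + 1),
      ∑ κ : Contraction (chain Γ' fun l => (n l : ℕ)) Γ, (if κ.AllGood then F κ.toSub else 0) =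
    ∑ A, (Nat.card (ContractIso Γ' Γ A) : M) * F A := by
  have h1 : ∀ n : Γ'.graph.Lines → Fin (L + 1),
      ∑ κ : Contraction (chain Γ' fun l => (n l : ℕ)) Γ, (if κ.AllGood then F κ.toSub else 0) =
      ∑ κ : {κ : Contraction (chain Γ' fun l => (n l : ℕ)) Γ // κ.AllGood}, F κ.1.toSub := by
    intro n
    rw [← Finset.sum_filter]
    exact Finset.sum_subtype _ (by simp) _
  simp_rw [h1, ← Fintype.sum_sigma']
  have h2 := bijective_contractIso hΓ hΓ' (B := L + 1)
    fun n κ hκ l => Nat.lt_succ_of_le ((num_le hΓ' hκ l).trans hL)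
  rw [h2.sum_comp (fun x : Σ A : Γ.graph.Sub, ContractIso Γ' Γ A => F x.1)]
  rw [Fintype.sum_sigma]
  refine Finset.sum_congr rfl fun A _ => ?_
  simp

theorem Graph.Sub.survives_ext {A : Γ.graph.Sub} (hΓ : Γ.graph.OnePI) (h : Nonempty A.QVx)
    {z : Γ.graph.Hf} (hz : Γ.graph.σ z = z) : A.Survives z :=
  ⟨fun p _ hm => p.internal z hm hz, fun _ hp hm =>
    σ_ne_of_leg hΓ h hp ⟨hm, fun hh => Graph.Piece.internal _ z hh hz⟩ hz⟩

/-- The contracted graph with its external lines labelled. -/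
def LegGraph.contract (Γ : LegGraph T r) (hΓ : Γ.graph.OnePI) (A : Γ.graph.Sub)
    (hA : A.contract.OnePI) : LegGraph T r where
  graph := A.contract
  label := Equiv.trans
    ⟨fun x => ⟨x.1.1, (Graph.Iso.contract_ext_iff hΓ hA x.1).1 x.2⟩,
      fun z => ⟨⟨z.1, Graph.Sub.survives_ext hΓ hA.connected.1 z.2⟩,
        (Graph.Iso.contract_ext_iff hΓ hA _).2 z.2⟩, fun _ => rfl, fun _ => rfl⟩ Γ.label
  label_lbl _ := Γ.label_lbl _

/-- Isomorphisms with the contracted graph. -/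
def contractIsoEquiv (hΓ : Γ.graph.OnePI) (A : Γ.graph.Sub) (hA : A.contract.OnePI) :
    ContractIso Γ' Γ A ≃ LegGraph.Iso Γ' (Γ.contract hΓ A hA) where
  toFun φ := ⟨φ.val, fun h x e => φ.label h
    ⟨x.1.1, (Graph.Iso.contract_ext_iff hΓ hA x.1).1 x.2⟩ (congrArg Subtype.val e)⟩
  invFun φ := ⟨φ.val, fun h z e => φ.label h
    ⟨⟨z.1, Graph.Sub.survives_ext hΓ hA.connected.1 z.2⟩,
      (Graph.Iso.contract_ext_iff hΓ hA _).2 z.2⟩ (Subtype.ext e)⟩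
  left_inv _ := rfl
  right_inv _ := rfl

theorem sum_lclass_iso {L : ℕ} (hΓ : Γ.graph.OnePI) (hL : Γ.graph.loops ≤ L) :
    ∑ c : {c : LClass T r // c.out.graph.loops ≤ L}, U c.1.term *
      (Nat.card (LegGraph.Iso c.1.out.leg Γ) : K) = U (gr Γ.graph) := by
  have : CharZero K := algebraRat.charZero K
  have hi := (Γ.nonempty_iso_cls hΓ).some
  have hc : (Γ.cls hΓ).out.graph.loops ≤ L := by rw [← hi.1.loops_eq]; exact hL
  rw [Finset.sum_eq_single ⟨Γ.cls hΓ, hc⟩]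
  · rw [LegGraph.card_iso_of_iso hi, LClass.term, map_smul, gr_eq_of_iso hi.1, Algebra.smul_def,
      map_inv₀, map_natCast]
    have : ((Γ.cls hΓ).out.graph.symFactor : K) ≠ 0 :=
      Nat.cast_ne_zero.2 (LegGraph.symFactor_pos (Γ.cls hΓ).out.leg).ne'
    field_simp
  · intro c _ hne
    have : IsEmpty (LegGraph.Iso c.1.out.leg Γ) :=
      ⟨fun φ => hne (Subtype.ext (LegGraph.eq_cls_of_iso hΓ φ))⟩
    simp
  · simp

/-- If `Γ/A` is 1PI, it has at most as many loops as `Γ`, so its class occurs in the truncated sum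
and is the only one that contributes. Otherwise both sides are zero. -/
theorem sum_lclass_contractIso (hΓ : Γ.graph.OnePI) {L : ℕ} (hL : Γ.graph.loops ≤ L)
    (A : Γ.graph.Sub) :
    ∑ c : {c : LClass T r // c.out.graph.loops ≤ L}, U c.1.term *
      (Nat.card (ContractIso c.1.out.leg Γ A) : K) = U (gr A.contract) := by
  by_cases hA : A.contract.OnePI
  · have hle : (Γ.contract hΓ A hA).graph.loops ≤ L := by
      have hi := ((Γ.contract hΓ A hA).nonempty_iso_cls hA).some
      have φ := (contractIsoEquiv hΓ A hA).symm hi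
      have h1 := LabelledGraph.onePI ((Γ.contract hΓ A hA).cls hA).out
      have h2 := loops_eq h1 (ContractIso.contraction_allGood (φ := φ) hΓ h1)
      have h3 := hi.1.loops_eq
      change _ = (LabelledGraph.leg _).graph.loops at h3
      omega
    refine Eq.trans ?_ (sum_lclass_iso U (Γ := Γ.contract hΓ A hA) hA hle)
    exact Finset.sum_congr rfl fun c _ => by rw [Nat.card_congr (contractIsoEquiv hΓ A hA)]
  · rw [gr, dif_neg fun h => hA h.1, map_zero]
    refine Finset.sum_eq_zero fun c _ => ?_
    have : IsEmpty (ContractIso c.1.out.leg Γ A) := ⟨fun φ => hA (φ.val.onePI c.1.out.onePI)⟩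
    simp

/-- The sum over all subgraphs of a graph, as a sum over the graphs into which one has to insert
in order to obtain it. -/
theorem sum_sub (hΓ : Γ.graph.OnePI) {L : ℕ} (hL : Γ.graph.loops ≤ L) :
    ∑ A : Γ.graph.Sub, C A.toH * U (gr A.contract) =
    ∑ c : {c : LClass T r // c.out.graph.loops ≤ L}, U c.1.term *
      ∑ n : c.1.out.graph.Lines → Fin (L + 1),
        ∑ d : ∀ p, BDec T L ((chain c.1.out.leg fun l => (n l : ℕ)).ty p),
          decWeight C d * (Nat.card (LegGraph.Iso (ins fun p => (d p).1.block) Γ) : K) := by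
  have h1 : ∀ c : {c : LClass T r // c.out.graph.loops ≤ L},
      ∑ n : c.1.out.graph.Lines → Fin (L + 1),
        ∑ d : ∀ p, BDec T L ((chain c.1.out.leg fun l => (n l : ℕ)).ty p),
          decWeight C d * (Nat.card (LegGraph.Iso (ins fun p => (d p).1.block) Γ) : K) =
      ∑ A, (Nat.card (ContractIso c.1.out.leg Γ A) : K) * C A.toH := fun c => by
    rw [← sum_contractIso hΓ c.1.out.onePI hL fun A => C A.toH]
    exact Finset.sum_congr rfl fun n _ =>
      sum_decWeight (Γ' := c.1.out.leg) C c.1.out.onePI hL fun l => (n l : ℕ)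
  simp_rw [h1, Finset.mul_sum]
  rw [Finset.sum_comm]
  refine Finset.sum_congr rfl fun A _ => ?_
  rw [← sum_lclass_contractIso U hΓ hL A, Finset.mul_sum]
  exact Finset.sum_congr rfl fun c _ => by ring

end Main

end FeynmanHopf

end

/-! ### The Green's functions of a convolution product. -/

noncomputable section

namespace FeynmanHopf

open scoped Classical

variable {T : FieldTheory}

/-! ## The convolution product on graphs -/

namespace Graph

variable {Γ : Graph T}

/-- The empty subgraph. -/
def Sub.empty (Γ : Graph T) : Γ.Sub := ⟨∅, fun _ h => h.elim, fun _ h => h.elim⟩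

theorem Sub.survives_empty (h : Γ.Hf) : (Sub.empty Γ).Survives h :=
  ⟨fun _ hp => hp.elim, fun _ hp => hp.1.elim⟩

/-- Contraction of the empty subgraph. -/
def contractEmpty (Γ : Graph T) : Iso Γ (Sub.empty Γ).contract := by
  refine Iso.ofHf ⟨fun h => ⟨h, Sub.survives_empty h⟩, fun h => h.1, fun _ => rfl, fun _ => rfl⟩
    (fun x y => ?_) (fun _ => rfl) fun x => ?_
  · refine (Sub.qsrc_eq_iff _ _).trans ⟨?_, fun h => Or.inl h⟩
    rintro (h | ⟨_, hp, -⟩)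
    · exact h
    · exact hp.elim
  · have hτ : ∀ z, (Sub.empty Γ).τ z = z := fun z => Sub.τ_of_survives _ (Sub.survives_empty z)
    have h1 : ((Sub.empty Γ).τ * Γ.σ) x = Γ.σ x := hτ _
    by_cases hx : Γ.σ x = x
    · refine (other_eq_self fun y ⟨k, hk⟩ => Subtype.ext ?_).trans (Subtype.ext hx.symm)
      exact hk.symm.trans (Equiv.Perm.zpow_apply_eq_self_of_apply_eq_self (h1.trans hx) k)
    · exact other_eq_of_rel (Sub.joined_pairing _) ⟨1, by rw [zpow_one]; exact h1⟩
        fun h => hx (congrArg Subtype.val h)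

/-- No internal half-line survives the contraction of the whole graph, whereas a 1PI graph has
internal lines. -/
theorem Sub.not_onePI_contract_whole (hΓ : Γ.OnePI) {A : Γ.Sub} (hA : A.pieces = {Γ.whole}) :
    ¬ A.contract.OnePI := fun h => by
  obtain ⟨x, hx⟩ := h.exists_internal
  refine hx ((Iso.contract_ext_iff hΓ h x).2 (not_not.1 fun h1 => ?_))
  exact x.2.1 Γ.whole (by rw [hA]; rfl) h1

end Graph

section

variable {K : Type*} [Field K] [Algebra ℚ K] (C U : H T →ₐ[ℚ] K)

/-- The sum may run over all subgraphs: the empty one supplies `1 ⊗ Γ`, and the whole graph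
contributes zero because `gr` of its quotient has the default value `0`. Only the term `Γ ⊗ 1`
remains separate. -/
theorem lift_coprodGraph {Γ : Graph T} (hΓ : Γ.OnePI) :
    Algebra.TensorProduct.lift C U (fun _ _ => Commute.all _ _) (coprodGraph Γ) =
      C (gr Γ) + ∑ A : Γ.Sub, C A.toH * U (gr A.contract) := by
  have h1 : (∑ᶠ A : {A : Γ.Sub // A.IsProper}, A.1.toH ⊗ₜ[ℚ] gr A.1.contract) =
      ∑ A : Γ.Sub, if A.IsProper then A.toH ⊗ₜ[ℚ] gr A.contract else 0 := by
    rw [finsum_eq_sum_of_fintype, ← Finset.sum_filter]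
    exact (Finset.sum_subtype (Finset.univ.filter fun A : Γ.Sub => A.IsProper)
      (fun A => Finset.mem_filter_univ A) fun A => A.toH ⊗ₜ[ℚ] gr A.contract).symm
  have h2 : ∀ A : Γ.Sub, C A.toH * U (gr A.contract) =
      (if A = Graph.Sub.empty Γ then U (gr Γ) else 0) +
        if A.IsProper then C A.toH * U (gr A.contract) else 0 := by
    intro A
    by_cases h3 : A = Graph.Sub.empty Γ
    · subst h3
      have h4 : (Graph.Sub.empty Γ).toH = 1 := by
        have : IsEmpty (Graph.Sub.empty Γ).pieces := ⟨fun p => p.2.elim⟩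
        exact finprod_of_isEmpty _
      rw [if_pos rfl, if_neg fun h => h.1 rfl, h4, map_one, one_mul, add_zero,
        gr_eq_of_iso Γ.contractEmpty]
    · rw [if_neg h3, zero_add]
      split_ifs with h4
      · rfl
      · have h5 : A.pieces ≠ ∅ := fun h => h3 (Graph.Sub.ext_pieces h)
        have h6 : A.pieces = {Γ.whole} := not_not.1 fun h => h4 ⟨h5, h⟩
        rw [gr, dif_neg fun h => Graph.Sub.not_onePI_contract_whole hΓ h6 h.1, map_zero, mul_zero]
  rw [Finset.sum_congr rfl fun A _ => h2 A, Finset.sum_add_distrib, coprodGraph, h1]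
  simp only [map_add, map_sum, Algebra.TensorProduct.lift_tmul, map_one, mul_one, one_mul,
    Finset.sum_ite_eq', Finset.mem_univ, if_true, add_assoc]
  congr 2
  refine Finset.sum_congr rfl fun A _ => ?_
  split_ifs
  · simp
  · simp

open Chain Skeleton

variable {r : T.R} {Γ : LegGraph T r}

theorem conv_gr (hΓ : Γ.graph.OnePI) {L : ℕ} (hL : Γ.graph.loops ≤ L) :
    conv C U (gr Γ.graph) = C (gr Γ.graph) +
    ∑ c : {c : LClass T r // c.out.graph.loops ≤ L}, U c.1.term *
      ∑ n : c.1.out.graph.Lines → Fin (L + 1),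
        ∑ d : ∀ p, BDec T L ((chain c.1.out.leg fun l => (n l : ℕ)).ty p),
          decWeight C d * (Nat.card (LegGraph.Iso (ins fun p => (d p).1.block) Γ) : K) := by
  have hg : Γ.graph.IsGenerator := ⟨hΓ, r, Γ.hasResidue⟩
  let q : Quotient (genSetoid T) := Quotient.mk _ ⟨Γ.graph, hg⟩
  have h1 : conv C U (gr Γ.graph) =
      Algebra.TensorProduct.lift C U (fun _ _ => Commute.all _ _) (coprodGraph q.out.1) := by
    rw [gr, dif_pos hg]
    exact congrArg _ (MvPolynomial.aeval_X _ q)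
  obtain ⟨φ⟩ : Nonempty (Graph.Iso q.out.1 Γ.graph) :=
    Quotient.mk_out (s := genSetoid T) ⟨Γ.graph, hg⟩
  let e : q.out.1.Ext ≃ Γ.graph.Ext :=
    φ.hf.subtypeEquiv fun h => (φ.σ_eq_iff h).symm
  -- The coproduct is evaluated on an unlabelled representative, so the labels of `Γ` are
  -- transported to it.
  let Γ₀ : LegGraph T r :=
    { graph := q.out.1
      label := e.trans Γ.label
      label_lbl := fun h => (Γ.label_lbl _).trans (φ.lbl_hf h.1) }
  have ψ : LegGraph.Iso Γ₀ Γ := ⟨φ, fun h h' hh => congrArg Γ.label (Subtype.ext hh)⟩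
  have hΓ₀ : Γ₀.graph.OnePI := φ.symm.onePI hΓ
  rw [h1, lift_coprodGraph C U hΓ₀, ← gr_eq_of_iso φ]
  congr 1
  rw [sum_sub (Γ := Γ₀) C U hΓ₀ (φ.loops_eq.symm.le.trans hL)]
  simp_rw [Nat.card_congr ψ.congrRight]

/-! ## The coefficients of the Green's functions -/

/-- `φ(G^r)` as a series in the loop number. -/
def gs (φ : H T →ₐ[ℚ] K) (r : T.R) : PowerSeries K := PowerSeries.map (φ : H T →+* K) (green r)

/-- The sum of the values of `φ` on the graphs of loop number at most `L`. -/
def graphSeries (φ : H T →ₐ[ℚ] K) (L : ℕ) (r : T.R) : PowerSeries K :=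
  ∑ c : {c : LClass T r // c.out.graph.loops ≤ L},
    PowerSeries.C (φ c.1.term) * PowerSeries.X ^ c.1.out.graph.loops

variable (φ : H T →ₐ[ℚ] K)

theorem coeff_graphSeries {m L : ℕ} (hm : m ≤ L) (r : T.R) :
    PowerSeries.coeff m (graphSeries φ L r) =
      ∑ᶠ c : {c : LClass T r // c.out.graph.loops = m}, φ c.1.term := by
  have h1 : (∑ᶠ c : {c : LClass T r // c.out.graph.loops = m}, φ c.1.term) =
      ∑ᶠ c : {c : {c : LClass T r // c.out.graph.loops ≤ L} // m = c.1.out.graph.loops},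
        φ c.1.1.term :=
    finsum_eq_of_bijective (fun c => ⟨⟨c.1, c.2.le.trans hm⟩, c.2.symm⟩)
      ⟨fun c c' h => Subtype.ext (congrArg (fun z => z.1.1) h),
        fun c => ⟨⟨c.1.1, c.2.symm⟩, rfl⟩⟩ fun _ => rfl
  rw [h1, finsum_eq_sum_of_fintype, graphSeries, map_sum]
  simp_rw [PowerSeries.coeff_C_mul, PowerSeries.coeff_X_pow, mul_ite, mul_one, mul_zero]
  rw [← Finset.sum_filter]
  exact Finset.sum_subtype (Finset.univ.filter
    fun c : {c : LClass T r // c.out.graph.loops ≤ L} => m = c.1.out.graph.loops)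
    (fun c => Finset.mem_filter_univ c) fun c => φ c.1.term

theorem coeff_green (L : ℕ) (r : T.R) : PowerSeries.coeff L (green r) =
    (if L = 0 then 1 else 0) +
      sign r • ∑ᶠ c : {c : LClass T r // c.out.graph.loops = L}, c.1.term := by
  rw [green, map_add, PowerSeries.coeff_one, map_zsmul, PowerSeries.coeff_mk]

theorem finite_lclass_loops_eq (r : T.R) (L : ℕ) :
    Finite {c : LClass T r // c.out.graph.loops = L} :=
  ((finite_lclass_loops_le r L).subset fun _ h => le_of_eq h).to_subtype

theorem coeff_gs {m L : ℕ} (hm : m ≤ L) (r : T.R) : PowerSeries.coeff m (gs φ r) =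
    PowerSeries.coeff m (1 + (sign r : PowerSeries K) * graphSeries φ L r) := by
  have := finite_lclass_loops_eq r m
  rw [gs, PowerSeries.coeff_map, coeff_green, map_add, ← zsmul_eq_mul, map_add, map_zsmul,
    map_zsmul, coeff_graphSeries φ hm, PowerSeries.coeff_one, map_finsum _ (Set.toFinite _)]
  congr 1
  split_ifs
  · exact map_one _
  · exact map_zero _

theorem constantCoeff_green (r : T.R) : PowerSeries.constantCoeff (green r) = 1 := by
  have : IsEmpty {c : LClass T r // c.out.graph.loops = 0} := ⟨fun c => c.1.out.onePI.not_tree c.2⟩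
  rw [← PowerSeries.coeff_zero_eq_constantCoeff_apply, coeff_green,
    finsum_of_isEmpty, if_pos rfl, smul_zero, add_zero]

theorem constantCoeff_gs (r : T.R) : PowerSeries.constantCoeff (gs φ r) = 1 := by
  rw [← PowerSeries.coeff_zero_eq_constantCoeff_apply, gs, PowerSeries.coeff_map,
    PowerSeries.coeff_zero_eq_constantCoeff_apply, constantCoeff_green]
  exact map_one _

/-- Truncation of power series. -/
def modX (K : Type*) [CommRing K] (L : ℕ) :
    PowerSeries K →+* PowerSeries K ⧸ Ideal.span {(PowerSeries.X : PowerSeries K) ^ L} :=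
  Ideal.Quotient.mk _

theorem modX_eq_iff {K : Type*} [CommRing K] {L : ℕ} {f g : PowerSeries K} :
    modX K L f = modX K L g ↔ ∀ m < L, PowerSeries.coeff m f = PowerSeries.coeff m g := by
  rw [modX, Ideal.Quotient.eq, Ideal.mem_span_singleton, PowerSeries.X_pow_dvd_iff]
  simp [sub_eq_zero]

/-- The sum over the graphs that can be inserted at `r`. -/
def decSeries (L : ℕ) (r : T.R) : PowerSeries K :=
  ∑ c : BDec T L r, PowerSeries.C ((c.1.block.graph.symFactor : K)⁻¹ * c.1.block.wt C) *
    PowerSeries.X ^ c.1.block.graph.loops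

theorem symFactor_trivialGraph (v : T.Vert) : (trivialGraph v).graph.symFactor = 1 := by
  rw [← LegGraph.card_iso_self, Nat.card_eq_one_iff_unique]
  refine ⟨⟨fun φ ψ => LegGraph.Iso.ext_hf fun x => ?_⟩, ⟨LegGraph.Iso.refl _⟩⟩
  exact (φ.label_symm x).trans (ψ.label_symm x).symm

theorem term_eq {r : T.R} (c : LClass T r) :
    (c.out.graph.symFactor : K)⁻¹ * c.out.leg.wt C = C c.term := by
  have h : c.out.leg.wt C = C (gr c.out.graph) := congrArg C (if_pos c.out.onePI)
  rw [h, LClass.term, map_smul, Algebra.smul_def, map_inv₀, map_natCast]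

theorem decSeries_inr (L : ℕ) (e : T.Edge) :
    decSeries C L (Sum.inr e) = graphSeries C L (Sum.inr e) := by
  refine Fintype.sum_equiv (Equiv.refl _) _ _ fun c => ?_
  exact congrArg (fun z => PowerSeries.C z * _) (term_eq C c.1)

theorem decSeries_inl (L : ℕ) (v : T.Vert) :
    decSeries C L (Sum.inl v) = 1 + graphSeries C L (Sum.inl v) := by
  let f : Option {c : LClass T (Sum.inl v) // c.out.graph.loops ≤ L} → BDec T L (Sum.inl v)
    | none => ⟨none, by
        have h := (trivialGraph_isTrivial v).loops
        change (trivialGraph v).graph.loops ≤ L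
        omega⟩
    | some c => ⟨some c.1, c.2⟩
  have hf : Function.Bijective f := by
    constructor
    · rintro (_ | c) (_ | c') h
      · rfl
      · exact absurd (congrArg Subtype.val h) (Option.some_ne_none _).symm
      · exact absurd (congrArg Subtype.val h) (Option.some_ne_none _)
      · exact congrArg some (Subtype.ext (Option.some.inj (congrArg Subtype.val h)))
    · rintro ⟨_ | c, h⟩
      · exact ⟨none, rfl⟩
      · exact ⟨some ⟨c, h⟩, rfl⟩
  rw [decSeries, ← hf.sum_comp, Fintype.sum_option]
  congr 1
  · change PowerSeries.C (((trivialGraph v).graph.symFactor : K)⁻¹ * (trivialGraph v).wt C) *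
      PowerSeries.X ^ (trivialGraph v).graph.loops = 1
    have h : (trivialGraph v).wt C = 1 :=
      (congrArg C (if_neg (trivialGraph_isTrivial v).not_onePI)).trans (map_one C)
    rw [(trivialGraph_isTrivial v).loops, symFactor_trivialGraph, h]
    simp
  · refine Finset.sum_congr rfl fun c _ => ?_
    exact congrArg (fun z => PowerSeries.C z * _) (term_eq C c.1)

theorem modX_decSeries_inl (L : ℕ) (v : T.Vert) :
    modX K (L + 1) (decSeries C L (Sum.inl v)) = modX K (L + 1) (gs C (Sum.inl v)) :=
  modX_eq_iff.2 fun m hm => by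
    rw [coeff_gs C (Nat.lt_succ_iff.1 hm), decSeries_inl]
    simp [sign]

theorem modX_decSeries_inr (L : ℕ) (e : T.Edge) :
    modX K (L + 1) (1 - decSeries C L (Sum.inr e)) = modX K (L + 1) (gs C (Sum.inr e)) :=
  modX_eq_iff.2 fun m hm => by
    rw [coeff_gs C (Nat.lt_succ_iff.1 hm), decSeries_inr]
    simp [sign, sub_eq_add_neg]

theorem X_dvd_decSeries (L : ℕ) (e : T.Edge) :
    PowerSeries.X ∣ decSeries C L (Sum.inr e) :=
  Finset.dvd_sum fun c _ => Dvd.dvd.mul_left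
    (dvd_pow_self _ (Quotient.out (s := labelledSetoid T _) c.1).onePI.not_tree) _

/-- The geometric series of self-energies is the inverse of `G^e = 1 - P`. As `P` is divisible by
`X`, chains of length greater than `L` do not matter modulo `X ^ (L + 1)`. -/
theorem modX_geom (L : ℕ) (e : T.Edge) :
    modX K (L + 1) (∑ k : Fin (L + 1), decSeries C L (Sum.inr e) ^ (k : ℕ)) =
      modX K (L + 1) (gs C (Sum.inr e))⁻¹ := by
  set P := decSeries C L (Sum.inr e)
  have h0 : PowerSeries.constantCoeff (gs C (Sum.inr e)) ≠ 0 := by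
    rw [constantCoeff_gs]; exact one_ne_zero
  have h1 : gs C (Sum.inr e) * (gs C (Sum.inr e))⁻¹ = 1 := PowerSeries.mul_inv_cancel _ h0
  have h2 : (∑ k : Fin (L + 1), P ^ (k : ℕ)) * (1 - P) = 1 - P ^ (L + 1) := by
    rw [Fin.sum_univ_eq_sum_range (fun k => P ^ k), geom_sum_mul_neg]
  have h3 : modX K (L + 1) (P ^ (L + 1)) = 0 :=
    Ideal.Quotient.eq_zero_iff_dvd _ _ |>.2 (pow_dvd_pow_of_dvd (X_dvd_decSeries C L e) _)
  have h4 := congrArg (modX K (L + 1)) h2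
  rw [map_mul, modX_decSeries_inr, map_sub, h3, map_one, sub_zero] at h4
  have h5 := congrArg (modX K (L + 1)) h1
  rw [map_mul, map_one] at h5
  exact left_inv_eq_right_inv h4 h5

/-- The series of the insertions into `c`. -/
def insSeries {r : T.R} (Γ : LegGraph T r) : PowerSeries K :=
  (∏ w, gs C (Sum.inl (Γ.graph.typ w))) *
    ∏ l : Γ.graph.Lines, (gs C (Sum.inr (Γ.graph.lbl l.1)))⁻¹

/-- Distributivity twice: over the decorations of the skeleton for fixed chain lengths, then over
the chain lengths. -/
theorem sum_ins_eq (L : ℕ) {r : T.R} (Γ : LegGraph T r) :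
    ∑ n : Γ.graph.Lines → Fin (L + 1),
      ∑ d : ∀ p, BDec T L ((chain Γ fun l => (n l : ℕ)).ty p),
        PowerSeries.C (decWeight C d) *
          PowerSeries.X ^ (∑ p, (d p).1.block.graph.loops) =
    (∏ w, decSeries C L (Sum.inl (Γ.graph.typ w))) *
      ∏ l : Γ.graph.Lines,
        ∑ k : Fin (L + 1), decSeries C L (Sum.inr (Γ.graph.lbl l.1)) ^ (k : ℕ) := by
  have h1 : ∀ n : Γ.graph.Lines → Fin (L + 1),
      ∑ d : ∀ p, BDec T L ((chain Γ fun l => (n l : ℕ)).ty p),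
        PowerSeries.C (decWeight C d) *
          PowerSeries.X ^ (∑ p, (d p).1.block.graph.loops) =
      (∏ w, decSeries C L (Sum.inl (Γ.graph.typ w))) *
        ∏ l : Γ.graph.Lines, decSeries C L (Sum.inr (Γ.graph.lbl l.1)) ^ (n l : ℕ) := by
    intro n
    rw [← prod_chain (fun l => (n l : ℕ)) (decSeries C L)]
    simp_rw [decSeries]
    rw [Finset.prod_univ_sum, Fintype.piFinset_univ]
    refine Finset.sum_congr rfl fun d _ => ?_
    rw [Finset.prod_mul_distrib, Finset.prod_pow_eq_pow_sum, decWeight, map_prod]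
  simp_rw [h1]
  rw [← Finset.mul_sum, Finset.prod_univ_sum, Fintype.piFinset_univ]

theorem modX_sum_ins (L : ℕ) {r : T.R} (Γ : LegGraph T r) :
    modX K (L + 1) (∑ n : Γ.graph.Lines → Fin (L + 1),
      ∑ d : ∀ p, BDec T L ((chain Γ fun l => (n l : ℕ)).ty p),
        PowerSeries.C (decWeight C d) *
          PowerSeries.X ^ (∑ p, (d p).1.block.graph.loops)) =
    modX K (L + 1) (insSeries C Γ) := by
  rw [sum_ins_eq, insSeries]
  simp only [map_mul, map_prod, modX_decSeries_inl, modX_geom]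

theorem sum_lclass_card {L : ℕ} (hΓ : Γ.graph.OnePI) :
    ∑ᶠ c : {c : LClass T r // c.out.graph.loops = L}, (c.1.out.graph.symFactor : K)⁻¹ *
      (Nat.card (LegGraph.Iso Γ c.1.out.leg) : K) = if L = Γ.graph.loops then 1 else 0 := by
  have : CharZero K := algebraRat.charZero K
  let F : LClass T r → K := fun c => (c.out.graph.symFactor : K)⁻¹ *
      (Nat.card (LegGraph.Iso Γ c.out.leg) : K)
  have h0 : ∀ c : LClass T r, c ≠ Γ.cls hΓ → F c = 0 := fun c hc => by
    have : IsEmpty (LegGraph.Iso Γ c.out.leg) :=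
      ⟨fun φ => hc (LegGraph.eq_cls_of_iso hΓ φ.symm)⟩
    simp [F]
  have hi := (Γ.nonempty_iso_cls hΓ).some
  have hl : Γ.graph.loops = (Γ.cls hΓ).out.graph.loops := hi.1.loops_eq
  change ∑ᶠ c : {c : LClass T r // c.out.graph.loops = L}, F c.1 = _
  split_ifs with h
  · have h1 : F (Γ.cls hΓ) = 1 := by
      change _ * _ = (1 : K)
      rw [LegGraph.card_iso_of_iso' hi.symm]
      exact inv_mul_cancel₀ (Nat.cast_ne_zero.2 (LegGraph.symFactor_pos (Γ.cls hΓ).out.leg).ne')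
    exact (finsum_eq_single (fun c : {c : LClass T r // c.out.graph.loops = L} => F c.1)
      ⟨Γ.cls hΓ, hl.symm.trans h.symm⟩ fun c hc => h0 c.1 fun h => hc (Subtype.ext h)).trans h1
  · have h1 : ∀ c : {c : LClass T r // c.out.graph.loops = L}, F c.1 = 0 := fun c =>
      h0 c.1 fun hc => h (by rw [hl, ← hc, c.2])
    rw [finsum_congr h1, finsum_zero]

/-- The coefficients of the Green's functions of a convolution product. -/
theorem coeff_gs_conv (L : ℕ) (r : T.R) :
    PowerSeries.coeff L (gs (conv C U) r) = PowerSeries.coeff L (gs C r) +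
      (sign r : K) * ∑ c : {c : LClass T r // c.out.graph.loops ≤ L}, U c.1.term *
        PowerSeries.coeff (L - c.1.out.graph.loops) (insSeries C c.1.out.leg) := by
  have := finite_lclass_loops_eq r L
  have := Fintype.ofFinite {c : LClass T r // c.out.graph.loops = L}
  have key : ∀ φ : H T →ₐ[ℚ] K, PowerSeries.coeff L (gs φ r) = (if L = 0 then 1 else 0) +
      (sign r : K) * ∑ c : {c : LClass T r // c.out.graph.loops = L}, φ c.1.term := fun φ => by
    rw [coeff_gs φ le_rfl, ← zsmul_eq_mul, map_add, map_zsmul, coeff_graphSeries φ le_rfl,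
      PowerSeries.coeff_one, finsum_eq_sum_of_fintype, zsmul_eq_mul]
  have hterm : ∀ (φ : H T →ₐ[ℚ] K) (c : LClass T r),
      φ c.term = (c.out.graph.symFactor : K)⁻¹ * φ (gr c.out.graph) := fun φ c => by
    rw [LClass.term, map_smul, Algebra.smul_def, map_inv₀, map_natCast]
  rw [key, key, add_assoc, ← mul_add]
  congr 2
  have h1 : ∀ c : {c : LClass T r // c.out.graph.loops = L}, conv C U c.1.term = C c.1.term +
      (c.1.out.graph.symFactor : K)⁻¹ *
      ∑ c' : {c : LClass T r // c.out.graph.loops ≤ L}, U c'.1.term *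
        ∑ n : c'.1.out.graph.Lines → Fin (L + 1),
        ∑ d : ∀ p, BDec T L ((chain c'.1.out.leg fun l => (n l : ℕ)).ty p),
          decWeight C d *
            (Nat.card (LegGraph.Iso (ins fun p => (d p).1.block) c.1.out.leg) : K) := fun c => by
    rw [hterm, hterm, conv_gr (Γ := c.1.out.leg) C U c.1.out.onePI c.2.le, mul_add]
  rw [Finset.sum_congr rfl fun c _ => h1 c, Finset.sum_add_distrib]
  congr 1
  simp_rw [Finset.mul_sum]
  rw [Finset.sum_comm]
  refine Finset.sum_congr rfl fun c' _ => ?_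
  -- The coefficient selects the decorations whose loops, added to those of `Γ'`, give an insertion
  -- of loop number `L`.
  have h2 : PowerSeries.coeff (L - c'.1.out.graph.loops) (insSeries C c'.1.out.leg) =
      ∑ n : c'.1.out.graph.Lines → Fin (L + 1),
        ∑ d : ∀ p, BDec T L ((chain c'.1.out.leg fun l => (n l : ℕ)).ty p),
          decWeight C d * if L = (ins fun p => (d p).1.block).graph.loops then 1 else 0 := by
    rw [← modX_eq_iff.1 (modX_sum_ins C L c'.1.out.leg) _
      (Nat.lt_succ_of_le (Nat.sub_le _ _)), map_sum]
    refine Finset.sum_congr rfl fun n _ => ?_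
    rw [map_sum]
    refine Finset.sum_congr rfl fun d _ => ?_
    rw [PowerSeries.coeff_C_mul, PowerSeries.coeff_X_pow,
      LegGraph.loops_ins (Γ := c'.1.out.leg) c'.1.out.onePI fun p => (d p).1.isGood]
    have h3 := c'.2
    congr 2
    exact propext (by change _ ↔ _ = c'.1.out.graph.loops + _; omega)
  rw [h2, Finset.mul_sum, Finset.sum_comm]
  refine Finset.sum_congr rfl fun n _ => ?_
  rw [Finset.mul_sum, Finset.sum_comm]
  refine Finset.sum_congr rfl fun d _ => ?_
  -- The indicator of loop number `L` is rewritten as the sum of isomorphisms over symmetry factors: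
  -- the insertion is 1PI and belongs to exactly one class.
  rw [← sum_lclass_card (K := K) (LegGraph.onePI_ins (Γ := c'.1.out.leg) c'.1.out.onePI
    fun p => (d p).1.isGood), finsum_eq_sum_of_fintype, Finset.mul_sum, Finset.mul_sum]
  exact Finset.sum_congr rfl fun c _ => by ring

end

end FeynmanHopf

end

/-! ### Rational powers of series and the charges as functions of the Green's functions. -/

noncomputable section

namespace FeynmanHopf

open scoped Classical

/-! ## Rational powers of power series -/

section RatPow

open PowerSeries

variable {A : Type*} [CommRing A]

theorem hasSubst_sub_one {f : A⟦X⟧} (hf : constantCoeff f = 1) : HasSubst (f - 1) :=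
  HasSubst.of_constantCoeff_zero' (by rw [map_sub, hf, map_one, sub_self])

variable [Algebra ℚ A]

theorem ratPow_add {f : A⟦X⟧} (hf : constantCoeff f = 1) (p q : ℚ) :
    ratPow f (p + q) = ratPow f p * ratPow f q := by
  rw [ratPow, binomialSeries_add, subst_mul (hasSubst_sub_one hf)]; rfl

theorem ratPow_natCast {f : A⟦X⟧} (hf : constantCoeff f = 1) (n : ℕ) :
    ratPow f (n : ℚ) = f ^ n := by
  have ha := hasSubst_sub_one hf
  rw [ratPow, binomialSeries_nat, subst_pow ha, subst_add ha, subst_X ha]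
  have h1 : (1 : ℚ⟦X⟧).subst (f - 1) = (1 : A⟦X⟧) := by
    rw [← coe_substAlgHom ha]; exact map_one _
  rw [h1]
  congr 1
  exact add_sub_cancel 1 f

theorem ratPow_zero {f : A⟦X⟧} (hf : constantCoeff f = 1) : ratPow f 0 = 1 := by
  have h := ratPow_natCast hf 0
  rwa [Nat.cast_zero, pow_zero] at h

theorem ratPow_one {f : A⟦X⟧} (hf : constantCoeff f = 1) : ratPow f 1 = f := by
  have h := ratPow_natCast hf 1
  rwa [Nat.cast_one, pow_one] at h

theorem ratPow_nat_mul {f : A⟦X⟧} (hf : constantCoeff f = 1) (n : ℕ) (q : ℚ) :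
    ratPow f (n * q) = ratPow f q ^ n := by
  induction n with
  | zero => rw [Nat.cast_zero, zero_mul, ratPow_zero hf, pow_zero]
  | succ n ih => rw [Nat.cast_succ, add_mul, one_mul, ratPow_add hf, ih, pow_succ]

theorem ratPow_mul_neg {f : A⟦X⟧} (hf : constantCoeff f = 1) (q : ℚ) :
    ratPow f q * ratPow f (-q) = 1 := by
  rw [← ratPow_add hf, add_neg_cancel, ratPow_zero hf]

/-- A rational power of `f` differs from `1` by a multiple of `f - 1`. -/
theorem dvd_ratPow_sub_one {f : A⟦X⟧} (hf : constantCoeff f = 1) (q : ℚ) :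
    f - 1 ∣ ratPow f q - 1 := by
  have ha := hasSubst_sub_one hf
  obtain ⟨g, hg⟩ : (X : ℚ⟦X⟧) ∣ PowerSeries.binomialSeries ℚ q - 1 := by
    rw [X_dvd_iff, map_sub, binomialSeries_constantCoeff, map_one, sub_self]
  refine ⟨g.subst (f - 1), ?_⟩
  have h1 : PowerSeries.binomialSeries ℚ q = 1 + X * g := by rw [← hg]; ring
  rw [ratPow, h1, ← coe_substAlgHom ha, map_add, map_one, map_mul, substAlgHom_X ha]
  exact add_sub_cancel_left 1 _

theorem constantCoeff_ratPow {f : A⟦X⟧} (hf : constantCoeff f = 1) (q : ℚ) :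
    constantCoeff (ratPow f q) = 1 := by
  obtain ⟨g, hg⟩ := dvd_ratPow_sub_one hf q
  have h := congrArg (constantCoeff (R := A)) hg
  rw [map_mul, map_sub, map_sub, hf, map_one, sub_self, zero_mul] at h
  exact sub_eq_zero.1 h

/-- The cofactor of `f - g` in `f ^ n - g ^ n` has constant coefficient `n`, so it is a unit over
`ℚ`. -/
theorem eq_of_pow_eq {f g : A⟦X⟧} (hf : constantCoeff f = 1) (hg : constantCoeff g = 1) {n : ℕ}
    (hn : n ≠ 0) (h : f ^ n = g ^ n) : f = g := by
  have h1 : (∑ i ∈ Finset.range n, f ^ i * g ^ (n - 1 - i)) * (f - g) = 0 := by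
    rw [(Commute.all f g).geom_sum₂_mul, h, sub_self]
  have h2 : IsUnit (∑ i ∈ Finset.range n, f ^ i * g ^ (n - 1 - i)) := by
    rw [isUnit_iff_constantCoeff, map_sum]
    simp only [map_mul, map_pow, hf, hg, one_pow, mul_one, Finset.sum_const, Finset.card_range,
      nsmul_eq_mul]
    have h3 : IsUnit (algebraMap ℚ A n) := (IsUnit.mk0 _ (Nat.cast_ne_zero.2 hn)).map _
    rwa [map_natCast] at h3
  exact sub_eq_zero.1 (h2.mul_right_eq_zero.1 h1)

/-- The denominator is cleared by the power `q.den`; the extra factor `f ^ |q.num|` keeps all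
exponents nonnegative when `q` is negative. -/
theorem ratPow_pow_eq {f : A⟦X⟧} (hf : constantCoeff f = 1) (q : ℚ) :
    ratPow f q ^ q.den * f ^ q.num.natAbs = f ^ (q.num + q.num.natAbs).toNat := by
  rw [← ratPow_nat_mul hf, ← ratPow_natCast hf, ← ratPow_natCast hf, ← ratPow_add hf]
  congr 1
  have h2 : ((q.num + q.num.natAbs).toNat : ℤ) = q.num + q.num.natAbs :=
    Int.toNat_of_nonneg (by omega)
  rw [← Int.cast_natCast (R := ℚ) (q.num + q.num.natAbs).toNat, h2, Int.cast_add,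
    Int.cast_natCast, mul_comm, Rat.mul_den_eq_num]

/-- Rational powers are characterized by their integral powers. -/
theorem eq_ratPow_of_pow {f g : A⟦X⟧} (hf : constantCoeff f = 1) (hg : constantCoeff g = 1) (q : ℚ)
    (h : g ^ q.den * f ^ q.num.natAbs = f ^ (q.num + q.num.natAbs).toNat) : g = ratPow f q := by
  refine eq_of_pow_eq hg (constantCoeff_ratPow hf q) q.den_ne_zero ?_
  have h2 : IsUnit (f ^ q.num.natAbs) := by
    rw [isUnit_iff_constantCoeff, map_pow, hf, one_pow]; exact isUnit_one
  exact h2.mul_right_cancel (h.trans (ratPow_pow_eq hf q).symm)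

theorem ratPow_mul {f g : A⟦X⟧} (hf : constantCoeff f = 1) (hg : constantCoeff g = 1) (q : ℚ) :
    ratPow (f * g) q = ratPow f q * ratPow g q := by
  refine (eq_ratPow_of_pow (by rw [map_mul, hf, hg, mul_one])
    (by rw [map_mul, constantCoeff_ratPow hf, constantCoeff_ratPow hg, mul_one]) q ?_).symm
  rw [mul_pow, mul_pow, mul_pow, ← ratPow_pow_eq hf, ← ratPow_pow_eq hg]
  ring

/-- Ring homomorphisms of power series rings commute with rational powers. -/
theorem map_ratPow {B : Type*} [CommRing B] [Algebra ℚ B] (Φ : A⟦X⟧ →+* B⟦X⟧)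
    (hΦ : ∀ f, constantCoeff f = 1 → constantCoeff (Φ f) = 1) {f : A⟦X⟧}
    (hf : constantCoeff f = 1) (q : ℚ) : Φ (ratPow f q) = ratPow (Φ f) q := by
  refine eq_ratPow_of_pow (hΦ f hf) (hΦ _ (constantCoeff_ratPow hf q)) q ?_
  rw [← map_pow, ← map_pow, ← map_pow, ← map_mul, ratPow_pow_eq hf]

theorem constantCoeff_prod_ratPow {ι : Type*} [Fintype ι] {f : ι → A⟦X⟧}
    (hf : ∀ i, constantCoeff (f i) = 1) (q : ι → ℚ) :
    constantCoeff (∏ i, ratPow (f i) (q i)) = 1 := by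
  rw [map_prod]
  exact Finset.prod_eq_one fun i _ => constantCoeff_ratPow (hf i) _

/-- Write `f = (f/g) g`. The quotient is congruent to `1`, hence so are its powers by
`dvd_ratPow_sub_one`. -/
theorem modX_ratPow {L : ℕ} {f g : A⟦X⟧} (hf : constantCoeff f = 1) (hg : constantCoeff g = 1)
    (h : modX A L f = modX A L g) (q : ℚ) : modX A L (ratPow f q) = modX A L (ratPow g q) := by
  have hi := ratPow_mul_neg hg 1
  rw [ratPow_one hg] at hi
  have hc := constantCoeff_ratPow hg (-1)
  set i := ratPow g (-1)
  have hu : constantCoeff (f * i) = 1 := by rw [map_mul, hf, hc, mul_one]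
  have h1 : modX A L (ratPow (f * i) q) = 1 := by
    obtain ⟨k, hk⟩ := dvd_ratPow_sub_one hu q
    have h2 := congrArg (modX A L) hk
    rw [map_mul, map_sub, map_sub, map_mul, h, ← map_mul, hi, map_one, sub_self, zero_mul] at h2
    exact sub_eq_zero.1 h2
  have h2 : f = f * i * g := by rw [mul_assoc, mul_comm i, hi, mul_one]
  rw [h2, ratPow_mul hu hg, map_mul, h1, one_mul]

end RatPow

/-! ## Invariant charges -/

section Charge

open PowerSeries

variable {T : FieldTheory} {A : Type*} [CommRing A] [Algebra ℚ A]

/-- The product of the powers of the propagators attached to `r`. -/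
def legs (G : T.R → A⟦X⟧) (r : T.R) : A⟦X⟧ :=
  ∏ e, ratPow (G (Sum.inr e)) ((T.lines r e : ℚ) / 2)

/-- The expression of `X_v` in terms of the Green's functions. -/
def charge (G : T.R → A⟦X⟧) (v : T.Vert) : A⟦X⟧ :=
  ratPow (G (Sum.inl v) * ratPow (legs G (Sum.inl v)) (-1))
    (1 / ((T.valence (Sum.inl v) : ℚ) - 2))

variable {G G' : T.R → A⟦X⟧} (hG : ∀ r, constantCoeff (G r) = 1)
  (hG' : ∀ r, constantCoeff (G' r) = 1)

include hG

theorem constantCoeff_legs (r : T.R) : constantCoeff (legs G r) = 1 :=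
  constantCoeff_prod_ratPow (fun _ => hG _) _

theorem constantCoeff_charge_aux (v : T.Vert) :
    constantCoeff (G (Sum.inl v) * ratPow (legs G (Sum.inl v)) (-1)) = 1 := by
  rw [map_mul, hG, constantCoeff_ratPow (constantCoeff_legs hG _), mul_one]

theorem constantCoeff_charge (v : T.Vert) : constantCoeff (charge G v) = 1 :=
  constantCoeff_ratPow (constantCoeff_charge_aux hG v) _

theorem charge_pow (v : T.Vert) :
    legs G (Sum.inl v) * charge G v ^ (T.valence (Sum.inl v) - 2) = G (Sum.inl v) := by
  have h := T.three_le_valence v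
  have h1 : ((T.valence (Sum.inl v) - 2 : ℕ) : ℚ) * (1 / ((T.valence (Sum.inl v) : ℚ) - 2)) = 1 := by
    rw [Nat.cast_sub (by omega), Nat.cast_ofNat, mul_one_div_cancel]
    have : (3 : ℚ) ≤ T.valence (Sum.inl v) := by exact_mod_cast h
    linarith
  have h2 : charge G v ^ (T.valence (Sum.inl v) - 2) =
      G (Sum.inl v) * ratPow (legs G (Sum.inl v)) (-1) := by
    rw [charge, ← ratPow_nat_mul (constantCoeff_charge_aux hG v), h1]
    exact ratPow_one (constantCoeff_charge_aux hG v)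
  have h3 := ratPow_mul_neg (constantCoeff_legs hG (Sum.inl v)) 1
  rw [ratPow_one (constantCoeff_legs hG _)] at h3
  rw [h2, mul_left_comm, h3, mul_one]

theorem legs_inr (e : T.Edge) : legs G (Sum.inr e) = G (Sum.inr e) := by
  rw [legs, Finset.prod_eq_single e]
  · simp [FieldTheory.lines, ratPow_one (hG _)]
  · intro e' _ he
    simp [FieldTheory.lines, he, ratPow_zero (hG _)]
  · simp

theorem map_charge {B : Type*} [CommRing B] [Algebra ℚ B] (Φ : A⟦X⟧ →+* B⟦X⟧)
    (hΦ : ∀ f, constantCoeff f = 1 → constantCoeff (Φ f) = 1) (v : T.Vert) :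
    Φ (charge G v) = charge (fun r => Φ (G r)) v := by
  rw [charge, map_ratPow Φ hΦ (constantCoeff_charge_aux hG v), map_mul,
    map_ratPow Φ hΦ (constantCoeff_legs hG _), legs, map_prod]
  simp_rw [map_ratPow Φ hΦ (hG _)]
  rfl

include hG'

theorem charge_mul (v : T.Vert) :
    charge (fun r => G r * G' r) v = charge G v * charge G' v := by
  rw [charge, charge, charge, ← ratPow_mul (constantCoeff_charge_aux hG v)
    (constantCoeff_charge_aux hG' v)]
  simp_rw [legs, ratPow_mul (hG _) (hG' _)]
  rw [Finset.prod_mul_distrib, ratPow_mul (constantCoeff_prod_ratPow (fun _ => hG _) _)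
    (constantCoeff_prod_ratPow (fun _ => hG' _) _)]
  congr 1
  exact mul_mul_mul_comm _ _ _ _

theorem modX_charge {L : ℕ} (h : ∀ r, modX A L (G r) = modX A L (G' r)) (v : T.Vert) :
    modX A L (charge G v) = modX A L (charge G' v) := by
  refine modX_ratPow (constantCoeff_charge_aux hG v) (constantCoeff_charge_aux hG' v) ?_ _
  rw [map_mul, map_mul, h]
  congr 1
  refine modX_ratPow (constantCoeff_legs hG _) (constantCoeff_legs hG' _) ?_ _
  rw [legs, legs, map_prod, map_prod]
  exact Finset.prod_congr rfl fun e _ => modX_ratPow (hG _) (hG' _) (h _) _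

end Charge

end FeynmanHopf

end

/-! ### Cancellation of propagators and the convolution formula for charges. -/

noncomputable section

namespace FeynmanHopf

open scoped Classical

variable {T : FieldTheory}

/-! ## Insertions and invariant charges -/

theorem Graph.card_lbl (Γ : Graph T) (e : T.Edge) :
    Nat.card {h : Γ.Hf // Γ.lbl h = e} = ∑ w, T.N (Γ.typ w) e := by
  rw [Nat.card_congr (Equiv.sigmaFiberEquiv fun h : {h : Γ.Hf // Γ.lbl h = e} => Γ.src h.1).symm,
    Nat.card_sigma]
  refine Finset.sum_congr rfl fun w _ => ?_
  rw [← Γ.valence w e]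
  exact Nat.card_congr ⟨fun h => ⟨h.1.1, h.2, h.1.2⟩, fun h => ⟨⟨h.1, h.2.2⟩, h.2.1⟩,
    fun _ => rfl, fun _ => rfl⟩

/-- The half-lines of type `e` are counted once by their vertices and once as external lines or
halves of internal lines. -/
theorem LegGraph.sum_lines {r : T.R} (Γ : LegGraph T r) (e : T.Edge) :
    ∑ w, T.N (Γ.graph.typ w) e =
      T.lines r e + 2 * Nat.card {l : Γ.graph.Lines // Γ.graph.lbl l.1 = e} := by
  rw [← Γ.graph.card_lbl, ← Γ.graph.card_internal_eq (fun h => Γ.graph.lbl h = e)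
    fun h => by rw [Γ.graph.lbl_σ], ← Γ.hasResidue e, ← Nat.card_sum]
  refine Nat.card_congr ⟨fun h => if h0 : Γ.graph.σ h.1 = h.1 then Sum.inl ⟨⟨h.1, h0⟩, h.2⟩
    else Sum.inr ⟨h.1, h0, h.2⟩, Sum.elim (fun h => ⟨h.1.1, h.2⟩) fun h => ⟨h.1, h.2.2⟩, ?_, ?_⟩
  · intro h
    dsimp only
    split_ifs <;> rfl
  · rintro (h | h)
    · simp [h.1.2]
    · simp [h.2.1]

section

open PowerSeries

theorem ratPow_sum {A : Type*} [CommRing A] [Algebra ℚ A] {f : A⟦X⟧}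
    (hf : constantCoeff f = 1) {ι : Type*} (s : Finset ι) (q : ι → ℚ) :
    ratPow f (∑ i ∈ s, q i) = ∏ i ∈ s, ratPow f (q i) := by
  induction s using Finset.induction_on with
  | empty => simp [ratPow_zero hf]
  | insert i s hi ih => rw [Finset.sum_insert hi, Finset.prod_insert hi, ratPow_add hf, ih]

/-- At each internal line two square roots of the propagator meet; one is left over for each
external line. -/
theorem prod_legs {A : Type*} [CommRing A] [Algebra ℚ A] {G : T.R → A⟦X⟧}
    (hG : ∀ r, constantCoeff (G r) = 1) {r : T.R} (Γ : LegGraph T r) :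
    ∏ w, legs G (Sum.inl (Γ.graph.typ w)) =
      legs G r * ∏ l : Γ.graph.Lines, G (Sum.inr (Γ.graph.lbl l.1)) := by
  simp_rw [legs]
  rw [Finset.prod_comm, ← Finset.prod_fiberwise' Finset.univ
    (fun l : Γ.graph.Lines => Γ.graph.lbl l.1) fun e => G (Sum.inr e), ← Finset.prod_mul_distrib]
  refine Finset.prod_congr rfl fun e _ => ?_
  rw [← ratPow_sum (hG _), Finset.prod_const, ← ratPow_natCast (hG _), ← ratPow_add (hG _)]
  congr 1
  have h := congrArg (Nat.cast (R := ℚ)) (Γ.sum_lines e)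
  rw [Nat.card_eq_fintype_card, Fintype.card_subtype] at h
  push_cast at h
  rw [← Finset.sum_div]
  change (∑ w, (T.N (Γ.graph.typ w) e : ℚ)) / 2 = _
  rw [h]
  ring

variable {K : Type*} [Field K] [Algebra ℚ K] (C U : H T →ₐ[ℚ] K)

/-- Each vertex function is its legs times a power of its charge. The propagators that the legs
produce on internal lines cancel the inverse propagators of the chains. -/
theorem insSeries_eq {r : T.R} (Γ : LegGraph T r) :
    insSeries C Γ = legs (gs C) r *
      ∏ w, charge (gs C) (Γ.graph.typ w) ^ (T.valence (Sum.inl (Γ.graph.typ w)) - 2) := by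
  have hG := constantCoeff_gs C
  have h1 : ∏ w, gs C (Sum.inl (Γ.graph.typ w)) = (∏ w, legs (gs C) (Sum.inl (Γ.graph.typ w))) *
      ∏ w, charge (gs C) (Γ.graph.typ w) ^ (T.valence (Sum.inl (Γ.graph.typ w)) - 2) := by
    rw [← Finset.prod_mul_distrib]
    exact Finset.prod_congr rfl fun w _ => (charge_pow hG _).symm
  have h2 : (∏ l : Γ.graph.Lines, gs C (Sum.inr (Γ.graph.lbl l.1))) *
      ∏ l : Γ.graph.Lines, (gs C (Sum.inr (Γ.graph.lbl l.1)))⁻¹ = 1 := by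
    rw [← Finset.prod_mul_distrib]
    exact Finset.prod_eq_one fun l _ => PowerSeries.mul_inv_cancel _
      (by rw [hG]; exact one_ne_zero)
  rw [insSeries, h1, prod_legs hG, mul_right_comm, mul_assoc (legs _ _), h2, mul_one]

/-- The Green's function in terms of a common charge of the vertices. -/
theorem modX_legs_mul {L : ℕ} {Y : K⟦X⟧}
    (hY : ∀ v : T.Vert, modX K L (charge (gs C) v) = modX K L Y) (r : T.R) :
    modX K L (legs (gs C) r * Y ^ (T.valence r - 2)) = modX K L (gs C r) := by
  rcases r with v | e
  · rw [map_mul, map_pow, ← hY v, ← map_pow, ← map_mul, charge_pow (constantCoeff_gs C)]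
  · rw [T.valence_edge, legs_inr (constantCoeff_gs C), pow_zero, mul_one]

/-- With a common charge, the exponents `N(w) - 2` add up to `N(r) - 2 + 2 L(Γ)`; the first part
recombines with the legs of `r` to `G^r`. -/
theorem modX_insSeries {L : ℕ} {Y : K⟦X⟧}
    (hY : ∀ v : T.Vert, modX K L (charge (gs C) v) = modX K L Y) {r : T.R} {Γ : LegGraph T r}
    (hΓ : Γ.graph.OnePI) :
    modX K L (insSeries C Γ) = modX K L (gs C r * Y ^ (2 * Γ.graph.loops)) := by
  have h1 : ∑ w, (T.valence (Sum.inl (Γ.graph.typ w)) - 2) =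
      T.valence r - 2 + 2 * Γ.graph.loops := by
    have h2 := LegGraph.couplingOrder hΓ
    have h3 := T.two_le_valence r
    rw [Graph.couplingOrder, finsum_eq_sum_of_fintype] at h2
    omega
  rw [map_mul, ← modX_legs_mul C hY r, ← map_mul, mul_assoc, ← pow_add, ← h1, insSeries_eq,
    ← Finset.prod_pow_eq_pow_sum, map_mul, map_mul, map_prod, map_prod]
  simp_rw [map_pow, hY]

theorem modX_subst {A : Type*} [CommRing A] {L : ℕ} {a f g : A⟦X⟧} (ha : constantCoeff a = 0)
    (h : modX A L f = modX A L g) : modX A L (f.subst a) = modX A L (g.subst a) := by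
  have hs : HasSubst a := HasSubst.of_constantCoeff_zero' ha
  rw [modX, Ideal.Quotient.eq, Ideal.mem_span_singleton] at h ⊢
  obtain ⟨k, hk⟩ := h
  rw [← coe_substAlgHom hs, ← map_sub, hk, map_mul, map_pow, substAlgHom_X hs]
  exact Dvd.dvd.mul_right (pow_dvd_pow_of_dvd (X_dvd_iff.2 ha) _) _

theorem constantCoeff_X_mul {A : Type*} [CommRing A] (Y : A⟦X⟧) :
    constantCoeff (X * Y) = 0 := by
  rw [map_mul, constantCoeff_X, zero_mul]

/-- The Green's functions of a convolution product, if the charges of the vertices agree to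
order `L`. -/
theorem modX_gs_conv {L : ℕ} {Y : K⟦X⟧}
    (hY : ∀ v : T.Vert, modX K L (charge (gs C) v) = modX K L Y) (r : T.R) :
    modX K (L + 1) (gs (conv C U) r) =
      modX K (L + 1) (gs C r * (gs U r).subst (X * Y ^ 2)) := by
  have ha := constantCoeff_X_mul (Y ^ 2)
  have hs : HasSubst (X * Y ^ 2) := HasSubst.of_constantCoeff_zero' ha
  refine modX_eq_iff.2 fun m hm => ?_
  have h1 : modX K (m + 1) (gs U r) =
      modX K (m + 1) (1 + (sign r : PowerSeries K) * graphSeries U m r) :=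
    modX_eq_iff.2 fun k hk => coeff_gs U (Nat.lt_succ_iff.1 hk) r
  have h2 := congrArg (modX K (m + 1) (gs C r) * ·) (modX_subst ha h1)
  simp only [← map_mul] at h2
  have h6 : (1 + (sign r : PowerSeries K) * graphSeries U m r).subst (X * Y ^ 2) =
      1 + (sign r : PowerSeries K) * ∑ c : {c : LClass T r // c.out.graph.loops ≤ m},
        PowerSeries.C (U c.1.term) * (X * Y ^ 2) ^ c.1.out.graph.loops := by
    rw [← coe_substAlgHom hs, map_add, map_one, map_mul, map_intCast, graphSeries, map_sum]
    congr 2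
    refine Finset.sum_congr rfl fun c _ => ?_
    rw [map_mul, map_pow, substAlgHom_X hs, coe_substAlgHom hs]
    congr 1
    exact subst_C _
  rw [modX_eq_iff.1 h2 m (Nat.lt_succ_self m), coeff_gs_conv, h6, mul_add, mul_one,
    map_add (coeff m), mul_left_comm, ← zsmul_eq_mul, ← zsmul_eq_mul, map_zsmul]
  congr 2
  rw [Finset.mul_sum, map_sum]
  refine Finset.sum_congr rfl fun c _ => ?_
  have h3 := c.2
  have h4 := c.1.out.onePI.not_tree
  rw [mul_left_comm, coeff_C_mul, mul_pow, ← pow_mul, mul_left_comm, coeff_X_pow_mul',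
    if_pos h3]
  congr 1
  -- This is where one order is gained: the graph has at least one loop, so only coefficients below
  -- order `L` of its insertion series enter.
  exact modX_eq_iff.1 (modX_insSeries C hY c.1.out.onePI) _ (by omega)

theorem constantCoeff_subst_eq {A : Type*} [CommRing A] {a f : A⟦X⟧} (ha : constantCoeff a = 0)
    (hf : constantCoeff f = 1) : constantCoeff (f.subst a) = 1 := by
  have h1 : modX A 1 f = modX A 1 1 := modX_eq_iff.2 fun m hm => by
    obtain rfl : m = 0 := by omega
    rw [coeff_zero_eq_constantCoeff_apply, hf, coeff_zero_one]
  have h2 := modX_eq_iff.1 (modX_subst ha h1) 0 Nat.one_pos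
  have hs : HasSubst a := HasSubst.of_constantCoeff_zero' ha
  rw [← coe_substAlgHom hs, map_one, coeff_zero_one] at h2
  rwa [← coeff_zero_eq_constantCoeff_apply, ← coe_substAlgHom hs]

theorem map_Xv (φ : H T →ₐ[ℚ] K) (v : T.Vert) :
    PowerSeries.map (φ : H T →+* K) (Xv v) = charge (gs φ) v :=
  map_charge constantCoeff_green (PowerSeries.map (φ : H T →+* K))
    (fun f hf => by
      rw [← coeff_zero_eq_constantCoeff_apply, coeff_map, coeff_zero_eq_constantCoeff_apply, hf,
        map_one]) v

/-- The charges of a convolution product. -/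
theorem modX_charge_conv {L : ℕ} {Y : K⟦X⟧}
    (hY : ∀ v : T.Vert, modX K L (charge (gs C) v) = modX K L Y) (v : T.Vert) :
    modX K (L + 1) (charge (gs (conv C U)) v) =
      modX K (L + 1) (charge (gs C) v * (charge (gs U) v).subst (X * Y ^ 2)) := by
  have ha := constantCoeff_X_mul (Y ^ 2)
  have hs : HasSubst (X * Y ^ 2) := HasSubst.of_constantCoeff_zero' ha
  let S : K⟦X⟧ →+* K⟦X⟧ := substAlgHom (R := K) hs
  have hS' : ∀ f : K⟦X⟧, S f = f.subst (X * Y ^ 2) := fun f => by rw [← coe_substAlgHom hs]; rfl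
  have hS : ∀ f : K⟦X⟧, constantCoeff f = 1 → constantCoeff (S f) = 1 := fun f hf => by
    rw [hS']; exact constantCoeff_subst_eq ha hf
  have hSG : ∀ r, constantCoeff (S (gs U r)) = 1 := fun r => hS _ (constantCoeff_gs U r)
  have h1 := modX_charge (G' := fun r => gs C r * S (gs U r)) (constantCoeff_gs (conv C U))
    (fun r => by rw [map_mul, constantCoeff_gs, hSG, mul_one])
    (fun r => by rw [hS']; exact modX_gs_conv C U hY r) v
  rw [h1, charge_mul (constantCoeff_gs C) hSG, ← map_charge (constantCoeff_gs U) S hS, hS']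

end

end FeynmanHopf

end

/-! ### The coupling constant, the induction on the loop order, and Dyson's formula. -/

noncomputable section

namespace FeynmanHopf

open scoped Classical

variable {T : FieldTheory}

open PowerSeries

/-! ## Green's functions in the coupling constant -/

section Coupling

variable {K : Type*} [Field K] [Algebra ℚ K]

/-- The coupling order of a graph is `2 L + N(r) - 2`, so the series in `g` is the loop series at
`g²`, shifted by `N(r) - 2`. -/
theorem greenAt_eq (φ : H T →ₐ[ℚ] K) (r : T.R) :
    greenAt φ r = X ^ (T.valence r - 2) * PowerSeries.expand 2 two_ne_zero (gs φ r) := by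
  have hr := T.two_le_valence r
  have hc : ∀ c : LClass T r, c.out.graph.couplingOrder = 2 * c.out.graph.loops +
      (T.valence r - 2) := fun c => by
    have h : c.out.graph.couplingOrder + 2 = 2 * c.out.graph.loops + T.valence r :=
      LegGraph.couplingOrder (Γ := c.out.leg) c.out.onePI
    omega
  ext n
  rw [greenAt, map_add, coeff_X_pow, map_zsmul, coeff_mk, coeff_X_pow_mul']
  by_cases h1 : T.valence r - 2 ≤ n ∧ 2 ∣ n - (T.valence r - 2)
  · obtain ⟨h1, L, hL⟩ := h1
    have h2 : (∑ᶠ c : {c : LClass T r // c.out.graph.couplingOrder = n}, φ c.1.term) =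
        ∑ᶠ c : {c : LClass T r // c.out.graph.loops = L}, φ c.1.term :=
      finsum_eq_of_bijective (fun c => ⟨c.1, by have := hc c.1; have := c.2; omega⟩)
        ⟨fun c c' h => Subtype.ext (congrArg (fun z => z.1) h),
          fun c => ⟨⟨c.1, by have := hc c.1; have := c.2; omega⟩, rfl⟩⟩ fun _ => rfl
    rw [if_pos h1, hL, coeff_expand_mul, coeff_gs φ le_rfl, h2, map_add, ← zsmul_eq_mul,
      map_zsmul, coeff_graphSeries φ le_rfl, coeff_one]
    congr 1
    exact if_congr (by omega) rfl rfl
  · have : IsEmpty {c : LClass T r // c.out.graph.couplingOrder = n} :=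
      ⟨fun c => h1 (by have := hc c.1; have := c.2; omega)⟩
    rw [finsum_of_isEmpty, smul_zero, add_zero, if_neg (by omega)]
    split_ifs with h2
    · rw [coeff_expand_of_not_dvd _ _ _ fun h => h1 ⟨h2, h⟩]
    · rfl

theorem prod_Z (C : H T →ₐ[ℚ] K) (r : T.R) :
    ∏ e, ratPow (Z C e) ((T.lines r e : ℚ) / 2) =
      PowerSeries.expand 2 two_ne_zero (legs (gs C) r) := by
  rw [legs, map_prod]
  refine Finset.prod_congr rfl fun e _ => ?_
  rw [Z, greenAt_eq, T.valence_edge, pow_zero, one_mul]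
  exact (map_ratPow (PowerSeries.expand 2 two_ne_zero : K⟦X⟧ →ₐ[K] K⟦X⟧).toRingHom
    (fun f hf => (constantCoeff_expand 2 two_ne_zero f).trans hf) (constantCoeff_gs C _) _).symm

/-- If `g₀ = Y(g²) g`, then `g₀²` is `t Y(t)²` at `t = g²`. This matches the substitution in the
convolution formula. -/
theorem greenAt_subst (U : H T →ₐ[ℚ] K) (Y : K⟦X⟧) (r : T.R) :
    (greenAt U r).subst (PowerSeries.expand 2 two_ne_zero Y * X) =
      PowerSeries.expand 2 two_ne_zero (Y ^ (T.valence r - 2) * (gs U r).subst (X * Y ^ 2)) *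
        X ^ (T.valence r - 2) := by
  have hb : HasSubst (PowerSeries.expand 2 two_ne_zero Y * X) :=
    HasSubst.of_constantCoeff_zero' (by rw [map_mul, constantCoeff_X, mul_zero])
  have ha : HasSubst (X * Y ^ 2) := HasSubst.of_constantCoeff_zero' (constantCoeff_X_mul _)
  have h2 : HasSubst (X ^ 2 : K⟦X⟧) := HasSubst.X_pow two_ne_zero
  have h3 : (PowerSeries.expand 2 two_ne_zero (gs U r)).subst
      (PowerSeries.expand 2 two_ne_zero Y * X) =
      PowerSeries.expand 2 two_ne_zero ((gs U r).subst (X * Y ^ 2)) := by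
    rw [expand_apply _ _ (gs U r), expand_apply _ _ (subst (X * Y ^ 2) (gs U r)),
      subst_comp_subst_apply h2 hb, subst_comp_subst_apply ha h2]
    congr 1
    rw [subst_pow hb, subst_X hb, ← expand_apply 2 two_ne_zero, map_mul, map_pow, expand_X]
    ring
  rw [greenAt_eq, subst_mul hb, subst_pow hb, subst_X hb, h3, map_mul, map_pow]
  ring

end Coupling

/-! ## The Slavnov–Taylor ideal and the Birkhoff decomposition -/

theorem gs_ε (r : T.R) : gs (ε T) r = 1 := by
  ext L
  have h : graphSeries (ε T) L r = 0 := by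
    refine Finset.sum_eq_zero fun c _ => ?_
    have hg : c.1.out.graph.IsGenerator := ⟨c.1.out.onePI, r, c.1.out.leg.hasResidue⟩
    have h1 : ε T (gr c.1.out.graph) = 0 := by
      rw [gr, dif_pos hg]; exact MvPolynomial.aeval_X _ _
    rw [LClass.term, map_smul, h1, smul_zero, map_zero, zero_mul]
  rw [coeff_gs (ε T) le_rfl, h, mul_zero, add_zero]

theorem charge_one {A : Type*} [CommRing A] [Algebra ℚ A] (v : T.Vert) :
    charge (fun _ : T.R => (1 : A⟦X⟧)) v = 1 := by
  have h : ∀ q : ℚ, ratPow (1 : A⟦X⟧) q = 1 := fun q => by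
    have h1 := dvd_ratPow_sub_one (map_one (constantCoeff (R := A))) q
    rw [sub_self, zero_dvd_iff] at h1
    exact sub_eq_zero.1 h1
  simp [charge, legs, h]

/-- Puts the generators of the ideal in the kernel of the counit, where `C` takes values in pole
parts. -/
theorem ε_coeff_Xv (v v' : T.Vert) (L : ℕ) : ε T (coeff L (Xv v - Xv v')) = 0 := by
  have h : ∀ v : T.Vert, PowerSeries.map (ε T : H T →+* ℚ) (Xv v) = 1 := fun v => by
    rw [map_Xv, ← charge_one v]
    exact congrArg (charge · v) (funext gs_ε)
  change (ε T : H T →+* ℚ) _ = 0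
  rw [← coeff_map, map_sub, h, h, sub_self, map_zero]

variable {K : Type*} [Field K] [Algebra ℚ K] (C U : H T →ₐ[ℚ] K)

theorem coeff_charge_sub (φ : H T →ₐ[ℚ] K) (v v' : T.Vert) (L : ℕ) :
    coeff L (charge (gs φ) v) - coeff L (charge (gs φ) v') = φ (coeff L (Xv v - Xv v')) := by
  rw [← map_Xv, ← map_Xv, ← map_sub, ← map_sub, coeff_map]; rfl

theorem charge_eq_of_stIdeal (hU : ∀ x ∈ stIdeal T, U x = 0) (v v' : T.Vert) :
    charge (gs U) v = charge (gs U) v' := by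
  ext L
  exact sub_eq_zero.1 ((coeff_charge_sub U v v' L).trans
    (hU _ (Ideal.subset_span ⟨v, v', L, rfl⟩)))

/-- If the charges agree for `U`, and to order `L` for `C`, then their differences at order `L`
are not changed by the convolution with `U`. -/
theorem conv_coeff_Xv (hU : ∀ x ∈ stIdeal T, U x = 0) {L : ℕ}
    (hC : ∀ v v' : T.Vert, modX K L (charge (gs C) v) = modX K L (charge (gs C) v'))
    (v v' : T.Vert) :
    conv C U (coeff L (Xv v - Xv v')) = C (coeff L (Xv v - Xv v')) := by
  have h1 := fun w => modX_eq_iff.1 (modX_charge_conv C U (fun w => hC w v) w) L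
    (Nat.lt_succ_self L)
  -- Since `U(X_v) = U(X_v')`, the substituted factor is common, and only the difference of the
  -- `C`-charges remains.
  rw [← coeff_charge_sub, ← coeff_charge_sub, h1, h1, charge_eq_of_stIdeal U hU v' v, ← map_sub,
    ← map_sub, ← sub_mul]
  have h2 := hC v v'
  rw [modX, Ideal.Quotient.eq, Ideal.mem_span_singleton] at h2
  obtain ⟨k, hk⟩ := h2
  -- The difference is divisible by `X ^ L` and the common factor has constant coefficient `1`, so
  -- the coefficient of order `L` is unchanged.
  rw [hk, mul_assoc, coeff_X_pow_mul', coeff_X_pow_mul', if_pos le_rfl, if_pos le_rfl, Nat.sub_self,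
    coeff_zero_eq_constantCoeff_apply, coeff_zero_eq_constantCoeff_apply, map_mul,
    constantCoeff_subst_eq (constantCoeff_X_mul _) (constantCoeff_charge (constantCoeff_gs U) v),
    mul_one]

/-- The counterterm satisfies the Slavnov–Taylor identities order by order in the loop number. -/
theorem IsBirkhoff.modX_charge {U C R : H T →ₐ[ℚ] LaurentSeries ℂ} (hU : ∀ x ∈ stIdeal T, U x = 0) (hB : IsBirkhoff U C R)
    (L : ℕ) : ∀ v v' : T.Vert,
      modX (LaurentSeries ℂ) L (charge (gs C) v) = modX (LaurentSeries ℂ) L (charge (gs C) v') := by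
  induction L with
  | zero => exact fun v v' => modX_eq_iff.2 fun m hm => absurd hm (Nat.not_lt_zero m)
  | succ L ih =>
    intro v v'
    have h1 := conv_coeff_Xv C U hU ih v v'
    rw [← hB.conv_eq] at h1
    have h2 : C (coeff L (Xv v - Xv v')) = 0 := by
      -- The common value of `C` and `R` has no negative coefficients by regularity, and no others
      -- by the pole condition.
      ext n
      rcases lt_or_ge n 0 with hn | hn
      · rw [← h1]; exact hB.regular _ n hn
      · exact hB.pole _ (ε_coeff_Xv v v' L) n hn
    refine modX_eq_iff.2 fun m hm => ?_
    rcases Nat.lt_succ_iff_lt_or_eq.1 hm with hm | rfl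
    · exact modX_eq_iff.1 (ih v v') m hm
    · exact sub_eq_zero.1 ((coeff_charge_sub C v v' m).trans h2)

theorem eq_of_modX {A : Type*} [CommRing A] {f g : A⟦X⟧}
    (h : ∀ L, modX A (L + 1) f = modX A (L + 1) g) : f = g :=
  PowerSeries.ext fun L => modX_eq_iff.1 (h L) L (Nat.lt_succ_self L)

theorem IsBirkhoff.eq_zero_of_mem_stIdeal {U C R : H T →ₐ[ℚ] LaurentSeries ℂ}
    (hU : ∀ x ∈ stIdeal T, U x = 0) (hB : IsBirkhoff U C R) {x : H T} (hx : x ∈ stIdeal T) :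
    C x = 0 ∧ R x = 0 := by
  have h1 : stIdeal T ≤ RingHom.ker C ⊓ RingHom.ker R := by
    refine Ideal.span_le.2 ?_
    rintro _ ⟨v, v', L, rfl⟩
    have h2 : C (coeff L (Xv v - Xv v')) = 0 := by
      rw [← coeff_charge_sub, modX_eq_iff.1 (hB.modX_charge hU (L + 1) v v') L
        (Nat.lt_succ_self L), sub_self]
    refine ⟨h2, ?_⟩
    change R (coeff L (Xv v - Xv v')) = 0
    rw [hB.conv_eq, conv_coeff_Xv C U hU (hB.modX_charge hU L), h2]
  exact ⟨(h1 hx).1, (h1 hx).2⟩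

theorem IsBirkhoff.greenAt_eq {U C R : H T →ₐ[ℚ] LaurentSeries ℂ}
    (hU : ∀ x ∈ stIdeal T, U x = 0) (hB : IsBirkhoff U C R) (r : T.R) (v : T.Vert) :
    greenAt R r = (∏ e, ratPow (Z C e) ((T.lines r e : ℚ) / 2)) *
      (greenAt U r).subst (bareCoupling C v) := by
  have hC := hB.modX_charge hU
  -- The charges now agree to every order, so the truncated formulas become equalities with `Y =
  -- C(X_v)` for any chosen `v`.
  have h1 : gs R r = gs C r * (gs U r).subst (X * charge (gs C) v ^ 2) :=
    eq_of_modX fun L => by rw [hB.conv_eq]; exact modX_gs_conv C U (fun w => hC L w v) r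
  have h2 : legs (gs C) r * charge (gs C) v ^ (T.valence r - 2) = gs C r :=
    eq_of_modX fun L => modX_legs_mul C (fun w => hC (L + 1) w v) r
  have h3 : bareCoupling C v = PowerSeries.expand 2 two_ne_zero (charge (gs C) v) * X := by
    rw [bareCoupling, atCoupling, map_Xv]
  rw [prod_Z, h3, greenAt_subst, FeynmanHopf.greenAt_eq, h1, ← h2, mul_assoc (legs _ _), map_mul,
    mul_comm, mul_assoc]

end FeynmanHopf

end

theorem mainTheorem3 (T : FeynmanHopf.FieldTheory)
    (U C R : FeynmanHopf.H T →ₐ[ℚ] LaurentSeries ℂ)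
    (hU : ∀ x ∈ FeynmanHopf.stIdeal T, U x = 0)
    (hB : FeynmanHopf.IsBirkhoff U C R) :
    (∀ x ∈ FeynmanHopf.stIdeal T, C x = 0 ∧ R x = 0) ∧
    ∀ (r : T.R) (v : T.Vert),
      FeynmanHopf.greenAt R r =
        (∏ e, FeynmanHopf.ratPow (FeynmanHopf.Z C e) ((T.lines r e : ℚ) / 2)) *
          (FeynmanHopf.greenAt U r).subst (FeynmanHopf.bareCoupling C v) :=
  ⟨fun _ hx => hB.eq_zero_of_mem_stIdeal hU hx, hB.greenAt_eq hU⟩
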